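/- **Calculus.** Fix a countably infinite set of variables. The call-by-need letrec calculus with eager pairs has - expressions $M,N ::= x \mid \lambda x.M \mid M\,N \mid \mathsf{let\ rec}\ D\ \mathsf{in}\ M \mid \bullet \mid \langle M,N\rangle \mid \pi_i(M)$ with $i\in\{1,2\}$; - definitions $D ::= \epsilon \mid D, x=M$ (unordered, defining pairwise distinct variables, all of them in scope in all right-hand sides and in the body); - values $V ::= \lambda x.M \mid \bullet \mid \langle V_1,V_2\rangle$ and answers $A ::= V \mid \mathsf{let\ rec}\ D\ \mathsf{in}\ A$; - evaluation contexts $E ::= [\,] \mid E\,M \mid \mathsf{let\ rec}\ D\ \mathsf{in}\ E \mid \mathsf{let\ rec}\ x=E, D\ \mathsf{in}\ E'[x] \mid \mathsf{let\ rec}\ x'=E, D[x,x'], D\ \mathsf{in}\ E'[x] \mid \langle E,M\rangle \mid \langle V,E\rangle \mid \pi_i(E)$; - dependencies $D[x,x'] ::= x=E[x'] \mid D[x,x''],\, x''=E[x']$; $D[x,V]$ denotes $D[x,x']$ with the displayed last occurrence $x'$ replaced by $V$. A *program* is a closed expression. **Reduction semantics.** It works on $\alpha$-equivalence classes; contexts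 and rules are read on canonical representatives, in which all binding occurrences have pairwise distinct names. The rules are - $(\lambda x.M)N \mapsto \mathsf{let\ rec}\ x=N\ \mathsf{in}\ M$; - $(\mathsf{let\ rec}\ D\ \mathsf{in}\ A)N \mapsto \mathsf{let\ rec}\ D\ \mathsf{in}\ A\,N$; - $\mathsf{let\ rec}\ x=V,D\ \mathsf{in}\ E[x] \mapsto \mathsf{let\ rec}\ x=V,D\ \mathsf{in}\ E[V]$; - $\mathsf{let\ rec}\ D[x,x'],x'=V,D\ \mathsf{in}\ E[x] \mapsto \mathsf{let\ rec}\ D[x,V],x'=V,D\ \mathsf{in}\ E[x]$; - $\mathsf{let\ rec}\ x=(\mathsf{let\ rec}\ D\ \mathsf{in}\ A),D'\ \mathsf{in}\ E[x] \mapsto \mathsf{let\ rec}\ D,x=A,D'\ \mathsf{in}\ E[x]$; - $\mathsf{let\ rec}\ x'=(\mathsf{let\ rec}\ D\ \mathsf{in}\ A),D[x,x'],D'\ \mathsf{in}\ E[x] \mapsto \mathsf{let\ rec}\ D,x'=A,D[x,x'],D'\ \mathsf{in}\ E[x]$; - $\mathsf{let\ rec}\ D[x,x],D\ \mathsf{in}\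 E[x] \mapsto \mathsf{let\ rec}\ D[x,\bullet],D\ \mathsf{in}\ E[x]$; - $\mathsf{let\ rec}\ D[x',x'],D'[x,x'],D\ \mathsf{in}\ E[x] \mapsto \mathsf{let\ rec}\ D[x',\bullet],D'[x,x'],D\ \mathsf{in}\ E[x]$; - $\bullet\,M \mapsto \bullet$; - $\pi_i(\langle V_1,V_2\rangle) \mapsto V_i$; - $\pi_i(\mathsf{let\ rec}\ D\ \mathsf{in}\ A) \mapsto \mathsf{let\ rec}\ D\ \mathsf{in}\ \pi_i(A)$; - $\langle \mathsf{let\ rec}\ D\ \mathsf{in}\ A, M\rangle \mapsto \mathsf{let\ rec}\ D\ \mathsf{in}\ \langle A,M\rangle$; - $\langle V,\mathsf{let\ rec}\ D\ \mathsf{in}\ A\rangle \mapsto \mathsf{let\ rec}\ D\ \mathsf{in}\ \langle V,A\rangle$. Write $M\to N$ if $M=E[M']$, $N=E[N']$ and $M'\mapsto N'$, and let $\twoheadrightarrow$ be the reflexive transitive closure of $\to$. **Natural semantics.** It works on raw expressions. Heaps $\Psi,\Phi$ are finite mappings from variables to expressions, and judgments $\langle\Psi\rangle M \Downarrow \langle\Phi\rangle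 V$ are derived by the rules - $\langle\Psi\rangle V\Downarrow\langle\Psi\rangle V$; - if $\langle\Psi\rangle M_1\Downarrow\langle\Phi\rangle\lambda x.N$ and $\langle\Phi[x'\mapsto M_2]\rangle N[x'/x]\Downarrow\langle\Psi'\rangle V$ with $x'$ fresh, then $\langle\Psi\rangle M_1M_2\Downarrow\langle\Psi'\rangle V$; - if $x\in\mathrm{dom}\,\Psi$ and $\langle\Psi[x\mapsto\bullet]\rangle\Psi(x)\Downarrow\langle\Phi\rangle V$, then $\langle\Psi\rangle x\Downarrow\langle\Phi[x\mapsto V]\rangle V$; - if $\langle\Psi[x_i'\mapsto M_i']_{i}\rangle N'\Downarrow\langle\Phi\rangle V$, where $x_1',\dots,x_n'$ are fresh and pairwise distinct and $M_i'$, $N'$ arise from $M_i$, $N$ by substituting $x_1',\dots,x_n'$ for $x_1,\dots,x_n$, then $\langle\Psi\rangle\mathsf{let\ rec}\ x_1=M_1,\dots,x_n=M_n\ \mathsf{in}\ N\Downarrow\langle\Phi\rangle V$; - if $\langle\Psi\rangle M_1\Downarrow\langle\Phi\rangle\bullet$, then $\langle\Psi\rangle M_1M_2\Downarrow\langle\Phi\rangle\bullet$;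 - if $\langle\Psi\rangle M_1\Downarrow\langle\Psi_1\rangle V_1$ and $\langle\Psi_1\rangle M_2\Downarrow\langle\Psi_2\rangle V_2$, then $\langle\Psi\rangle\langle M_1,M_2\rangle\Downarrow\langle\Psi_2\rangle\langle V_1,V_2\rangle$; - if $\langle\Psi\rangle M\Downarrow\langle\Phi\rangle\langle V_1,V_2\rangle$, then $\langle\Psi\rangle\pi_i(M)\Downarrow\langle\Phi\rangle V_i$. Here a variable is fresh if it occurs neither in the heap at hand (in its domain or in a stored expression) nor in the expressions to which the rule is applied. Let $\Theta$ range over finite sequences of frames $\mathsf{let\ rec}\ D\ \mathsf{in}\ [\,]$; $\Theta[M]$ is $M$ wrapped in these frames, the first one outermost. If the variables defined in the frames of $\Theta$ are pairwise distinct, $\lfloor\Theta\rfloor$ is the heap consisting of all the bindings of all the frames. **Theorem.** For every program $M$: 1. if $M\twoheadrightarrow A$ for an answer $A$, then there exist $\Theta$ and a value $V$ such that $\Theta[V]$ and $A$ are $\alpha$-equivalent and $\langle\,\rangle M\Downarrow\langle\lfloor\Theta\rfloor\rangle V$; 2. if $\langle\,\rangle M\Downarrow\langle\Psi\rangle V$,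 then $M\twoheadrightarrow\Theta[V]$ for some $\Theta$ with $\lfloor\Theta\rfloor=\Psi$. -/

import Mathlib

namespace NeedRec

/-- Variables: a countably infinite set of names. -/
abbrev Var := ℕ

/-- Raw expressions of the call-by-need letrec calculus with pairs. A definition block
`x₁ = M₁, …, xₙ = Mₙ` is a list of bindings; its order is made irrelevant by `AlphaEq`, and
its names are pairwise distinct in a well-formed expression (`Expr.WF`). -/
inductive Expr : Type
  | var (x : Var)
  | lam (x : Var) (M : Expr)
  | app (M N : Expr)
  | letrec (D : List (Var × Expr)) (N : Expr)
  | bullet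
  | pair (M N : Expr)
  | prj (i : Fin 2) (M : Expr)

/-- Definition blocks `D`. -/
abbrev Defs := List (Var × Expr)

/-- The variables bound by a definition block. -/
abbrev names (D : Defs) : List Var := D.map Prod.fst

mutual
/-- Free variables. -/
def Expr.fv : Expr → Finset Var
  | .var x => {x}
  | .lam x M => M.fv.erase x
  | .app M N => M.fv ∪ N.fv
  | .letrec D N => (fvRhs D ∪ N.fv) \ (names D).toFinset
  | .bullet => ∅
  | .pair M N => M.fv ∪ N.fv
  | .prj _ M => M.fv
/-- Free variables of the right-hand sides of a block. -/
def fvRhs : List (Var × Expr) → Finset Var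
  | [] => ∅
  | (_, M) :: D => M.fv ∪ fvRhs D
end

mutual
/-- All variables that occur in an expression: free, bound or binding. -/
def Expr.vars : Expr → Finset Var
  | .var x => {x}
  | .lam x M => insert x M.vars
  | .app M N => M.vars ∪ N.vars
  | .letrec D N => varsDefs D ∪ N.vars
  | .bullet => ∅
  | .pair M N => M.vars ∪ N.vars
  | .prj _ M => M.vars
/-- All variables that occur in a block. -/
def varsDefs : List (Var × Expr) → Finset Var
  | [] => ∅
  | (x, M) :: D => insert x M.vars ∪ varsDefs D
end

mutual
/-- The list of all binding occurrences of variables in an expression. -/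
def Expr.binders : Expr → List Var
  | .var _ => []
  | .lam x M => x :: M.binders
  | .app M N => M.binders ++ N.binders
  | .letrec D N => bindersDefs D ++ N.binders
  | .bullet => []
  | .pair M N => M.binders ++ N.binders
  | .prj _ M => M.binders
/-- The binding occurrences of variables in a block, with the names that it defines. -/
def bindersDefs : List (Var × Expr) → List Var
  | [] => []
  | (x, M) :: D => x :: (M.binders ++ bindersDefs D)
end

mutual
/-- In every definition block, the defined variables are pairwise distinct. -/
def Expr.WF : Expr → Prop
  | .var _ => True
  | .lam _ M => M.WF
  | .app M N => M.WF ∧ N.WF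
  | .letrec D N => (names D).Nodup ∧ wfRhs D ∧ N.WF
  | .bullet => True
  | .pair M N => M.WF ∧ N.WF
  | .prj _ M => M.WF
/-- All right-hand sides of a block satisfy `Expr.WF`. -/
def wfRhs : List (Var × Expr) → Prop
  | [] => True
  | (_, M) :: D => M.WF ∧ wfRhs D
end

mutual
/-- `M.rename ρ` replaces every free occurrence of a variable `x` in `M` by `ρ x`. Binding
occurrences are left alone, so it is used only where the new names do not occur in `M`. -/
def Expr.rename (ρ : Var → Var) : Expr → Expr
  | .var x => .var (ρ x)
  | .lam x M => .lam x (M.rename (Function.update ρ x x))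
  | .app M N => .app (M.rename ρ) (N.rename ρ)
  | .letrec D N =>
      .letrec (renameRhs (fun y => if y ∈ names D then y else ρ y) D)
        (N.rename (fun y => if y ∈ names D then y else ρ y))
  | .bullet => .bullet
  | .pair M N => .pair (M.rename ρ) (N.rename ρ)
  | .prj i M => .prj i (M.rename ρ)
/-- Renaming of the right-hand sides of a block. -/
def renameRhs (ρ : Var → Var) : List (Var × Expr) → List (Var × Expr)
  | [] => []
  | (x, M) :: D => (x, M.rename ρ) :: renameRhs ρ D
end

/-- `M[x'/x]`. -/
def Expr.subst (M : Expr) (x' x : Var) : Expr := M.rename (Function.update id x x')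

/-- A program is a closed (well-formed) expression. -/
def Expr.IsProgram (M : Expr) : Prop := M.WF ∧ M.fv = ∅

/-- Values `V ::= λx.M | • | ⟨V₁, V₂⟩`. -/
inductive IsValue : Expr → Prop
  | lam (x : Var) (M : Expr) : IsValue (.lam x M)
  | bullet : IsValue .bullet
  | pair {V₁ V₂ : Expr} : IsValue V₁ → IsValue V₂ → IsValue (.pair V₁ V₂)

/-- Answers `A ::= V | let rec D in A`. -/
inductive IsAnswer : Expr → Prop
  | value {V : Expr} : IsValue V → IsAnswer V
  | letrec (D : Defs) {A : Expr} : IsAnswer A → IsAnswer (.letrec D A)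

/-! ### α-equivalence -/

/-- `x` (on the left) and `y` (on the right) denote the same variable, given the list of pairs
of binders that have been passed on the two sides, the innermost one first. -/
def VarMatch : List (Var × Var) → Var → Var → Prop
  | [], x, y => x = y
  | (a, b) :: ρ, x, y => (x = a ∧ y = b) ∨ (x ≠ a ∧ y ≠ b ∧ VarMatch ρ x y)

/-- α-equivalence relative to a list of pairs of corresponding binders. Blocks are unordered:
`D'` is a reordering of the block `D₂` on the right that matches `D₁` position by position. -/
inductive AlphaEqIn : List (Var × Var) → Expr → Expr → Prop
  | var {ρ : List (Var × Var)} {x y : Var} : VarMatch ρ x y → AlphaEqIn ρ (.var x) (.var y)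
  | lam {ρ : List (Var × Var)} {x y : Var} {M N : Expr} :
      AlphaEqIn ((x, y) :: ρ) M N → AlphaEqIn ρ (.lam x M) (.lam y N)
  | app {ρ : List (Var × Var)} {M₁ M₂ N₁ N₂ : Expr} :
      AlphaEqIn ρ M₁ M₂ → AlphaEqIn ρ N₁ N₂ → AlphaEqIn ρ (.app M₁ N₁) (.app M₂ N₂)
  | letrec {ρ : List (Var × Var)} {D₁ D₂ D' : Defs} {N₁ N₂ : Expr} :
      (names D₁).Nodup → (names D₂).Nodup → D₂.Perm D' → D₁.length = D'.length →
      (∀ (i : ℕ) (x y : Var) (M N : Expr), D₁[i]? = some (x, M) → D'[i]? = some (y, N) →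
        AlphaEqIn ((names D₁).zip (names D') ++ ρ) M N) →
      AlphaEqIn ((names D₁).zip (names D') ++ ρ) N₁ N₂ →
      AlphaEqIn ρ (.letrec D₁ N₁) (.letrec D₂ N₂)
  | bullet {ρ : List (Var × Var)} : AlphaEqIn ρ .bullet .bullet
  | pair {ρ : List (Var × Var)} {M₁ M₂ N₁ N₂ : Expr} :
      AlphaEqIn ρ M₁ M₂ → AlphaEqIn ρ N₁ N₂ → AlphaEqIn ρ (.pair M₁ N₁) (.pair M₂ N₂)
  | prj {ρ : List (Var × Var)} {i : Fin 2} {M N : Expr} :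
      AlphaEqIn ρ M N → AlphaEqIn ρ (.prj i M) (.prj i N)

/-- Two well-formed expressions belong to the same α-equivalence class (definition blocks being
unordered). -/
def AlphaEq (M N : Expr) : Prop := AlphaEqIn [] M N

/-- A canonical representative of its α-equivalence class: the binding occurrences use pairwise
distinct names, which are also distinct from the free variables. -/
def Expr.Canonical (M : Expr) : Prop := M.binders.Nodup ∧ ∀ x ∈ M.binders, x ∉ M.fv

/-! ### Reduction semantics -/

mutual
/-- Evaluation contexts `E`. -/
inductive Ctx : Type
  /-- `[]` -/
  | hole
  /-- `E M` -/
  | app (E : Ctx) (M : Expr)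
  /-- `let rec D in E` -/
  | letBody (D : Defs) (E : Ctx)
  /-- `let rec x = E, D in E'[x]` -/
  | letBind (x : Var) (E : Ctx) (D : Defs) (E' : Ctx)
  /-- `let rec x' = E, D[x,x'], D in E'[x]`, where `x` is the head of `Δ = D[x,·]` -/
  | letDep (x' : Var) (E : Ctx) (Δ : Dep) (D : Defs) (E' : Ctx)
  /-- `⟨E, M⟩` -/
  | pairL (E : Ctx) (M : Expr)
  /-- `⟨V, E⟩` -/
  | pairR (V : Expr) (hV : IsValue V) (E : Ctx)
  /-- `π_i(E)` -/
  | prj (i : Fin 2) (E : Ctx)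
/-- Dependencies `D[x,·]`, with a hole at the last position. -/
inductive Dep : Type
  /-- `x = E[·]` -/
  | base (x : Var) (E : Ctx)
  /-- `D[x,x''], x'' = E[·]` -/
  | snoc (Δ : Dep) (x'' : Var) (E : Ctx)
end

/-- The variable `x` of `D[x,·]`. -/
def Dep.head : Dep → Var
  | .base x _ => x
  | .snoc Δ _ _ => Δ.head

mutual
/-- `E[M]`: the hole of `E` is filled with `M` (capturing is permitted). -/
def Ctx.plug : Ctx → Expr → Expr
  | .hole, M => M
  | .app E N, M => .app (E.plug M) N
  | .letBody D E, M => .letrec D (E.plug M)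
  | .letBind x E D E', M => .letrec ((x, E.plug M) :: D) (E'.plug (.var x))
  | .letDep x' E Δ D E', M =>
      .letrec ((x', E.plug M) :: (Δ.plug (.var x') ++ D)) (E'.plug (.var Δ.head))
  | .pairL E N, M => .pair (E.plug M) N
  | .pairR V _ E, M => .pair V (E.plug M)
  | .prj i E, M => .prj i (E.plug M)
/-- `D[x,M]`: the bindings of the dependency, with `M` at the last position. -/
def Dep.plug : Dep → Expr → Defs
  | .base x E, M => [(x, E.plug M)]
  | .snoc Δ x'' E, M => Δ.plug (.var x'') ++ [(x'', E.plug M)]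
end

/-- The reduction rules on redexes. -/
inductive Contract : Expr → Expr → Prop
  | beta_need (x : Var) (M N : Expr) :
      Contract (.app (.lam x M) N) (.letrec [(x, N)] M)
  | lift (D : Defs) (A N : Expr) : IsAnswer A →
      Contract (.app (.letrec D A) N) (.letrec D (.app A N))
  | deref (x : Var) (V : Expr) (D : Defs) (E : Ctx) : IsValue V →
      Contract (.letrec ((x, V) :: D) (E.plug (.var x))) (.letrec ((x, V) :: D) (E.plug V))
  | deref_env (Δ : Dep) (x' : Var) (V : Expr) (D : Defs) (E : Ctx) : IsValue V →
      Contract (.letrec (Δ.plug (.var x') ++ (x', V) :: D) (E.plug (.var Δ.head)))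
        (.letrec (Δ.plug V ++ (x', V) :: D) (E.plug (.var Δ.head)))
  | assoc (x : Var) (D : Defs) (A : Expr) (D' : Defs) (E : Ctx) : IsAnswer A →
      Contract (.letrec ((x, .letrec D A) :: D') (E.plug (.var x)))
        (.letrec (D ++ (x, A) :: D') (E.plug (.var x)))
  | assoc_env (x' : Var) (D : Defs) (A : Expr) (Δ : Dep) (D' : Defs) (E : Ctx) : IsAnswer A →
      Contract
        (.letrec ((x', .letrec D A) :: (Δ.plug (.var x') ++ D')) (E.plug (.var Δ.head)))
        (.letrec (D ++ (x', A) :: (Δ.plug (.var x') ++ D')) (E.plug (.var Δ.head)))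
  | error (Δ : Dep) (D : Defs) (E : Ctx) :
      Contract (.letrec (Δ.plug (.var Δ.head) ++ D) (E.plug (.var Δ.head)))
        (.letrec (Δ.plug .bullet ++ D) (E.plug (.var Δ.head)))
  | error_env (Δ' Δ : Dep) (D : Defs) (E : Ctx) :
      Contract
        (.letrec (Δ'.plug (.var Δ'.head) ++ Δ.plug (.var Δ'.head) ++ D) (E.plug (.var Δ.head)))
        (.letrec (Δ'.plug .bullet ++ Δ.plug (.var Δ'.head) ++ D) (E.plug (.var Δ.head)))
  | error_beta (M : Expr) : Contract (.app .bullet M) .bullet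
  | prj (i : Fin 2) (V : Fin 2 → Expr) : IsValue (V 0) → IsValue (V 1) →
      Contract (.prj i (.pair (V 0) (V 1))) (V i)
  | lift_prj (i : Fin 2) (D : Defs) (A : Expr) : IsAnswer A →
      Contract (.prj i (.letrec D A)) (.letrec D (.prj i A))
  | lift_pair₁ (D : Defs) (A M : Expr) : IsAnswer A →
      Contract (.pair (.letrec D A) M) (.letrec D (.pair A M))
  | lift_pair₂ (V : Expr) (D : Defs) (A : Expr) : IsValue V → IsAnswer A →
      Contract (.pair V (.letrec D A)) (.letrec D (.pair V A))

/-- One-step standard reduction `M → N` between α-equivalence classes: some canonical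
representative of the class of `M` is `E[M']`, with `M'` a redex that contracts to `N'`, and
`E[N']` lies in the class of `N`. -/
def Step (M N : Expr) : Prop :=
  ∃ (E : Ctx) (M' N' : Expr), Contract M' N' ∧ (E.plug M').Canonical ∧
    AlphaEq M (E.plug M') ∧ AlphaEq (E.plug N') N

/-- `M ↠ N`: zero or more reduction steps, on α-equivalence classes. -/
def Reduces (M N : Expr) : Prop :=
  ∃ N' : Expr, Relation.ReflTransGen Step M N' ∧ AlphaEq N' N

/-! ### Natural semantics -/

/-- Heaps are partial mappings from variables to expressions. Those that are reached from the
empty heap have a finite domain. -/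
abbrev Heap := Var → Option Expr

/-- The empty heap. -/
def Heap.empty : Heap := fun _ => none

/-- `Ψ[x ↦ M]`. -/
def Heap.set (Ψ : Heap) (x : Var) (M : Expr) : Heap := Function.update Ψ x (some M)

/-- `Ψ[xᵢ ↦ Mᵢ]` for the bindings `xᵢ = Mᵢ` of a block. -/
def Heap.extend (Ψ : Heap) (D : Defs) : Heap := fun y => (D.lookup y).or (Ψ y)

/-- `x` is not in the domain of `Ψ` and does not occur in the expressions stored in `Ψ`. -/
def Heap.Fresh (Ψ : Heap) (x : Var) : Prop :=
  Ψ x = none ∧ ∀ (y : Var) (M : Expr), Ψ y = some M → x ∉ M.vars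

/-- The natural semantics: `Eval Ψ M Φ V` is the judgment `⟨Ψ⟩ M ⇓ ⟨Φ⟩ V`. -/
inductive Eval : Heap → Expr → Heap → Expr → Prop
  | value {Ψ : Heap} {V : Expr} : IsValue V → Eval Ψ V Ψ V
  | app {Ψ Φ Ψ' : Heap} {M₁ M₂ N V : Expr} {x x' : Var} :
      Eval Ψ M₁ Φ (.lam x N) →
      Φ.Fresh x' → x' ∉ (Expr.lam x N).vars → x' ∉ M₂.vars →
      Eval (Φ.set x' M₂) (N.subst x' x) Ψ' V →
      Eval Ψ (.app M₁ M₂) Ψ' V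
  | var {Ψ Φ : Heap} {x : Var} {M V : Expr} :
      Ψ x = some M → Eval (Ψ.set x .bullet) M Φ V →
      Eval Ψ (.var x) (Φ.set x V) V
  /-- `ρ` sends the variables `xᵢ` of the block to pairwise distinct fresh variables `xᵢ'`, and
  fixes all other variables. -/
  | letrec {Ψ Φ : Heap} {D : Defs} {N V : Expr} (ρ : Var → Var) :
      (∀ y, y ∉ names D → ρ y = y) →
      Set.InjOn ρ {y | y ∈ names D} →
      (∀ y ∈ names D, Ψ.Fresh (ρ y) ∧ ρ y ∉ (Expr.letrec D N).vars) →
      Eval (Ψ.extend (D.map fun b => (ρ b.1, b.2.rename ρ))) (N.rename ρ) Φ V →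
      Eval Ψ (.letrec D N) Φ V
  | error_beta {Ψ Φ : Heap} {M₁ M₂ : Expr} :
      Eval Ψ M₁ Φ .bullet → Eval Ψ (.app M₁ M₂) Φ .bullet
  | pair {Ψ Ψ₁ Ψ₂ : Heap} {M₁ M₂ V₁ V₂ : Expr} :
      Eval Ψ M₁ Ψ₁ V₁ → Eval Ψ₁ M₂ Ψ₂ V₂ → Eval Ψ (.pair M₁ M₂) Ψ₂ (.pair V₁ V₂)
  | prj {Ψ Φ : Heap} {M : Expr} (i : Fin 2) (V : Fin 2 → Expr) :
      Eval Ψ M Φ (.pair (V 0) (V 1)) → Eval Ψ (.prj i M) Φ (V i)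

/-! ### Sequences of letrec frames -/

/-- `Θ`: a sequence of frames `let rec D in []`, the outermost one first. -/
abbrev Letrecs := List Defs

/-- `Θ[M]`. -/
def Letrecs.plug (Θ : Letrecs) (M : Expr) : Expr := Θ.foldr Expr.letrec M

/-- All bindings of all frames of `Θ`. -/
def Letrecs.bindings (Θ : Letrecs) : Defs := List.flatten Θ

/-- `⌊Θ⌋ = Ψ`: the variables bound by the frames of `Θ` are pairwise distinct, and `Ψ` is the
heap that consists of exactly the bindings of `Θ`. -/
def Letrecs.HasHeap (Θ : Letrecs) (Ψ : Heap) : Prop :=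
  (names Θ.bindings).Nodup ∧
    ∀ (x : Var) (M : Expr), Ψ x = some M ↔ (x, M) ∈ Θ.bindings

end NeedRec

namespace NeedRec

/-! ### Structural induction and membership lemmas -/

-- Both semantics are compared with a third one: a deterministic environment machine whose heap is a
-- list of cells addressed by position. Locations take the place of names, so freshness,
-- α-conversion and the order of blocks survive only in the relation between states: a bijection `β`
-- between the locations of two heaps under which related cells hold code that is α-equivalent once
-- free variables are matched through the environments and `β`. Related states run in lockstep
-- (`bisim`).
--
-- A heap of the natural semantics is itself a machine heap whose locations are its variables
-- (`raw`). With this reading `Eval.run` turns a derivation into a run, and `eval_of_steps` cuts a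
-- halting run into derivations by induction on its number of steps.
--
-- For the reduction semantics, a machine started on `E[M]` first loads `E`: it arrives at `M` with
-- a heap, stack and environment that do not depend on `M` (`loads_and_loadsDep`). The bindings
-- along a dependency chain are then under evaluation and their cells hold `•`, which is exactly
-- what the cyclic rules produce. Hence it suffices to compare a redex with its contractum in such a
-- state. They halt together with related results, and the contractum is cheaper by at least one
-- unit (`sim_contract`). The costs are chosen for this purpose: allocation pays one plus the height
-- of the stack, so that moving a `let rec` outwards saves something; lookups, applications and
-- projections pay one; evaluating a syntactic value is free. The hardest rule is the flattening of
-- blocks (`sim_assoc`), where the same bindings are allocated at different times and places.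
--
-- Two further facts close the argument. A program with a halting run is an answer or has a
-- reduction step (`progress`). An answer runs to a state from which frames can be read back with
-- the names of any natural heap related to the final machine heap (`readback`). If `M` reduces to
-- an answer, that answer halts, so `M` halts with a related result; the run of `M` yields a
-- derivation, whose heap supplies the names for the frames. Conversely a derivation for `M` yields
-- a halting run; each reduction step lowers its cost, so reduction must stop, and by progress it
-- stops at an answer, which is read back.

theorem Expr.ind {P : Expr → Prop} (var : ∀ x, P (.var x)) (lam : ∀ x M, P M → P (.lam x M))
    (app : ∀ M N, P M → P N → P (.app M N))
    (letrec : ∀ D N, (∀ p ∈ D, P p.2) → P N → P (.letrec D N)) (bullet : P .bullet)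
    (pair : ∀ M N, P M → P N → P (.pair M N)) (prj : ∀ i M, P M → P (.prj i M)) :
    ∀ M, P M := by
  intro M
  refine Expr.rec (motive_1 := P) (motive_2 := fun D => ∀ p ∈ D, P p.2)
    (motive_3 := fun p => P p.2) var lam app letrec bullet pair prj ?_ ?_ ?_ M
  · simp
  · intro p D hp hD q hq
    rcases List.mem_cons.1 hq with rfl | h
    exacts [hp, hD _ h]
  · intro _ _ h; exact h

theorem mem_fvRhs {D : Defs} {x : Var} : x ∈ fvRhs D ↔ ∃ p ∈ D, x ∈ p.2.fv := by
  induction D with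
  | nil => simp [fvRhs]
  | cons p D ih => obtain ⟨y, M⟩ := p; simp [fvRhs, ih]

theorem bindersDefs_eq (D : Defs) : bindersDefs D = D.flatMap fun p => p.1 :: p.2.binders := by
  induction D with
  | nil => simp [bindersDefs]
  | cons p D ih => obtain ⟨y, M⟩ := p; simp [bindersDefs, ih]

theorem wfRhs_iff {D : Defs} : wfRhs D ↔ ∀ p ∈ D, p.2.WF := by
  induction D with
  | nil => simp [wfRhs]
  | cons p D ih => obtain ⟨y, M⟩ := p; simp [wfRhs, ih]

theorem renameRhs_eq (ρ : Var → Var) (D : Defs) :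
    renameRhs ρ D = D.map fun p => (p.1, p.2.rename ρ) := by
  induction D with
  | nil => simp [renameRhs]
  | cons p D ih => obtain ⟨y, M⟩ := p; simp [renameRhs, ih]

theorem mem_varsDefs {D : Defs} {x : Var} :
    x ∈ varsDefs D ↔ ∃ p ∈ D, x = p.1 ∨ x ∈ p.2.vars := by
  induction D with
  | nil => simp [varsDefs]
  | cons p D ih => obtain ⟨y, M⟩ := p; simp [varsDefs, ih, or_assoc]

theorem binders_subset_vars (M : Expr) : ∀ x ∈ M.binders, x ∈ M.vars := by
  induction M using Expr.ind with
  | var y => simp [Expr.binders]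
  | lam y M ih => simp +contextual [Expr.binders, Expr.vars, or_imp, ih]
  | app M N ih₁ ih₂ => simp +contextual [Expr.binders, Expr.vars, or_imp, ih₁, ih₂]
  | letrec D N ihD ihN =>
    intro x hx
    simp only [Expr.binders, bindersDefs_eq, List.mem_append, List.mem_flatMap, List.mem_cons] at hx
    simp only [Expr.vars, Finset.mem_union, mem_varsDefs]
    rcases hx with ⟨p, hp, rfl | h⟩ | h
    · exact .inl ⟨p, hp, .inl rfl⟩
    · exact .inl ⟨p, hp, .inr (ihD p hp _ h)⟩
    · exact .inr (ihN _ h)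
  | bullet => simp [Expr.binders]
  | pair M N ih₁ ih₂ => simp +contextual [Expr.binders, Expr.vars, or_imp, ih₁, ih₂]
  | prj i M ih => simpa [Expr.binders, Expr.vars] using ih

theorem mem_fv_letrec {D : Defs} {N : Expr} {x : Var} :
    x ∈ (Expr.letrec D N).fv ↔ ((∃ p ∈ D, x ∈ p.2.fv) ∨ x ∈ N.fv) ∧ x ∉ names D := by
  simp [Expr.fv, mem_fvRhs]

/-! ### α-equivalence relative to a relation between the free variables -/

/-- The relation `R` below binders that are matched by the pairs in `zs`. -/
def Bd (zs : List (Var × Var)) (R : Var → Var → Prop) (x y : Var) : Prop :=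
  (x, y) ∈ zs ∨ ((∀ p ∈ zs, p.1 ≠ x) ∧ (∀ p ∈ zs, p.2 ≠ y) ∧ R x y)

/-- The pairs of names of a list of matched bindings. -/
def pnames (L : List ((Var × Expr) × (Var × Expr))) : List (Var × Var) :=
  L.map fun q => (q.1.1, q.2.1)

/-- α-equivalence where free variables correspond by `R`. The bindings of two blocks are matched
by a list of pairs of bindings. -/
inductive AEq : (Var → Var → Prop) → Expr → Expr → Prop
  | var {R : Var → Var → Prop} {x y : Var} : R x y → AEq R (.var x) (.var y)
  | lam {R : Var → Var → Prop} {x y : Var} {M N : Expr} :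
      AEq (Bd [(x, y)] R) M N → AEq R (.lam x M) (.lam y N)
  | app {R : Var → Var → Prop} {M₁ M₂ N₁ N₂ : Expr} :
      AEq R M₁ M₂ → AEq R N₁ N₂ → AEq R (.app M₁ N₁) (.app M₂ N₂)
  | letrec {R : Var → Var → Prop} {D₁ D₂ : Defs} {N₁ N₂ : Expr}
      (L : List ((Var × Expr) × (Var × Expr))) :
      (names D₁).Nodup → (names D₂).Nodup → (L.map Prod.fst).Perm D₁ → (L.map Prod.snd).Perm D₂ →
      (∀ q ∈ L, AEq (Bd (pnames L) R) q.1.2 q.2.2) →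
      AEq (Bd (pnames L) R) N₁ N₂ → AEq R (.letrec D₁ N₁) (.letrec D₂ N₂)
  | bullet {R : Var → Var → Prop} : AEq R .bullet .bullet
  | pair {R : Var → Var → Prop} {M₁ M₂ N₁ N₂ : Expr} :
      AEq R M₁ M₂ → AEq R N₁ N₂ → AEq R (.pair M₁ N₁) (.pair M₂ N₂)
  | prj {R : Var → Var → Prop} {i : Fin 2} {M N : Expr} :
      AEq R M N → AEq R (.prj i M) (.prj i N)

-- Matchings between the bindings of two blocks

section Matching

variable {D₁ D₂ : Defs} {L : List ((Var × Expr) × (Var × Expr))}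

theorem matching_left (h : (L.map Prod.fst).Perm D₁) {p : Var × Expr} :
    p ∈ D₁ ↔ ∃ q ∈ L, q.1 = p := by
  rw [← h.mem_iff]; simp

theorem matching_right (h : (L.map Prod.snd).Perm D₂) {p : Var × Expr} :
    p ∈ D₂ ↔ ∃ q ∈ L, q.2 = p := by
  rw [← h.mem_iff]; simp

theorem mem_names {D : Defs} {x : Var} : x ∈ names D ↔ ∃ M, (x, M) ∈ D := by
  simp [names]

theorem matching_left_names (h : (L.map Prod.fst).Perm D₁) {x : Var} :
    x ∈ names D₁ ↔ ∃ p ∈ pnames L, p.1 = x := by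
  rw [← (h.map Prod.fst).mem_iff]
  simp only [List.map_map, List.mem_map, pnames, exists_exists_and_eq_and, Function.comp_apply]

theorem matching_right_names (h : (L.map Prod.snd).Perm D₂) {x : Var} :
    x ∈ names D₂ ↔ ∃ p ∈ pnames L, p.2 = x := by
  rw [← (h.map Prod.fst).mem_iff]
  simp only [List.map_map, List.mem_map, pnames, exists_exists_and_eq_and, Function.comp_apply]

theorem pnames_fst : (pnames L).map Prod.fst = names (L.map Prod.fst) := by
  simp [pnames, names]

theorem pnames_snd : (pnames L).map Prod.snd = names (L.map Prod.snd) := by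
  simp [pnames, names]

theorem pnames_fst_nodup (hn : (names D₁).Nodup) (h : (L.map Prod.fst).Perm D₁) :
    ((pnames L).map Prod.fst).Nodup := by
  rw [pnames_fst]; exact (h.map Prod.fst).nodup_iff.2 hn

theorem pnames_snd_nodup (hn : (names D₂).Nodup) (h : (L.map Prod.snd).Perm D₂) :
    ((pnames L).map Prod.snd).Nodup := by
  rw [pnames_snd]; exact (h.map Prod.fst).nodup_iff.2 hn

theorem eq_of_nodup_map {α β : Type*} {f : α → β} {l : List α} (h : (l.map f).Nodup) {a b : α}
    (ha : a ∈ l) (hb : b ∈ l) (hab : f a = f b) : a = b :=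
  List.inj_on_of_nodup_map h ha hb hab

theorem names_inj {D : Defs} (h : (names D).Nodup) {x : Var} {M N : Expr} (h₁ : (x, M) ∈ D)
    (h₂ : (x, N) ∈ D) : M = N := by
  have := eq_of_nodup_map (f := Prod.fst) h h₁ h₂ rfl
  exact (Prod.mk.inj this).2

/-- Turns a matching into a map, so that matchings can be composed and blocks reordered to fit one
another. -/
theorem exists_graph_fun {α β : Type*} [Inhabited β] {L : List (α × β)}
    (h : (L.map Prod.fst).Nodup) : ∃ g : α → β, ∀ q ∈ L, g q.1 = q.2 := by
  classical
  refine ⟨fun a => if h : ∃ q ∈ L, q.1 = a then h.choose.2 else default, fun q hq => ?_⟩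
  have hex : ∃ q' ∈ L, q'.1 = q.1 := ⟨q, hq, rfl⟩
  simp only [hex, dite_true]
  rw [eq_of_nodup_map h hex.choose_spec.1 hq hex.choose_spec.2]

end Matching

theorem Bd.mono {zs : List (Var × Var)} {R R' : Var → Var → Prop} {x y : Var}
    (h : (∀ p ∈ zs, p.1 ≠ x) → (∀ p ∈ zs, p.2 ≠ y) → R x y → R' x y) :
    Bd zs R x y → Bd zs R' x y := by
  rintro (h' | ⟨h₁, h₂, h₃⟩)
  exacts [.inl h', .inr ⟨h₁, h₂, h h₁ h₂ h₃⟩]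

/-- `Bd` answers for bound names by itself, so `R` is consulted only at free variables. This is what
lets code keep its relation when the relation between locations grows. -/
theorem AEq.mono {R R' : Var → Var → Prop} {M N : Expr} (h : AEq R M N)
    (hR : ∀ x ∈ M.fv, ∀ y ∈ N.fv, R x y → R' x y) : AEq R' M N := by
  induction h generalizing R' with
  | var h => exact .var (hR _ (by simp [Expr.fv]) _ (by simp [Expr.fv]) h)
  | lam h ih =>
    refine .lam (ih fun a ha b hb => Bd.mono fun h₁ h₂ => hR _ ?_ _ ?_)
    · simp_all [Expr.fv, eq_comm]
    · simp_all [Expr.fv, eq_comm]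
  | app h₁ h₂ ih₁ ih₂ =>
    exact .app (ih₁ fun a ha b hb => hR _ (by simp [Expr.fv, ha]) _ (by simp [Expr.fv, hb]))
      (ih₂ fun a ha b hb => hR _ (by simp [Expr.fv, ha]) _ (by simp [Expr.fv, hb]))
  | letrec L n₁ n₂ p₁ p₂ h₁ h₂ ih₁ ih₂ =>
    refine .letrec L n₁ n₂ p₁ p₂ (fun q hq => ih₁ q hq fun a ha b hb => ?_) (ih₂ fun a ha b hb => ?_)
    all_goals
      refine Bd.mono fun h₁ h₂ => hR _ (mem_fv_letrec.2 ⟨?_, ?_⟩) _ (mem_fv_letrec.2 ⟨?_, ?_⟩)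
    · exact .inl ⟨_, (matching_left p₁).2 ⟨q, hq, rfl⟩, ha⟩
    · rw [matching_left_names p₁]; rintro ⟨p, hp, h⟩; exact h₁ p hp h
    · exact .inl ⟨_, (matching_right p₂).2 ⟨q, hq, rfl⟩, hb⟩
    · rw [matching_right_names p₂]; rintro ⟨p, hp, h⟩; exact h₂ p hp h
    · exact .inr ha
    · rw [matching_left_names p₁]; rintro ⟨p, hp, h⟩; exact h₁ p hp h
    · exact .inr hb
    · rw [matching_right_names p₂]; rintro ⟨p, hp, h⟩; exact h₂ p hp h
  | bullet => exact .bullet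
  | pair h₁ h₂ ih₁ ih₂ =>
    exact .pair (ih₁ fun a ha b hb => hR _ (by simp [Expr.fv, ha]) _ (by simp [Expr.fv, hb]))
      (ih₂ fun a ha b hb => hR _ (by simp [Expr.fv, ha]) _ (by simp [Expr.fv, hb]))
  | prj h ih => exact .prj (ih hR)

theorem AEq.symm {R R' : Var → Var → Prop} {M N : Expr} (h : AEq R M N)
    (hR : ∀ x y, R x y → R' y x) : AEq R' N M := by
  induction h generalizing R' with
  | var h => exact .var (hR _ _ h)
  | lam h ih =>
    refine .lam (ih fun a b => ?_)
    rintro (h' | ⟨h₁, h₂, h₃⟩)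
    · exact .inl (by simp_all)
    · exact .inr ⟨by simpa using h₂, by simpa using h₁, hR _ _ h₃⟩
  | app h₁ h₂ ih₁ ih₂ => exact .app (ih₁ hR) (ih₂ hR)
  | @letrec R D₁ D₂ N₁ N₂ L n₁ n₂ p₁ p₂ h₁ h₂ ih₁ ih₂ =>
    have key : ∀ x y, Bd (pnames L) R x y → Bd (pnames (L.map Prod.swap)) R' y x := by
      rintro a b (h' | ⟨h₁, h₂, h₃⟩)
      · refine .inl ?_
        simp only [pnames, List.mem_map, List.map_map] at h' ⊢
        obtain ⟨q, hq, e⟩ := h'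
        obtain ⟨rfl, rfl⟩ := Prod.mk.inj e
        exact ⟨q, hq, rfl⟩
      · refine .inr ⟨?_, ?_, hR _ _ h₃⟩
        · intro p hp
          simp only [pnames, List.map_map, List.mem_map] at hp
          obtain ⟨q, hq, rfl⟩ := hp
          exact h₂ _ (List.mem_map.2 ⟨q, hq, rfl⟩)
        · intro p hp
          simp only [pnames, List.map_map, List.mem_map] at hp
          obtain ⟨q, hq, rfl⟩ := hp
          exact h₁ _ (List.mem_map.2 ⟨q, hq, rfl⟩)
    refine .letrec (L.map Prod.swap) n₂ n₁ ?_ ?_ ?_ (ih₂ key)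
    · simpa [Function.comp_def] using p₂
    · simpa [Function.comp_def] using p₁
    · intro q hq
      obtain ⟨q, hq', rfl⟩ := List.mem_map.1 hq
      exact ih₁ q hq' key
  | bullet => exact .bullet
  | pair h₁ h₂ ih₁ ih₂ => exact .pair (ih₁ hR) (ih₂ hR)
  | prj h ih => exact .prj (ih hR)

/-- The two matchings of a block share their middle column, so they compose through a map `g` from
the bindings in the middle to their partners on the right. -/
theorem AEq.trans {R S T : Var → Var → Prop} {M N P : Expr} (h : AEq R M N) (h' : AEq S N P)
    (hT : ∀ x y z, R x y → S y z → T x z) : AEq T M P := by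
  induction h generalizing S T P with
  | var h => cases h' with | var h' => exact .var (hT _ _ _ h h')
  | lam h ih =>
    cases h' with
    | lam h' =>
      refine .lam (ih h' fun a b c => ?_)
      rintro (h₁ | ⟨h₁, h₂, h₃⟩) (h₁' | ⟨h₁', h₂', h₃'⟩)
      · exact .inl (by simp_all)
      · simp_all
      · simp_all
      · exact .inr ⟨by simpa using h₁, by simpa using h₂', hT _ _ _ h₃ h₃'⟩
  | app h₁ h₂ ih₁ ih₂ => cases h' with | app h₁' h₂' => exact .app (ih₁ h₁' hT) (ih₂ h₂' hT)
  | @letrec R D₁ D₂ N₁ N₂ L n₁ n₂ p₁ p₂ h₁ h₂ ih₁ ih₂ =>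
    cases h' with
    | @letrec _ _ D₃ _ N₃ L' _ n₃ p₂' p₃ h₁' h₂' =>
      have nd : (L'.map Prod.fst).Nodup := p₂'.nodup_iff.2 (List.Nodup.of_map _ n₂)
      have : Inhabited (Var × Expr) := ⟨(0, .bullet)⟩
      obtain ⟨g, hg⟩ := exists_graph_fun nd
      have hgL : ∀ q ∈ L, (q.2, g q.2) ∈ L' := by
        intro q hq
        obtain ⟨q', hq', e⟩ := (matching_left p₂').1 ((matching_right p₂).2 ⟨q, hq, rfl⟩)
        rw [← e, hg q' hq']; exact hq'
      have key : ∀ a b c, Bd (pnames L) R a b → Bd (pnames L') S b c →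
          Bd (pnames (L.map fun q => (q.1, g q.2))) T a c := by
        rintro a b c (k | ⟨k₁, k₂, k₃⟩) (k' | ⟨k₁', k₂', k₃'⟩)
        · left
          simp only [pnames, List.mem_map] at k k'
          obtain ⟨q, hq, e⟩ := k
          obtain ⟨q', hq', e'⟩ := k'
          obtain ⟨rfl, rfl⟩ := Prod.mk.inj e
          obtain ⟨e₁, rfl⟩ := Prod.mk.inj e'
          -- The middle names are distinct, so the pair of `L'` with this name is the one that `g`
          -- selects.
          have e₂ : (q.2, g q.2) = q' := eq_of_nodup_map
            (f := fun q : (Var × Expr) × (Var × Expr) => q.1.1)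
            (by have := pnames_fst_nodup n₂ p₂'; simpa [pnames, Function.comp_def] using this)
            (hgL q hq) hq' e₁.symm
          simp only [pnames, List.map_map, List.mem_map]
          exact ⟨q, hq, by simp [← e₂]⟩
        · exfalso
          simp only [pnames, List.mem_map] at k
          obtain ⟨q, hq, e⟩ := k
          obtain ⟨rfl, rfl⟩ := Prod.mk.inj e
          exact k₁' _ (List.mem_map.2 ⟨_, hgL q hq, rfl⟩) rfl
        · exfalso
          obtain ⟨p, hp, e⟩ := (matching_right_names p₂).1
            ((matching_left_names p₂').2 ⟨_, k', rfl⟩)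
          exact k₂ p hp e
        · refine .inr ⟨?_, ?_, hT _ _ _ k₃ k₃'⟩
          · intro p hp
            simp only [pnames, List.map_map, List.mem_map] at hp
            obtain ⟨q, hq, rfl⟩ := hp
            exact k₁ (q.1.1, q.2.1) (List.mem_map.2 ⟨q, hq, rfl⟩)
          · intro p hp
            simp only [pnames, List.map_map, List.mem_map] at hp
            obtain ⟨q, hq, rfl⟩ := hp
            exact k₂' (q.2.1, (g q.2).1) (List.mem_map.2 ⟨_, hgL q hq, rfl⟩)
      refine .letrec (L.map fun q => (q.1, g q.2)) n₁ n₃ ?_ ?_ ?_ (ih₂ h₂' key)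
      · simpa [Function.comp_def] using p₁
      · have e : (L.map fun q => (q.1, g q.2)).map Prod.snd = (L.map Prod.snd).map g := by simp
        have e' : (L'.map Prod.fst).map g = L'.map Prod.snd := by
          rw [List.map_map]; exact List.map_congr_left fun q hq => hg q hq
        rw [e]
        refine ((p₂.trans p₂'.symm).map g).trans ?_
        rw [e']; exact p₃
      · intro q hq
        obtain ⟨q, hq', rfl⟩ := List.mem_map.1 hq
        exact ih₁ q hq' (h₁' _ (hgL q hq')) key
  | bullet => cases h' with | bullet => exact .bullet
  | pair h₁ h₂ ih₁ ih₂ => cases h' with | pair h₁' h₂' => exact .pair (ih₁ h₁' hT) (ih₂ h₂' hT)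
  | prj h ih => cases h' with | prj h' => exact .prj (ih h' hT)

theorem AEq.wf {R : Var → Var → Prop} {M N : Expr} (h : AEq R M N) : M.WF := by
  induction h with
  | var h => simp [Expr.WF]
  | lam h ih => simpa [Expr.WF] using ih
  | app h₁ h₂ ih₁ ih₂ => exact ⟨ih₁, ih₂⟩
  | letrec L n₁ n₂ p₁ p₂ h₁ h₂ ih₁ ih₂ =>
    refine ⟨n₁, wfRhs_iff.2 fun p hp => ?_, ih₂⟩
    obtain ⟨q, hq, rfl⟩ := (matching_left p₁).1 hp
    exact ih₁ q hq
  | bullet => simp [Expr.WF]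
  | pair h₁ h₂ ih₁ ih₂ => exact ⟨ih₁, ih₂⟩
  | prj h ih => simpa [Expr.WF] using ih

theorem AEq.fv {R : Var → Var → Prop} {M N : Expr} (h : AEq R M N) :
    ∀ x ∈ M.fv, ∃ y ∈ N.fv, R x y := by
  induction h with
  | var h => simpa [Expr.fv] using h
  | lam h ih =>
    intro a ha
    simp only [Expr.fv, Finset.mem_erase] at ha
    obtain ⟨b, hb, h' | ⟨h₁, h₂, h₃⟩⟩ := ih a ha.2
    · simp_all
    · exact ⟨b, by simp_all [Expr.fv, eq_comm], h₃⟩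
  | app h₁ h₂ ih₁ ih₂ =>
    intro a ha
    simp only [Expr.fv, Finset.mem_union] at ha ⊢
    rcases ha with ha | ha
    · obtain ⟨b, hb, h⟩ := ih₁ a ha; exact ⟨b, .inl hb, h⟩
    · obtain ⟨b, hb, h⟩ := ih₂ a ha; exact ⟨b, .inr hb, h⟩
  | @letrec R D₁ D₂ N₁ N₂ L n₁ n₂ p₁ p₂ h₁ h₂ ih₁ ih₂ =>
    intro a ha
    obtain ⟨ha, hn⟩ := mem_fv_letrec.1 ha
    have key : ∀ b, Bd (pnames L) R a b → R a b ∧ b ∉ names D₂ := by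
      rintro b (h' | ⟨k₁, k₂, k₃⟩)
      · exact absurd ((matching_left_names p₁).2 ⟨_, h', rfl⟩) hn
      · refine ⟨k₃, fun hb => ?_⟩
        obtain ⟨p, hp, e⟩ := (matching_right_names p₂).1 hb
        exact k₂ p hp e
    rcases ha with ⟨p, hp, ha⟩ | ha
    · obtain ⟨q, hq, rfl⟩ := (matching_left p₁).1 hp
      obtain ⟨b, hb, h⟩ := ih₁ q hq a ha
      exact ⟨b, mem_fv_letrec.2 ⟨.inl ⟨_, (matching_right p₂).2 ⟨q, hq, rfl⟩, hb⟩, (key b h).2⟩,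
        (key b h).1⟩
    · obtain ⟨b, hb, h⟩ := ih₂ a ha
      exact ⟨b, mem_fv_letrec.2 ⟨.inr hb, (key b h).2⟩, (key b h).1⟩
  | bullet => simp [Expr.fv]
  | pair h₁ h₂ ih₁ ih₂ =>
    intro a ha
    simp only [Expr.fv, Finset.mem_union] at ha ⊢
    rcases ha with ha | ha
    · obtain ⟨b, hb, h⟩ := ih₁ a ha; exact ⟨b, .inl hb, h⟩
    · obtain ⟨b, hb, h⟩ := ih₂ a ha; exact ⟨b, .inr hb, h⟩
  | prj h ih => exact ih

theorem AEq.refl {R : Var → Var → Prop} {M : Expr} (hM : M.WF) (h : ∀ x ∈ M.fv, R x x) :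
    AEq R M M := by
  induction M using Expr.ind generalizing R with
  | var x => exact .var (h x (by simp [Expr.fv]))
  | lam x M ih =>
    refine .lam (ih hM fun a ha => ?_)
    by_cases e : a = x
    · left; simp [e]
    · right; simpa [Ne.symm e] using h a (by simp [Expr.fv, e, ha])
  | app M N ih₁ ih₂ =>
    exact .app (ih₁ hM.1 fun a ha => h a (by simp [Expr.fv, ha]))
      (ih₂ hM.2 fun a ha => h a (by simp [Expr.fv, ha]))
  | letrec D N ihD ihN =>
    obtain ⟨hn, hD, hN⟩ := hM
    have key : ∀ a, ((∃ p ∈ D, a ∈ p.2.fv) ∨ a ∈ N.fv) →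
        Bd (pnames (D.map fun p => (p, p))) R a a := by
      intro a ha
      by_cases hn : a ∈ names D
      · obtain ⟨M, hM⟩ := mem_names.1 hn
        left
        simp only [pnames, List.map_map, List.mem_map]
        exact ⟨_, hM, rfl⟩
      · right
        refine ⟨?_, ?_, h a (mem_fv_letrec.2 ⟨ha, hn⟩)⟩ <;>
        · intro p hp e
          simp only [pnames, List.map_map, List.mem_map] at hp
          obtain ⟨q, hq, rfl⟩ := hp
          exact hn (mem_names.2 ⟨q.2, by rw [← e]; exact hq⟩)
    refine .letrec (D.map fun p => (p, p)) hn hn ?_ ?_ ?_ (ihN hN fun a ha => key a (.inr ha))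
    · simp [Function.comp_def]
    · simp [Function.comp_def]
    · intro q hq
      obtain ⟨p, hp, rfl⟩ := List.mem_map.1 hq
      exact ihD p hp (wfRhs_iff.1 hD p hp) fun a ha => key a (.inl ⟨p, hp, ha⟩)
  | bullet => exact .bullet
  | pair M N ih₁ ih₂ =>
    exact .pair (ih₁ hM.1 fun a ha => h a (by simp [Expr.fv, ha]))
      (ih₂ hM.2 fun a ha => h a (by simp [Expr.fv, ha]))
  | prj i M ih => exact .prj (ih hM h)

/-- Since `rename` leaves binders alone, capture is excluded by `hf`: a free variable that moves
lands outside the binders of `M`. Below a binder the renaming fixes the bound names, so the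
condition is inherited. -/
theorem AEq.rename {R R' : Var → Var → Prop} {M N : Expr} {f : Var → Var} (h : AEq R' M N)
    (hR : ∀ x ∈ M.fv, ∀ y, R' x y → R (f x) y)
    (hf : ∀ x ∈ M.fv, f x = x ∨ f x ∉ M.binders) : AEq R (M.rename f) N := by
  induction h generalizing R f with
  | var h => exact .var (hR _ (by simp [Expr.fv]) _ h)
  | @lam R' x y M N h ih =>
    simp only [Expr.rename]
    refine .lam (ih ?_ ?_)
    · rintro a ha b (h' | ⟨h₁, h₂, h₃⟩)
      · left; simp_all
      · right
        have hax : a ≠ x := by simp_all [eq_comm]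
        have ha' : a ∈ (Expr.lam x M).fv := by simp [Expr.fv, hax, ha]
        rw [Function.update_of_ne hax]
        refine ⟨?_, h₂, hR a ha' b h₃⟩
        rcases hf a ha' with e | e
        · simp [e, hax.symm]
        · simp only [Expr.binders, List.mem_cons, not_or] at e
          simpa using fun e' => e.1 e'.symm
    · intro a ha
      by_cases hax : a = x
      · left; simp [hax]
      · rw [Function.update_of_ne hax]
        have ha' : a ∈ (Expr.lam x M).fv := by simp [Expr.fv, hax, ha]
        rcases hf a ha' with e | e
        · exact .inl e
        · simp only [Expr.binders, List.mem_cons, not_or] at e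
          exact .inr e.2
  | app h₁ h₂ ih₁ ih₂ =>
    refine .app (ih₁ (fun a ha => hR a (by simp [Expr.fv, ha])) fun a ha => ?_)
      (ih₂ (fun a ha => hR a (by simp [Expr.fv, ha])) fun a ha => ?_)
    all_goals
      refine (hf a (by simp [Expr.fv, ha])).imp_right ?_
      simp +contextual [Expr.binders]
  | @letrec R' D₁ D₂ N₁ N₂ L n₁ n₂ p₁ p₂ h₁ h₂ ih₁ ih₂ =>
    simp only [Expr.rename, renameRhs_eq]
    set f' : Var → Var := fun y => if y ∈ names D₁ then y else f y with hf'
    set L' := L.map fun q => ((q.1.1, q.1.2.rename f'), q.2) with hL'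
    have hpn : pnames L' = pnames L := by simp [hL', pnames]
    have key : ∀ a, ((∃ p ∈ D₁, a ∈ p.2.fv) ∨ a ∈ N₁.fv) → ∀ b, Bd (pnames L) R' a b →
        Bd (pnames L') R (f' a) b := by
      rintro a ha b (h' | ⟨k₁, k₂, k₃⟩)
      · have : a ∈ names D₁ := (matching_left_names p₁).2 ⟨_, h', rfl⟩
        left; simpa [hf', this, hpn] using h'
      · have hn : a ∉ names D₁ := by
          rw [matching_left_names p₁]; rintro ⟨p, hp, h⟩; exact k₁ p hp h
        have ha' : a ∈ (Expr.letrec D₁ N₁).fv := mem_fv_letrec.2 ⟨ha, hn⟩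
        right
        simp only [hf', hn, if_false, hpn]
        refine ⟨?_, k₂, hR a ha' b k₃⟩
        rcases hf a ha' with e | e
        · rwa [e]
        · intro p hp he
          apply e
          obtain ⟨M, hM⟩ := mem_names.1 ((matching_left_names p₁).2 ⟨p, hp, he⟩)
          simp only [Expr.binders, bindersDefs_eq, List.mem_append, List.mem_flatMap]
          exact .inl ⟨_, hM, by simp⟩
    have key₂ : ∀ a, ((∃ p ∈ D₁, a ∈ p.2.fv) ∨ a ∈ N₁.fv) → ∀ B : List Var,
        (∀ z ∈ B, z ∈ (Expr.letrec D₁ N₁).binders) → f' a = a ∨ f' a ∉ B := by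
      intro a ha B hB
      by_cases hn : a ∈ names D₁
      · left; simp [hf', hn]
      · simp only [hf', hn, if_false]
        exact (hf a (mem_fv_letrec.2 ⟨ha, hn⟩)).imp_right fun h h' => h (hB _ h')
    refine .letrec L' ?_ n₂ ?_ ?_ ?_ (ih₂ (fun a ha => key a (.inr ha)) fun a ha =>
      key₂ a (.inr ha) _ fun z hz => by simp [Expr.binders, hz])
    · simpa [names, Function.comp_def] using n₁
    · simpa [hL', Function.comp_def] using p₁.map fun p => (p.1, p.2.rename f')
    · simpa [hL', Function.comp_def] using p₂
    · intro q hq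
      obtain ⟨q, hq', rfl⟩ := List.mem_map.1 hq
      have hq₁ := (matching_left p₁).2 ⟨q, hq', rfl⟩
      refine ih₁ q hq' (fun a ha => key a (.inl ⟨_, hq₁, ha⟩)) fun a ha =>
        key₂ a (.inl ⟨_, hq₁, ha⟩) _ fun z hz => ?_
      simp only [Expr.binders, bindersDefs_eq, List.mem_append, List.mem_flatMap]
      exact .inl ⟨_, hq₁, by simp [hz]⟩
  | bullet => exact .bullet
  | pair h₁ h₂ ih₁ ih₂ =>
    refine .pair (ih₁ (fun a ha => hR a (by simp [Expr.fv, ha])) fun a ha => ?_)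
      (ih₂ (fun a ha => hR a (by simp [Expr.fv, ha])) fun a ha => ?_)
    all_goals
      refine (hf a (by simp [Expr.fv, ha])).imp_right ?_
      simp +contextual [Expr.binders]
  | prj h ih => exact .prj (ih hR hf)

theorem AEq.isValue {R : Var → Var → Prop} {M N : Expr} (h : AEq R M N) (hM : IsValue M) :
    IsValue N := by
  induction hM generalizing N with
  | lam x M => cases h; exact .lam _ _
  | bullet => cases h; exact .bullet
  | pair _ _ ih₁ ih₂ => cases h with | pair h₁ h₂ => exact .pair (ih₁ h₁) (ih₂ h₂)

theorem AEq.isAnswer {R : Var → Var → Prop} {M N : Expr} (h : AEq R M N) (hM : IsAnswer M) :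
    IsAnswer N := by
  induction hM generalizing N R with
  | value hV => exact .value (h.isValue hV)
  | letrec D _ ih => cases h with | letrec L _ _ _ _ _ h => exact .letrec _ (ih h)

/-! ### Comparison with `AlphaEq` -/

/-- With distinct names on each side a variable meets at most one pair of `zs`. The innermost-first
search then does not depend on the order of the pairs. -/
theorem varMatch_append {zs ρ : List (Var × Var)} (h₁ : (zs.map Prod.fst).Nodup)
    (h₂ : (zs.map Prod.snd).Nodup) {x y : Var} :
    VarMatch (zs ++ ρ) x y ↔ Bd zs (VarMatch ρ) x y := by
  induction zs with
  | nil => simp [Bd]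
  | cons p zs ih =>
    obtain ⟨a, b⟩ := p
    simp only [List.map_cons, List.nodup_cons] at h₁ h₂
    have ih := ih h₁.2 h₂.2
    simp only [List.cons_append, VarMatch, ih, Bd, List.mem_cons, Prod.mk.injEq, forall_eq_or_imp]
    constructor
    · rintro (h | ⟨hx, hy, h | h⟩)
      · exact .inl (.inl h)
      · exact .inl (.inr h)
      · exact .inr ⟨⟨Ne.symm hx, h.1⟩, ⟨Ne.symm hy, h.2.1⟩, h.2.2⟩
    · rintro ((h | h) | ⟨⟨hx, h⟩, ⟨hy, h'⟩, h''⟩)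
      · exact .inl h
      · refine .inr ⟨?_, ?_, .inl h⟩
        · rintro rfl; exact h₁.1 (List.mem_map.2 ⟨_, h, rfl⟩)
        · rintro rfl; exact h₂.1 (List.mem_map.2 ⟨_, h, rfl⟩)
      · exact .inr ⟨Ne.symm hx, Ne.symm hy, .inr ⟨h, h', h''⟩⟩

/-- Zipping the left block with the reordered right block gives the matching. -/
theorem AlphaEqIn.toAEq {ρ : List (Var × Var)} {M N : Expr} (h : AlphaEqIn ρ M N) :
    AEq (VarMatch ρ) M N := by
  induction h with
  | var h => exact .var h
  | lam h ih =>
    refine .lam (ih.mono fun a _ b _ h => ?_)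
    exact (varMatch_append (zs := [(_, _)]) (by simp) (by simp)).1 h
  | app h₁ h₂ ih₁ ih₂ => exact .app ih₁ ih₂
  | @letrec ρ D₁ D₂ D' N₁ N₂ n₁ n₂ p l h₁ h₂ ih₁ ih₂ =>
    have e : pnames (D₁.zip D') = (names D₁).zip (names D') := by
      simp [pnames, names, List.zip_map, Prod.map]
    have q₁ : (D₁.zip D').map Prod.fst = D₁ := List.map_fst_zip l.le
    have q₂ : (D₁.zip D').map Prod.snd = D' := List.map_snd_zip l.ge
    have hv : ∀ x y, VarMatch ((names D₁).zip (names D') ++ ρ) x y →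
        Bd (pnames (D₁.zip D')) (VarMatch ρ) x y := by
      intro x y h
      rw [e]
      refine (varMatch_append ?_ ?_).1 h
      · rw [List.map_fst_zip (by simp [names, l])]; exact n₁
      · rw [List.map_snd_zip (by simp [names, l])]; exact (p.map Prod.fst).nodup_iff.1 n₂
    refine .letrec (D₁.zip D') n₁ n₂ (by rw [q₁]) (by rw [q₂]; exact p.symm) ?_
      (ih₂.mono fun x _ y _ => hv x y)
    intro q hq
    obtain ⟨i, hi⟩ := List.mem_iff_getElem?.1 hq
    rw [List.getElem?_zip_eq_some] at hi
    exact (ih₁ i _ _ _ _ hi.1 hi.2).mono fun x _ y _ => hv x y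
  | bullet => exact .bullet
  | pair h₁ h₂ ih₁ ih₂ => exact .pair ih₁ ih₂
  | prj h ih => exact .prj ih

theorem AEq.toAlphaEqIn {R : Var → Var → Prop} {M N : Expr} (h : AEq R M N)
    {ρ : List (Var × Var)} (hR : ∀ x y, R x y → VarMatch ρ x y) : AlphaEqIn ρ M N := by
  induction h generalizing ρ with
  | var h => exact .var (hR _ _ h)
  | lam h ih =>
    refine .lam (ih fun x y h => ?_)
    exact (varMatch_append (zs := [(_, _)]) (by simp) (by simp)).2 (h.mono fun _ _ => hR _ _)
  | app h₁ h₂ ih₁ ih₂ => exact .app (ih₁ hR) (ih₂ hR)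
  | @letrec R D₁ D₂ N₁ N₂ L n₁ n₂ p₁ p₂ h₁ h₂ ih₁ ih₂ =>
    have nd : (L.map Prod.fst).Nodup := p₁.nodup_iff.2 (List.Nodup.of_map _ n₁)
    have : Inhabited (Var × Expr) := ⟨(0, .bullet)⟩
    obtain ⟨g, hg⟩ := exists_graph_fun nd
    -- The reordering demanded by `AlphaEqIn` lists the partners of the bindings of `D₁`, in the
    -- order of `D₁`.
    have hp : D₂.Perm (D₁.map g) := by
      have e' : (L.map Prod.fst).map g = L.map Prod.snd := by
        rw [List.map_map]; exact List.map_congr_left fun q hq => hg q hq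
      exact p₂.symm.trans (e' ▸ p₁.map g)
    have hm : ∀ z, z ∈ pnames L ↔ z ∈ (names D₁).zip (names (D₁.map g)) := by
      have e : (names D₁).zip (names (D₁.map g)) = D₁.map fun p => (p.1, (g p).1) := by
        simp [names, List.zip_map', Function.comp_def]
      intro z
      rw [e]
      simp only [pnames, List.mem_map]
      constructor
      · rintro ⟨q, hq, rfl⟩
        exact ⟨q.1, (matching_left p₁).2 ⟨q, hq, rfl⟩, by rw [hg q hq]⟩
      · rintro ⟨p, hp, rfl⟩
        obtain ⟨q, hq, rfl⟩ := (matching_left p₁).1 hp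
        exact ⟨q, hq, by rw [hg q hq]⟩
    have hv : ∀ x y, Bd (pnames L) R x y →
        VarMatch ((names D₁).zip (names (D₁.map g)) ++ ρ) x y := by
      intro x y h
      refine (varMatch_append ?_ ?_).2 ?_
      · rw [List.map_fst_zip (by simp [names])]; exact n₁
      · rw [List.map_snd_zip (by simp [names])]; exact (hp.map Prod.fst).nodup_iff.1 n₂
      · simp only [Bd, hm] at h
        exact Bd.mono (fun _ _ => hR x y) h
    refine .letrec n₁ n₂ hp (by simp) ?_ (ih₂ hv)
    intro i x y M N h h'
    rw [List.getElem?_map, h, Option.map_some, Option.some_inj] at h'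
    obtain ⟨q, hq, e⟩ := (matching_left p₁).1 (List.mem_of_getElem? h)
    have := ih₁ q hq hv
    rw [e] at this
    rw [← e, hg q hq] at h'
    rw [h'] at this
    exact this
  | bullet => exact .bullet
  | pair h₁ h₂ ih₁ ih₂ => exact .pair (ih₁ hR) (ih₂ hR)
  | prj h ih => exact .prj (ih hR)

theorem alphaEq_iff {M N : Expr} : AlphaEq M N ↔ AEq Eq M N :=
  ⟨fun h => (AlphaEqIn.toAEq h).mono fun _ _ _ _ h => h, fun h => h.toAlphaEqIn fun _ _ h => h⟩

theorem AlphaEq.symm {M N : Expr} (h : AlphaEq M N) : AlphaEq N M :=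
  alphaEq_iff.2 ((alphaEq_iff.1 h).symm fun _ _ h => h.symm)

theorem AlphaEq.trans {M N P : Expr} (h : AlphaEq M N) (h' : AlphaEq N P) : AlphaEq M P :=
  alphaEq_iff.2 ((alphaEq_iff.1 h).trans (alphaEq_iff.1 h') fun _ _ _ h h' => h.trans h')

theorem AlphaEq.refl {M : Expr} (h : M.WF) : AlphaEq M M :=
  alphaEq_iff.2 (AEq.refl h fun _ _ => rfl)

theorem AEq.fv_eq {M N : Expr} (h : AEq Eq M N) : M.fv = N.fv := by
  ext x
  constructor
  · intro hx; obtain ⟨y, hy, rfl⟩ := h.fv x hx; exact hy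
  · intro hx
    obtain ⟨y, hy, rfl⟩ := (h.symm (R' := Eq) fun _ _ h => h.symm).fv x hx; exact hy

/-! ### An environment machine -/

/-- Environments map variables to heap locations. -/
abbrev Env := Var → ℕ

/-- Machine values. -/
inductive Val : Type
  | clo (x : Var) (M : Expr) (e : Env)
  | bul
  | pr (v w : Val)

/-- The contents of heap cells and the focus of the machine. -/
inductive Code : Type
  | thunk (M : Expr) (e : Env)
  | val (v : Val)

/-- The machine value of a syntactic value. -/
def valOf : Expr → Env → Val
  | .lam x M, e => .clo x M e
  | .pair M N, e => .pr (valOf M e) (valOf N e)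
  | _, _ => .bul

open Classical in
/-- The heap cell for an expression: syntactic values are stored as machine values. -/
noncomputable def code (M : Expr) (e : Env) : Code :=
  if IsValue M then .val (valOf M e) else .thunk M e

/-- Stack frames. -/
inductive Frame : Type
  | arg (N : Expr) (e : Env)
  | upd (l : ℕ)
  | pairL (N : Expr) (e : Env)
  | pairR (v : Val)
  | prj (i : Fin 2)

/-- Machine states; heap locations are positions in the list `heap`. -/
structure State where
  heap : List Code
  stack : List Frame
  focus : Code

/-- The variables `xs` are mapped to consecutive locations from `n` on. -/
def ext (e : Env) (xs : List Var) (n : ℕ) : Env :=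
  fun y => if y ∈ xs then n + xs.idxOf y else e y

/-- The heap cells for a block. -/
noncomputable def codes (D : Defs) (e : Env) : List Code := D.map fun p => code p.2 e

/-- Machine steps, labelled with a cost. -/
inductive MStep : State → ℕ → State → Prop
  | var {h K x e c} : h[e x]? = some c →
      MStep ⟨h, K, .thunk (.var x) e⟩ 1 ⟨h.set (e x) (.val .bul), .upd (e x) :: K, c⟩
  | lam {h K x M e} : MStep ⟨h, K, .thunk (.lam x M) e⟩ 0 ⟨h, K, .val (.clo x M e)⟩
  | bullet {h K e} : MStep ⟨h, K, .thunk .bullet e⟩ 0 ⟨h, K, .val .bul⟩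
  | app {h K M N e} : MStep ⟨h, K, .thunk (.app M N) e⟩ 1 ⟨h, .arg N e :: K, .thunk M e⟩
  -- Allocation is charged by stack height, so that a `let rec` moved out of a frame or a needed
  -- binding becomes strictly cheaper.
  | letrec {h K D N e} : MStep ⟨h, K, .thunk (.letrec D N) e⟩ (1 + K.length)
      ⟨h ++ codes D (ext e (names D) h.length), K, .thunk N (ext e (names D) h.length)⟩
  | pair {h K M N e} : MStep ⟨h, K, .thunk (.pair M N) e⟩ 0 ⟨h, .pairL N e :: K, .thunk M e⟩
  | prj {h K i M e} : MStep ⟨h, K, .thunk (.prj i M) e⟩ 1 ⟨h, .prj i :: K, .thunk M e⟩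
  | ret_upd {h K l v} : MStep ⟨h, .upd l :: K, .val v⟩ 0 ⟨h.set l (.val v), K, .val v⟩
  | ret_arg {h K N e x M e'} : MStep ⟨h, .arg N e :: K, .val (.clo x M e')⟩ (1 + K.length)
      ⟨h ++ [code N e], K, .thunk M (ext e' [x] h.length)⟩
  | ret_arg_bul {h K N e} : MStep ⟨h, .arg N e :: K, .val .bul⟩ 0 ⟨h, K, .val .bul⟩
  | ret_pairL {h K N e v} : MStep ⟨h, .pairL N e :: K, .val v⟩ 0 ⟨h, .pairR v :: K, .thunk N e⟩
  | ret_pairR {h K v w} : MStep ⟨h, .pairR v :: K, .val w⟩ 0 ⟨h, K, .val (.pr v w)⟩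
  | ret_prj {h K} {i : Fin 2} {v : Fin 2 → Val} :
      MStep ⟨h, .prj i :: K, .val (.pr (v 0) (v 1))⟩ 0 ⟨h, K, .val (v i)⟩

-- Determinism, runs and halting

theorem MStep.det {s t t' : State} {c c' : ℕ} (h : MStep s c t) (h' : MStep s c' t') :
    c = c' ∧ t = t' := by
  cases h with
  | ret_prj =>
    rename_i h K i v
    -- The components of the pair are applications of a function, which case analysis cannot unify;
    -- naming them makes the state a pattern.
    generalize hv : v 0 = v0 at h'
    generalize hw : v 1 = v1 at h'
    cases h' with
    | ret_prj => refine ⟨rfl, ?_⟩; fin_cases i; all_goals simp_all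
  | _ => cases h'; all_goals simp_all

/-- Runs of the machine: number of steps and total cost. -/
inductive Steps : ℕ → ℕ → State → State → Prop
  | refl (s : State) : Steps 0 0 s s
  | head {n c d : ℕ} {s t u : State} : MStep s c t → Steps n d t u → Steps (n + 1) (c + d) s u

/-- `Run c s t`: the machine gets from `s` to `t` at total cost `c`. -/
def Run (c : ℕ) (s t : State) : Prop := ∃ n, Steps n c s t

theorem Run.refl (s : State) : Run 0 s s := ⟨0, .refl s⟩

theorem Run.head {c d : ℕ} {s t u : State} (h : MStep s c t) : Run d t u → Run (c + d) s u
  | ⟨_, h'⟩ => ⟨_, .head h h'⟩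

theorem Run.single {c : ℕ} {s t : State} (h : MStep s c t) : Run c s t := .head h (.refl t)

theorem Run.induct {P : ℕ → State → Prop} {t : State} (refl : P 0 t)
    (head : ∀ c d s u, MStep s c u → Run d u t → P d u → P (c + d) s) {c : ℕ} {s : State}
    (h : Run c s t) : P c s := by
  obtain ⟨n, h⟩ := h
  induction h with
  | refl => exact refl
  | head h h' ih => exact head _ _ _ _ h ⟨_, h'⟩ (ih refl head)

theorem Run.trans {c d : ℕ} {s t u : State} (h : Run c s t) (h' : Run d t u) :
    Run (c + d) s u := by
  refine Run.induct (P := fun c s => Run (c + d) s u) ?_ ?_ h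
  · simpa using h'
  · intro c d' s v hs _ ih
    rw [add_assoc]; exact .head hs ih

theorem Run.cast {c d : ℕ} {s t : State} (h : Run c s t) (e : c = d) : Run d s t := e ▸ h

/-- Two runs from one state: one of them is a prefix of the other one. -/
theorem Run.linear {c d : ℕ} {s t u : State} (h : Run c s t) (h' : Run d s u) :
    (∃ k, d = c + k ∧ Run k t u) ∨ (∃ k, c = d + k ∧ Run k u t) := by
  refine Run.induct (P := fun c s => ∀ d, Run d s u →
    (∃ k, d = c + k ∧ Run k t u) ∨ (∃ k, c = d + k ∧ Run k u t)) ?_ ?_ h d h'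
  · intro d h'; exact .inl ⟨d, by simp, h'⟩
  · intro c d s v hs hr ih d' h'
    obtain ⟨n, h'⟩ := h'
    cases h' with
    | refl => exact .inr ⟨_, by simp, .head hs hr⟩
    | head hs' h' =>
      obtain ⟨rfl, rfl⟩ := hs.det hs'
      rcases ih _ ⟨_, h'⟩ with ⟨k, e, hk⟩ | ⟨k, e, hk⟩
      · exact .inl ⟨k, by omega, hk⟩
      · exact .inr ⟨k, by omega, hk⟩

/-- No step is possible. -/
def Final (s : State) : Prop := ∀ c t, ¬ MStep s c t

theorem Run.of_final {c : ℕ} {s t : State} (h : Run c s t) (hs : Final s) : c = 0 ∧ t = s := by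
  obtain ⟨n, h⟩ := h
  cases h with
  | refl => exact ⟨rfl, rfl⟩
  | head h => exact absurd h (hs _ _)

/-- A run to a final state extends every run from the same state. -/
theorem Run.to_final {c d : ℕ} {s t u : State} (h : Run c s t) (h' : Run d s u) (hu : Final u) :
    ∃ k, d = c + k ∧ Run k t u := by
  rcases h.linear h' with h | ⟨k, e, hk⟩
  · exact h
  · obtain ⟨rfl, rfl⟩ := hk.of_final hu
    exact ⟨0, by omega, .refl _⟩

theorem final_halt (h : List Code) (v : Val) : Final ⟨h, [], .val v⟩ := by
  intro c t h; cases h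

/-- The machine halts with heap `h` and value `v`, at total cost `c`. -/
def Halts (s : State) (c : ℕ) (h : List Code) (v : Val) : Prop := Run c s ⟨h, [], .val v⟩

/-- A syntactic value is evaluated at no cost. -/
theorem run_value {V : Expr} (hV : IsValue V) (h : List Code) (K : List Frame) (e : Env) :
    Run 0 ⟨h, K, .thunk V e⟩ ⟨h, K, .val (valOf V e)⟩ := by
  induction hV generalizing K with
  | lam x M => exact .single .lam
  | bullet => exact .single .bullet
  | pair _ _ ih₁ ih₂ =>
    exact .head .pair ((ih₁ _).trans (.head .ret_pairL ((ih₂ _).trans (.single .ret_pairR))))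

theorem code_of_value {V : Expr} (hV : IsValue V) (e : Env) : code V e = .val (valOf V e) :=
  if_pos hV

theorem code_of_not_value {M : Expr} (hM : ¬ IsValue M) (e : Env) : code M e = .thunk M e :=
  if_neg hM

/-! ### Heap cells and lists -/

theorem ext_of_not_mem {e : Env} {xs : List Var} {n : ℕ} {y : Var} (h : y ∉ xs) :
    ext e xs n y = e y := if_neg h

theorem ext_of_mem {e : Env} {xs : List Var} {n : ℕ} {y : Var} (h : y ∈ xs) :
    ext e xs n y = n + xs.idxOf y := if_pos h

theorem ext_singleton (e : Env) (x : Var) (n : ℕ) : ext e [x] n x = n := by simp [ext]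

theorem ext_inj {e : Env} {xs : List Var} {n : ℕ} {x y : Var} (hx : x ∈ xs) (hy : y ∈ xs)
    (h : ext e xs n x = ext e xs n y) : x = y := by
  rw [ext_of_mem hx, ext_of_mem hy, Nat.add_left_cancel_iff] at h
  exact (List.idxOf_inj hx).1 h

/-- Distinct names make the first position of a name the position of its binding. -/
theorem getElem?_block {D : Defs} (hD : (names D).Nodup) {F : Var × Expr → Code} {x : Var}
    {M : Expr} (hx : (x, M) ∈ D) (h t : List Code) :
    (h ++ (D.map F ++ t))[h.length + (names D).idxOf x]? = some (F (x, M)) := by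
  rw [List.getElem?_append_right (by omega), Nat.add_sub_cancel_left]
  have hm : x ∈ names D := mem_names.2 ⟨M, hx⟩
  have hlt : (names D).idxOf x < D.length := by
    simpa [names] using List.idxOf_lt_length_of_mem hm
  rw [List.getElem?_append_left (by simpa using hlt), List.getElem?_map,
    List.getElem?_eq_getElem hlt, Option.map_some]
  have e : (D[(names D).idxOf x]).1 = x := by
    have := List.getElem_idxOf (List.idxOf_lt_length_of_mem hm)
    rwa [List.getElem_map] at this
  rw [eq_of_nodup_map hD (List.getElem_mem hlt) hx e]

/-! ### The simulation relation -/

/-- Related machine values, where `β` relates locations. -/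
inductive VRel (β : ℕ → ℕ → Prop) : Val → Val → Prop
  | clo {x y : Var} {M N : Expr} {e e' : Env} :
      AEq (Bd [(x, y)] fun a b => β (e a) (e' b)) M N → VRel β (.clo x M e) (.clo y N e')
  | bul : VRel β .bul .bul
  | pr {v w v₂ w₂ : Val} : VRel β v v₂ → VRel β w w₂ → VRel β (.pr v w) (.pr v₂ w₂)

/-- Related codes. -/
inductive CRel (β : ℕ → ℕ → Prop) : Code → Code → Prop
  | thunk {M N : Expr} {e e' : Env} :
      AEq (fun a b => β (e a) (e' b)) M N → CRel β (.thunk M e) (.thunk N e')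
  | val {v w : Val} : VRel β v w → CRel β (.val v) (.val w)

/-- Related stack frames. -/
inductive FRel (β : ℕ → ℕ → Prop) : Frame → Frame → Prop
  | arg {M N : Expr} {e e' : Env} :
      AEq (fun a b => β (e a) (e' b)) M N → FRel β (.arg M e) (.arg N e')
  | upd {l l' : ℕ} : β l l' → FRel β (.upd l) (.upd l')
  | pairL {M N : Expr} {e e' : Env} :
      AEq (fun a b => β (e a) (e' b)) M N → FRel β (.pairL M e) (.pairL N e')
  | pairR {v w : Val} : VRel β v w → FRel β (.pairR v) (.pairR w)
  | prj {i : Fin 2} : FRel β (.prj i) (.prj i)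

-- Monotonicity, symmetry and composition of the relations on code, and their agreement with
-- α-equivalence

section RelLemmas

variable {β γ δ : ℕ → ℕ → Prop}

theorem VRel.mono (hβ : ∀ a b, β a b → γ a b) {v w : Val} (h : VRel β v w) : VRel γ v w := by
  induction h with
  | clo h => exact .clo (h.mono fun x _ y _ => Bd.mono fun _ _ => hβ _ _)
  | bul => exact .bul
  | pr _ _ ih₁ ih₂ => exact .pr ih₁ ih₂

theorem CRel.mono (hβ : ∀ a b, β a b → γ a b) {c d : Code} (h : CRel β c d) : CRel γ c d := by
  cases h with
  | thunk h => exact .thunk (h.mono fun _ _ _ _ => hβ _ _)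
  | val h => exact .val (h.mono hβ)

theorem FRel.mono (hβ : ∀ a b, β a b → γ a b) {F G : Frame} (h : FRel β F G) : FRel γ F G := by
  cases h with
  | arg h => exact .arg (h.mono fun _ _ _ _ => hβ _ _)
  | upd h => exact .upd (hβ _ _ h)
  | pairL h => exact .pairL (h.mono fun _ _ _ _ => hβ _ _)
  | pairR h => exact .pairR (h.mono hβ)
  | prj => exact .prj

theorem stackRel_mono (hβ : ∀ a b, β a b → γ a b) {K K' : List Frame}
    (h : List.Forall₂ (FRel β) K K') : List.Forall₂ (FRel γ) K K' :=
  h.imp fun _ _ h => h.mono hβ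

theorem VRel.symm (hβ : ∀ a b, β a b → γ b a) {v w : Val} (h : VRel β v w) : VRel γ w v := by
  induction h with
  | clo h =>
    refine .clo (h.symm fun x y h => ?_)
    rcases h with h | ⟨h₁, h₂, h₃⟩
    · exact .inl (by simp_all)
    · exact .inr ⟨by simpa using h₂, by simpa using h₁, hβ _ _ h₃⟩
  | bul => exact .bul
  | pr _ _ ih₁ ih₂ => exact .pr ih₁ ih₂

theorem CRel.symm (hβ : ∀ a b, β a b → γ b a) {c d : Code} (h : CRel β c d) : CRel γ d c := by
  cases h with
  | thunk h => exact .thunk (h.symm fun _ _ => hβ _ _)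
  | val h => exact .val (h.symm hβ)

theorem FRel.symm (hβ : ∀ a b, β a b → γ b a) {F G : Frame} (h : FRel β F G) : FRel γ G F := by
  cases h with
  | arg h => exact .arg (h.symm fun _ _ => hβ _ _)
  | upd h => exact .upd (hβ _ _ h)
  | pairL h => exact .pairL (h.symm fun _ _ => hβ _ _)
  | pairR h => exact .pairR (h.symm hβ)
  | prj => exact .prj

theorem VRel.trans (hδ : ∀ a b c, β a b → γ b c → δ a c) {u v w : Val} (h : VRel β u v)
    (h' : VRel γ v w) : VRel δ u w := by
  induction h generalizing w with
  | clo h =>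
    cases h' with
    | clo h' =>
      refine .clo (h.trans h' fun a b c => ?_)
      rintro (h₁ | ⟨h₁, h₂, h₃⟩) (h₁' | ⟨h₁', h₂', h₃'⟩)
      · exact .inl (by simp_all)
      · simp_all
      · simp_all
      · exact .inr ⟨by simpa using h₁, by simpa using h₂', hδ _ _ _ h₃ h₃'⟩
  | bul => cases h'; exact .bul
  | pr _ _ ih₁ ih₂ => cases h' with | pr h₁ h₂ => exact .pr (ih₁ h₁) (ih₂ h₂)

theorem CRel.trans (hδ : ∀ a b c, β a b → γ b c → δ a c) {c d d' : Code} (h : CRel β c d)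
    (h' : CRel γ d d') : CRel δ c d' := by
  cases h with
  | thunk h => cases h' with | thunk h' => exact .thunk (h.trans h' fun _ _ _ => hδ _ _ _)
  | val h => cases h' with | val h' => exact .val (h.trans hδ h')

theorem FRel.trans (hδ : ∀ a b c, β a b → γ b c → δ a c) {F G G' : Frame} (h : FRel β F G)
    (h' : FRel γ G G') : FRel δ F G' := by
  cases h with
  | arg h => cases h' with | arg h' => exact .arg (h.trans h' fun _ _ _ => hδ _ _ _)
  | upd h => cases h' with | upd h' => exact .upd (hδ _ _ _ h h')
  | pairL h => cases h' with | pairL h' => exact .pairL (h.trans h' fun _ _ _ => hδ _ _ _)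
  | pairR h => cases h' with | pairR h' => exact .pairR (h.trans hδ h')
  | prj => cases h'; exact .prj

/-- `valOf` keeps the shape of a value and hands the environment to its components. Both sides must
be values because `valOf` has `bul` as its default result. -/
theorem vrel_valOf {V W : Expr} {e e' : Env} (hV : IsValue V) (hW : IsValue W) :
    VRel β (valOf V e) (valOf W e') ↔ AEq (fun a b => β (e a) (e' b)) V W := by
  induction hV generalizing W with
  | lam x M =>
    constructor
    · intro h
      cases hW with
      | lam => cases h with | clo h => exact .lam h
      | bullet => cases h
      | pair => cases h
    · intro h; cases h with | lam h => exact .clo h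
  | bullet =>
    constructor
    · intro h
      cases hW with
      | lam => cases h
      | bullet => exact .bullet
      | pair => cases h
    · intro h; cases h; exact .bul
  | pair _ _ ih₁ ih₂ =>
    constructor
    · intro h
      cases hW with
      | lam => cases h
      | bullet => cases h
      | pair w₁ w₂ => cases h with | pr h₁ h₂ => exact .pair ((ih₁ w₁).1 h₁) ((ih₂ w₂).1 h₂)
    · intro h
      cases h with
      | pair h₁ h₂ => cases hW with | pair w₁ w₂ => exact .pr ((ih₁ w₁).2 h₁) ((ih₂ w₂).2 h₂)

/-- Being a value is invariant under α-equivalence, so related expressions are stored in the same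
form. -/
theorem crel_code {M N : Expr} {e e' : Env} :
    CRel β (code M e) (code N e') ↔ AEq (fun a b => β (e a) (e' b)) M N := by
  by_cases hM : IsValue M <;> by_cases hN : IsValue N
  · rw [code_of_value hM, code_of_value hN, ← vrel_valOf hM hN]
    exact ⟨fun h => by cases h; assumption, .val⟩
  · rw [code_of_value hM, code_of_not_value hN]
    exact ⟨fun h => (nomatch h), fun h => absurd (h.isValue hM) hN⟩
  · rw [code_of_not_value hM, code_of_value hN]
    exact ⟨fun h => (nomatch h),
      fun h => absurd ((h.symm (R' := fun a b => β (e b) (e' a)) fun _ _ h => h).isValue hN) hM⟩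
  · rw [code_of_not_value hM, code_of_not_value hN]
    exact ⟨fun h => by cases h; assumption, .thunk⟩

end RelLemmas

/-- Related heaps: `β` is a bijection between the locations of `H₁` and those locations of `H₂`
that are not in `X`, and related locations have related contents. -/
structure HRel (β : ℕ → ℕ → Prop) (X : Set ℕ) (H₁ H₂ : ℕ → Option Code) : Prop where
  bij : ∀ {a b a' b'}, β a b → β a' b' → (a = a' ↔ b = b')
  rel : ∀ {a b}, β a b → ∃ c d, H₁ a = some c ∧ H₂ b = some d ∧ CRel β c d
  totl : ∀ {a c}, H₁ a = some c → ∃ b, β a b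
  totr : ∀ {b d}, H₂ b = some d → b ∉ X → ∃ a, β a b
  excl : ∀ {a b}, b ∈ X → ¬ β a b
  dom : ∀ {b}, b ∈ X → ∃ d, H₂ b = some d

/-- `β` extended by the locations of newly bound variables. -/
def allocRel (β : ℕ → ℕ → Prop) (zs : List (Var × Var)) (f g : Var → ℕ) (a b : ℕ) : Prop :=
  β a b ∨ ∃ p ∈ zs, a = f p.1 ∧ b = g p.2

-- Extending, updating and composing relations between heaps

section HRelLemmas

variable {β γ : ℕ → ℕ → Prop} {X X' : Set ℕ} {H₁ H₂ H₃ H₁' H₂' : ℕ → Option Code}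

/-- Glues to `β` a bijection `γ` that is disjoint from it on both sides. The excluded set may change
as well: when blocks are flattened, cells that had no partner receive one. -/
theorem HRel.extend (h : HRel β X H₁ H₂) (mono₁ : ∀ {a c}, H₁ a = some c → H₁' a = some c)
    (mono₂ : ∀ {b d}, H₂ b = some d → H₂' b = some d)
    (γbij : ∀ {a b a' b'}, γ a b → γ a' b' → (a = a' ↔ b = b'))
    (γl : ∀ {a b b'}, γ a b → ¬ β a b') (γr : ∀ {a b a'}, γ a b → ¬ β a' b)
    (γrel : ∀ {a b}, γ a b →
      ∃ c d, H₁' a = some c ∧ H₂' b = some d ∧ CRel (fun a b => β a b ∨ γ a b) c d)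
    (totl : ∀ {a c}, H₁' a = some c → H₁ a = some c ∨ ∃ b, γ a b)
    (totr : ∀ {b d}, H₂' b = some d → b ∉ X' → (H₂ b = some d ∧ b ∉ X) ∨ ∃ a, γ a b)
    (excl : ∀ {a b}, b ∈ X' → ¬ β a b ∧ ¬ γ a b) (dom : ∀ {b}, b ∈ X' → ∃ d, H₂' b = some d) :
    HRel (fun a b => β a b ∨ γ a b) X' H₁' H₂' where
  bij := by
    rintro a b a' b' (k | k) (k' | k')
    · exact h.bij k k'
    · exact ⟨fun e => absurd (e ▸ k) (γl k'), fun e => absurd (e ▸ k) (γr k')⟩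
    · exact ⟨fun e => absurd (e ▸ k') (γl k), fun e => absurd (e ▸ k') (γr k)⟩
    · exact γbij k k'
  rel := by
    rintro a b (k | k)
    · obtain ⟨c, d, h₁, h₂, h₃⟩ := h.rel k
      exact ⟨c, d, mono₁ h₁, mono₂ h₂, h₃.mono fun _ _ => .inl⟩
    · exact γrel k
  totl := by
    intro a c k
    rcases totl k with k | ⟨b, k⟩
    · obtain ⟨b, k⟩ := h.totl k; exact ⟨b, .inl k⟩
    · exact ⟨b, .inr k⟩
  totr := by
    intro b d k hb
    rcases totr k hb with ⟨k, k'⟩ | ⟨a, k⟩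
    · obtain ⟨a, k⟩ := h.totr k k'; exact ⟨a, .inl k⟩
    · exact ⟨a, .inr k⟩
  excl := by
    rintro a b hb (k | k)
    exacts [(excl hb).1 k, (excl hb).2 k]
  dom := dom

theorem HRel.alloc (h : HRel β X H₁ H₂) {zs : List (Var × Var)} {f g : Var → ℕ}
    (hf : (zs.map Prod.fst).Nodup) (hg : (zs.map Prod.snd).Nodup)
    (injf : ∀ p ∈ zs, ∀ q ∈ zs, f p.1 = f q.1 → p.1 = q.1)
    (injg : ∀ p ∈ zs, ∀ q ∈ zs, g p.2 = g q.2 → p.2 = q.2)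
    (freshl : ∀ p ∈ zs, H₁ (f p.1) = none) (freshr : ∀ p ∈ zs, H₂ (g p.2) = none)
    (keepl : ∀ a, (∀ p ∈ zs, a ≠ f p.1) → H₁' a = H₁ a)
    (keepr : ∀ b, (∀ p ∈ zs, b ≠ g p.2) → H₂' b = H₂ b)
    (rel : ∀ p ∈ zs, ∃ c d, H₁' (f p.1) = some c ∧ H₂' (g p.2) = some d ∧
      CRel (allocRel β zs f g) c d) : HRel (allocRel β zs f g) X H₁' H₂' := by
  have keepl' : ∀ {a c}, H₁ a = some c → H₁' a = some c := by
    intro a c k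
    rw [keepl a (fun p hp e => by rw [e, freshl p hp] at k; cases k), k]
  have keepr' : ∀ {a c}, H₂ a = some c → H₂' a = some c := by
    intro a c k
    rw [keepr a (fun p hp e => by rw [e, freshr p hp] at k; cases k), k]
  refine h.extend (γ := fun a b => ∃ p ∈ zs, a = f p.1 ∧ b = g p.2) keepl' keepr' ?_ ?_ ?_ ?_ ?_
    ?_ ?_ ?_
  · rintro a b a' b' ⟨p, hp, rfl, rfl⟩ ⟨q, hq, rfl, rfl⟩
    constructor
    · intro e; rw [eq_of_nodup_map hf hp hq (injf p hp q hq e)]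
    · intro e; rw [eq_of_nodup_map hg hp hq (injg p hp q hq e)]
  · rintro a b b' ⟨p, hp, rfl, rfl⟩ k
    obtain ⟨c, d, h₁, -⟩ := h.rel k
    rw [freshl p hp] at h₁; cases h₁
  · rintro a b b' ⟨p, hp, rfl, rfl⟩ k
    obtain ⟨c, d, -, h₁, -⟩ := h.rel k
    rw [freshr p hp] at h₁; cases h₁
  · rintro a b ⟨p, hp, rfl, rfl⟩
    exact rel p hp
  · intro a c k
    by_cases hp : ∃ p ∈ zs, a = f p.1
    · obtain ⟨p, hp, rfl⟩ := hp; exact .inr ⟨_, p, hp, rfl, rfl⟩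
    · push Not at hp
      exact .inl (by rw [← keepl a hp, k])
  · intro b c k hb
    by_cases hp : ∃ p ∈ zs, b = g p.2
    · obtain ⟨p, hp, rfl⟩ := hp; exact .inr ⟨_, p, hp, rfl, rfl⟩
    · push Not at hp
      exact .inl ⟨by rw [← keepr b hp, k], hb⟩
  · intro a b hb
    refine ⟨h.excl hb, ?_⟩
    rintro ⟨p, hp, rfl, rfl⟩
    obtain ⟨d, k⟩ := h.dom hb
    rw [freshr p hp] at k; cases k
  · intro b hb
    obtain ⟨d, k⟩ := h.dom hb
    exact ⟨d, keepr' k⟩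

/-- Carries an α-equivalence of the code below the binders over to the extended environments: bound
variables meet in the new pairs, all others keep their locations. -/
theorem allocRel_of_bd {zs : List (Var × Var)} {e₁ e₂ f g : Var → ℕ}
    (hf : ∀ x, (∀ p ∈ zs, p.1 ≠ x) → f x = e₁ x) (hg : ∀ x, (∀ p ∈ zs, p.2 ≠ x) → g x = e₂ x)
    {x y : Var} (h : Bd zs (fun a b => β (e₁ a) (e₂ b)) x y) : allocRel β zs f g (f x) (g y) := by
  rcases h with h | ⟨h₁, h₂, h₃⟩
  · exact .inr ⟨_, h, rfl, rfl⟩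
  · left; rw [hf x h₁, hg y h₂]; exact h₃

/-- By bijectivity the update touches no other related pair, and `b` is not excluded because it has
a partner. -/
theorem HRel.set (h : HRel β X H₁ H₂) {a b : ℕ} (hab : β a b) {c d : Code} (hcd : CRel β c d) :
    HRel β X (Function.update H₁ a (some c)) (Function.update H₂ b (some d)) where
  bij := h.bij
  rel := by
    intro a' b' k
    by_cases e : a' = a
    · have e' := (h.bij k hab).1 e
      subst e e'
      exact ⟨c, d, by simp, by simp, hcd⟩
    · have e' : b' ≠ b := fun e' => e ((h.bij k hab).2 e')
      rw [Function.update_of_ne e, Function.update_of_ne e']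
      exact h.rel k
  totl := by
    intro a' c' k
    by_cases e : a' = a
    · exact ⟨b, e ▸ hab⟩
    · rw [Function.update_of_ne e] at k; exact h.totl k
  totr := by
    intro b' c' k hb
    by_cases e : b' = b
    · exact ⟨a, e ▸ hab⟩
    · rw [Function.update_of_ne e] at k; exact h.totr k hb
  excl := h.excl
  dom := by
    intro b' hb
    have e : b' ≠ b := by rintro rfl; exact h.excl hb hab
    rw [Function.update_of_ne e]; exact h.dom hb

theorem HRel.symm (h : HRel β ∅ H₁ H₂) : HRel (fun a b => β b a) ∅ H₂ H₁ where
  bij := fun k k' => (h.bij k k').symm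
  rel := fun k => by
    obtain ⟨c, d, h₁, h₂, h₃⟩ := h.rel k
    exact ⟨d, c, h₂, h₁, h₃.symm fun _ _ h => h⟩
  totl := fun k => h.totr k (by simp)
  totr := fun k _ => h.totl k
  excl := fun k => by simp at k
  dom := fun k => by simp at k

theorem HRel.trans (h : HRel β ∅ H₁ H₂) (h' : HRel γ ∅ H₂ H₃) :
    HRel (fun a c => ∃ b, β a b ∧ γ b c) ∅ H₁ H₃ where
  bij := by
    rintro a c a' c' ⟨b, k₁, k₂⟩ ⟨b', k₁', k₂'⟩
    exact (h.bij k₁ k₁').trans (h'.bij k₂ k₂')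
  rel := by
    rintro a c ⟨b, k₁, k₂⟩
    obtain ⟨c, d, h₁, h₂, h₃⟩ := h.rel k₁
    obtain ⟨c', d', h₁', h₂', h₃'⟩ := h'.rel k₂
    rw [h₂, Option.some_inj] at h₁'
    subst h₁'
    exact ⟨_, _, h₁, h₂', h₃.trans (fun a b c k k' => ⟨b, k, k'⟩) h₃'⟩
  totl := by
    intro a c k
    obtain ⟨b, k⟩ := h.totl k
    obtain ⟨_, _, -, h₂, -⟩ := h.rel k
    obtain ⟨c, k'⟩ := h'.totl h₂
    exact ⟨c, b, k, k'⟩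
  totr := by
    intro a c k _
    obtain ⟨b, k⟩ := h'.totr k (by simp)
    obtain ⟨_, _, h₂, -, -⟩ := h'.rel k
    obtain ⟨c, k'⟩ := h.totr h₂ (by simp)
    exact ⟨c, b, k', k⟩
  excl := fun k => by simp at k
  dom := fun k => by simp at k

end HRelLemmas

/-- A list as a heap. -/
def lk (h : List Code) : ℕ → Option Code := fun l => h[l]?

theorem lk_set {h : List Code} {l : ℕ} {d : Code} (hl : lk h l = some d) (c : Code) :
    lk (h.set l c) = Function.update (lk h) l (some c) := by
  have hlt : l < h.length := (List.getElem?_eq_some_iff.1 hl).1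
  funext k
  by_cases e : k = l
  · subst e; simp [lk, hlt]
  · rw [Function.update_of_ne e]; simp [lk, Ne.symm e]

theorem lk_none {h : List Code} {l : ℕ} (hl : h.length ≤ l) : lk h l = none := by
  simp [lk, hl]

theorem lk_lt {h : List Code} {l : ℕ} {c : Code} (hl : lk h l = some c) : l < h.length :=
  (List.getElem?_eq_some_iff.1 hl).1

theorem lk_codes {D : Defs} (hD : (names D).Nodup) {x : Var} {M : Expr} (hx : (x, M) ∈ D)
    (h : List Code) (e e' : Env) :
    lk (h ++ codes D e) (ext e' (names D) h.length x) = some (code M e) := by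
  rw [ext_of_mem (mem_names.2 ⟨M, hx⟩)]
  have := getElem?_block hD (F := fun p => code p.2 e) hx h []
  rwa [List.append_nil] at this

theorem lk_codes_keep {D : Defs} {h : List Code} {e e' : Env} {a : ℕ}
    (ha : ∀ x ∈ names D, a ≠ ext e' (names D) h.length x) (hD : (names D).Nodup) :
    lk (h ++ codes D e) a = lk h a := by
  unfold lk
  by_cases hlt : a < h.length
  · rw [List.getElem?_append_left hlt]
  · rw [List.getElem?_append_right (by omega), List.getElem?_eq_none_iff.2 (by omega : _ ≤ a),
      List.getElem?_eq_none_iff]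
    by_contra hc
    push Not at hc
    have hc' : a - h.length < (names D).length := by simpa [codes, names] using hc
    refine ha ((names D)[a - h.length]) (List.getElem_mem _) ?_
    rw [ext_of_mem (List.getElem_mem _), hD.idxOf_getElem]; omega

/-- Related states. -/
structure SRel (β : ℕ → ℕ → Prop) (X : Set ℕ) (s t : State) : Prop where
  heap : HRel β X (lk s.heap) (lk t.heap)
  stack : List.Forall₂ (FRel β) s.stack t.stack
  focus : CRel β s.focus t.focus

/-- The left heap is arbitrary, so that the lemma serves both a second machine heap and a heap of
the natural semantics. -/
theorem HRel.alloc_block {β : ℕ → ℕ → Prop} {X : Set ℕ} {H₁ : ℕ → Option Code} {h : List Code}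
    (hh : HRel β X H₁ (lk h)) {D : Defs} {L : List ((Var × Expr) × (Var × Expr))}
    (hD : (names D).Nodup) (hL : (L.map Prod.snd).Perm D) {e : Env} {f : Var → ℕ}
    {H₁' : ℕ → Option Code}
    (hf : ((pnames L).map Prod.fst).Nodup)
    (injf : ∀ p ∈ pnames L, ∀ q ∈ pnames L, f p.1 = f q.1 → p.1 = q.1)
    (freshl : ∀ p ∈ pnames L, H₁ (f p.1) = none)
    (keepl : ∀ a, (∀ p ∈ pnames L, a ≠ f p.1) → H₁' a = H₁ a)
    (rel : ∀ q ∈ L, ∃ c, H₁' (f q.1.1) = some c ∧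
      CRel (allocRel β (pnames L) f (ext e (names D) h.length)) c
        (code q.2.2 (ext e (names D) h.length))) :
    HRel (allocRel β (pnames L) f (ext e (names D) h.length)) X H₁'
      (lk (h ++ codes D (ext e (names D) h.length))) := by
  refine hh.alloc hf (pnames_snd_nodup hD hL) injf ?_ freshl ?_ keepl ?_ ?_
  · intro p hp q hq
    exact ext_inj ((matching_right_names hL).2 ⟨p, hp, rfl⟩)
      ((matching_right_names hL).2 ⟨q, hq, rfl⟩)
  · intro p hp
    rw [ext_of_mem ((matching_right_names hL).2 ⟨p, hp, rfl⟩)]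
    exact lk_none (by omega)
  · intro b hb
    refine lk_codes_keep (e' := e) (fun x hx => ?_) hD
    obtain ⟨p, hp, rfl⟩ := (matching_right_names hL).1 hx
    exact hb p hp
  · intro p hp
    obtain ⟨q, hq, rfl⟩ := List.mem_map.1 hp
    obtain ⟨c, h₁, h₂⟩ := rel q hq
    exact ⟨c, _, h₁, lk_codes hD (M := q.2.2) ((matching_right hL).2 ⟨q, hq, rfl⟩) _ _ _, h₂⟩

/-- The machine inspects only the shape of the focus and of the top frame, which related states
share. Cells in `X` have no partner, hence are never addressed and stay as they are. -/
theorem bisim {β : ℕ → ℕ → Prop} {X : Set ℕ} {s t s' : State} {c : ℕ} (h : SRel β X s t)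
    (hs : MStep s c s') : ∃ β' t', MStep t c t' ∧ (∀ a b, β a b → β' a b) ∧ SRel β' X s' t' ∧
      ∀ b ∈ X, lk t'.heap b = lk t.heap b := by
  obtain ⟨h₂, K₂, c₂⟩ := t
  obtain ⟨hh, hK, hc⟩ := h
  cases hs with
  | @var h K x e c hx =>
    cases hc with
    | @thunk _ _ _ e' hc =>
      cases hc with
      | @var _ _ y hxy =>
        obtain ⟨c', d, k₁, k₂, k₃⟩ := hh.rel hxy
        have : c = c' := by simpa [lk, hx] using k₁
        subst this
        refine ⟨β, _, .var k₂, fun _ _ h => h, ⟨?_, .cons (.upd hxy) hK, k₃⟩, ?_⟩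
        · simp only
          rw [lk_set k₁, lk_set k₂]; exact hh.set hxy (.val .bul)
        · intro b hb
          simp only
          rw [lk_set k₂, Function.update_of_ne]
          rintro rfl; exact hh.excl hb hxy
  | lam =>
    cases hc with
    | thunk hc =>
      cases hc with
      | lam hc =>
        exact ⟨β, _, .lam, fun _ _ h => h, ⟨hh, hK, .val (.clo hc)⟩, fun _ _ => rfl⟩
  | bullet =>
    cases hc with
    | thunk hc =>
      cases hc with
      | bullet => exact ⟨β, _, .bullet, fun _ _ h => h, ⟨hh, hK, .val .bul⟩, fun _ _ => rfl⟩
  | app =>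
    cases hc with
    | thunk hc =>
      cases hc with
      | app hc hc' =>
        exact ⟨β, _, .app, fun _ _ h => h, ⟨hh, .cons (.arg hc') hK, .thunk hc⟩, fun _ _ => rfl⟩
  | @letrec h K D N e =>
    cases hc with
    | @thunk _ _ _ e' hc =>
      cases hc with
      | @letrec _ _ D' _ N' L n₁ n₂ p₁ p₂ k₁ k₂ =>
        -- Stack height is part of the cost and agrees for related stacks.
        have hl : K.length = K₂.length := hK.length_eq
        have hst := @MStep.letrec h₂ K₂ D' N' e'
        rw [← hl] at hst
        have htr : ∀ x y, Bd (pnames L) (fun a b => β (e a) (e' b)) x y →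
            allocRel β (pnames L) (ext e (names D) h.length) (ext e' (names D') h₂.length)
              (ext e (names D) h.length x) (ext e' (names D') h₂.length y) := fun x y hxy =>
          allocRel_of_bd (fun x hx => ext_of_not_mem (by
              rw [matching_left_names p₁]; rintro ⟨p, hp, e⟩; exact hx p hp e))
            (fun x hx => ext_of_not_mem (by
              rw [matching_right_names p₂]; rintro ⟨p, hp, e⟩; exact hx p hp e)) hxy
        refine ⟨allocRel β (pnames L) (ext e (names D) h.length) (ext e' (names D') h₂.length),
          _, hst, fun _ _ h => .inl h,
          ⟨?_, stackRel_mono (fun _ _ => .inl) hK, .thunk (k₂.mono fun x _ y _ => htr x y)⟩, ?_⟩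
        · refine hh.alloc_block n₂ p₂ (pnames_fst_nodup n₁ p₁) ?_ ?_ ?_ ?_
          · intro p hp q hq
            exact ext_inj ((matching_left_names p₁).2 ⟨p, hp, rfl⟩)
              ((matching_left_names p₁).2 ⟨q, hq, rfl⟩)
          · intro p hp
            rw [ext_of_mem ((matching_left_names p₁).2 ⟨p, hp, rfl⟩)]
            exact lk_none (by simp)
          · intro b hb
            refine lk_codes_keep (e' := e) (fun x hx => ?_) n₁
            obtain ⟨p, hp, rfl⟩ := (matching_left_names p₁).1 hx
            exact hb p hp
          · intro q hq
            refine ⟨_, lk_codes n₁ (M := q.1.2) ((matching_left p₁).2 ⟨q, hq, rfl⟩) _ _ _, ?_⟩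
            exact crel_code.2 ((k₁ q hq).mono fun x _ y _ => htr x y)
        · intro b hb
          obtain ⟨d, hd⟩ := hh.dom hb
          simp only at hd ⊢
          have := lk_lt hd
          simp [lk, List.getElem?_append_left this]
  | pair =>
    cases hc with
    | thunk hc =>
      cases hc with
      | pair hc hc' =>
        exact ⟨β, _, .pair, fun _ _ h => h, ⟨hh, .cons (.pairL hc') hK, .thunk hc⟩, fun _ _ => rfl⟩
  | prj =>
    cases hc with
    | thunk hc =>
      cases hc with
      | prj hc =>
        exact ⟨β, _, .prj, fun _ _ h => h, ⟨hh, .cons .prj hK, .thunk hc⟩, fun _ _ => rfl⟩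
  | ret_upd =>
    cases hK with
    | cons hF hK =>
      cases hF with
      | upd hl =>
        cases hc with
        | val hc =>
          obtain ⟨c', d, k₁, k₂, k₃⟩ := hh.rel hl
          refine ⟨β, _, .ret_upd, fun _ _ h => h, ⟨?_, hK, .val hc⟩, ?_⟩
          · simp only at k₁ k₂ ⊢
            rw [lk_set k₁, lk_set k₂]; exact hh.set hl (.val hc)
          · intro b hb
            simp only at k₂ ⊢
            rw [lk_set k₂, Function.update_of_ne]
            rintro rfl; exact hh.excl hb hl
  | @ret_arg h K N e x M e' =>
    cases hK with
    | @cons _ _ _ K₂ hF hK =>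
      cases hF with
      | @arg _ N₂ _ e₂ hN =>
        cases hc with
        | val hc =>
          cases hc with
          | @clo _ y _ M₂ _ e₂' hc =>
            have hst := @MStep.ret_arg h₂ K₂ N₂ e₂ y M₂ e₂'
            rw [← hK.length_eq] at hst
            refine ⟨allocRel β [(x, y)] (ext e' [x] h.length) (ext e₂' [y] h₂.length), _,
              hst, fun _ _ h => .inl h, ⟨?_, stackRel_mono (fun _ _ => .inl) hK,
                .thunk (hc.mono fun a _ b _ hab => ?_)⟩, ?_⟩
            · refine hh.alloc (by simp) (by simp) (by simp) (by simp) ?_ ?_ ?_ ?_ ?_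
              · simp [ext_singleton, lk]
              · simp [ext_singleton, lk]
              · intro a ha
                simp only [List.mem_singleton, forall_eq, ext_singleton] at ha
                simp only [lk]
                rcases lt_or_gt_of_ne ha with h' | h'
                · rw [List.getElem?_append_left h']
                · rw [List.getElem?_eq_none_iff.2 (by simp; omega),
                    List.getElem?_eq_none_iff.2 (by omega)]
              · intro a ha
                simp only [List.mem_singleton, forall_eq, ext_singleton] at ha
                simp only [lk]
                rcases lt_or_gt_of_ne ha with h' | h'
                · rw [List.getElem?_append_left h']
                · rw [List.getElem?_eq_none_iff.2 (by simp; omega),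
                    List.getElem?_eq_none_iff.2 (by omega)]
              · intro p hp
                obtain rfl := List.mem_singleton.1 hp
                refine ⟨code N e, code N₂ e₂, by simp [ext_singleton, lk],
                  by simp [ext_singleton, lk], ?_⟩
                exact (crel_code.2 hN).mono fun _ _ => .inl
            · refine allocRel_of_bd ?_ ?_ hab
              · intro z hz; exact ext_of_not_mem (by simpa [eq_comm] using hz)
              · intro z hz; exact ext_of_not_mem (by simpa [eq_comm] using hz)
            · intro b hb
              obtain ⟨d, hd⟩ := hh.dom hb
              simp only at hd ⊢
              have := lk_lt hd
              simp [lk, List.getElem?_append_left this]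
  | ret_arg_bul =>
    cases hK with
    | cons hF hK =>
      cases hF with
      | arg hN =>
        cases hc with
        | val hc =>
          cases hc with
          | bul => exact ⟨β, _, .ret_arg_bul, fun _ _ h => h, ⟨hh, hK, .val .bul⟩, fun _ _ => rfl⟩
  | ret_pairL =>
    cases hK with
    | cons hF hK =>
      cases hF with
      | pairL hN =>
        cases hc with
        | val hc =>
          exact ⟨β, _, .ret_pairL, fun _ _ h => h, ⟨hh, .cons (.pairR hc) hK, .thunk hN⟩,
            fun _ _ => rfl⟩
  | ret_pairR =>
    cases hK with
    | cons hF hK =>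
      cases hF with
      | pairR hv =>
        cases hc with
        | val hc =>
          exact ⟨β, _, .ret_pairR, fun _ _ h => h, ⟨hh, hK, .val (.pr hv hc)⟩, fun _ _ => rfl⟩
  | @ret_prj h K i v =>
    cases hK with
    | cons hF hK =>
      cases hF with
      | prj =>
        cases hc with
        | val hc =>
          cases hc with
          | @pr _ _ v' w' h₁ h₂ =>
            refine ⟨β, _, .ret_prj (v := ![v', w']), fun _ _ h => h, ⟨hh, hK, .val ?_⟩,
              fun _ _ => rfl⟩
            fin_cases i
            exacts [h₁, h₂]

theorem bisim_run {β : ℕ → ℕ → Prop} {X : Set ℕ} {s t s' : State} {c : ℕ} (h : SRel β X s t)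
    (hs : Run c s s') : ∃ β' t', Run c t t' ∧ (∀ a b, β a b → β' a b) ∧ SRel β' X s' t' ∧
      ∀ b ∈ X, lk t'.heap b = lk t.heap b := by
  refine Run.induct (P := fun c s => ∀ β t, SRel β X s t → ∃ β' t', Run c t t' ∧
    (∀ a b, β a b → β' a b) ∧ SRel β' X s' t' ∧ ∀ b ∈ X, lk t'.heap b = lk t.heap b) ?_ ?_ hs β t h
  · intro β t h
    exact ⟨β, t, .refl t, fun _ _ h => h, h, fun _ _ => rfl⟩
  · intro c d s u hs _ ih β t h
    obtain ⟨β', t', k₁, k₂, k₃, k₄⟩ := bisim h hs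
    obtain ⟨β'', t'', k₁', k₂', k₃', k₄'⟩ := ih β' t' k₃
    exact ⟨β'', t'', .head k₁ k₁', fun a b h => k₂' a b (k₂ a b h), k₃',
      fun b hb => (k₄' b hb).trans (k₄ b hb)⟩

theorem SRel.symm {β : ℕ → ℕ → Prop} {s t : State} (h : SRel β ∅ s t) :
    SRel (fun a b => β b a) ∅ t s :=
  ⟨h.heap.symm, h.stack.flip.imp fun _ _ h => FRel.symm (fun _ _ h => h) h,
    h.focus.symm fun _ _ h => h⟩

theorem forall₂_trans {α : Type*} {R S T : α → α → Prop} (hT : ∀ a b c, R a b → S b c → T a c)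
    {l₁ l₂ l₃ : List α} (h : List.Forall₂ R l₁ l₂) (h' : List.Forall₂ S l₂ l₃) :
    List.Forall₂ T l₁ l₃ := by
  induction h generalizing l₃ with
  | nil => cases h'; exact .nil
  | cons h _ ih => cases h' with | cons h' hs' => exact .cons (hT _ _ _ h h') (ih hs')

theorem SRel.trans {β γ : ℕ → ℕ → Prop} {s t u : State} (h : SRel β ∅ s t) (g : SRel γ ∅ t u) :
    SRel (fun a c => ∃ b, β a b ∧ γ b c) ∅ s u :=
  ⟨h.heap.trans g.heap,
    forall₂_trans (fun _ _ _ k k' => k.trans (fun _ b _ l l' => ⟨b, l, l'⟩) k') h.stack g.stack,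
    h.focus.trans (fun _ b _ k l => ⟨b, k, l⟩) g.focus⟩

/-- The identity on the first `n` locations. -/
def idRel (n a b : ℕ) : Prop := a = b ∧ a < n

/-- States without dangling references are related to themselves. -/
def Closed (s : State) : Prop := ∃ β, SRel β ∅ s s

/-- Composing `β` with its converse gives the identity on the allocated locations, since `β` is a
total bijection on them. -/
theorem Closed.idRel {s : State} (h : Closed s) : SRel (idRel s.heap.length) ∅ s s := by
  obtain ⟨β, h⟩ := h
  have h' := h.trans h.symm
  have e : (fun a c => ∃ b, β a b ∧ β c b) = NeedRec.idRel s.heap.length := by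
    funext a c
    refine propext ⟨?_, ?_⟩
    · rintro ⟨b, k, k'⟩
      refine ⟨(h.heap.bij k k').2 rfl, ?_⟩
      obtain ⟨_, _, k, -⟩ := h.heap.rel k
      exact lk_lt k
    · rintro ⟨rfl, k⟩
      obtain ⟨b, k⟩ := h.heap.totl (a := a) (c := s.heap[a]) (by simp [lk, k])
      exact ⟨b, k, k⟩
  rw [e] at h'
  exact h'

/-- Simulate the step from the state to itself; by determinism the simulating step is the same one.
-/
theorem Closed.step {s t : State} {c : ℕ} (h : Closed s) (hs : MStep s c t) : Closed t := by
  obtain ⟨β, h⟩ := h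
  obtain ⟨β', t', k₁, -, k₃, -⟩ := bisim h hs
  obtain ⟨-, rfl⟩ := hs.det k₁
  exact ⟨β', k₃⟩

theorem Closed.run {s t : State} {c : ℕ} (h : Closed s) (hr : Run c s t) : Closed t :=
  Run.induct (P := fun _ s => Closed s → Closed t) id (fun _ _ _ _ hs _ ih h => ih (h.step hs)) hr h

/-! ### Joinable states -/

/-- `s` runs at cost `c` to `s'`, up to a common continuation of both; up to nothing if `p`. -/
def Join (p : Prop) (c : ℕ) (s s' : State) : Prop :=
  ∃ d u, Run (c + d) s u ∧ Run d s' u ∧ (p → d = 0 ∧ u = s')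

theorem Join.of_run {p : Prop} {c : ℕ} {s s' : State} (h : Run c s s') : Join p c s s' :=
  ⟨0, s', by simpa using h, .refl _, fun _ => ⟨rfl, rfl⟩⟩

theorem Join.run {p : Prop} {c : ℕ} {s s' : State} (h : Join p c s s') (hp : p) : Run c s s' := by
  obtain ⟨d, u, h₁, -, h₃⟩ := h
  obtain ⟨rfl, rfl⟩ := h₃ hp
  simpa using h₁

theorem Join.imp {p q : Prop} {c : ℕ} {s s' : State} (h : Join p c s s') (hp : q → p) :
    Join q c s s' := by
  obtain ⟨d, u, h₁, h₂, h₃⟩ := h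
  exact ⟨d, u, h₁, h₂, fun hq => h₃ (hp hq)⟩

theorem Join.trans {p : Prop} {c d : ℕ} {s t u : State} (h : Join p c s t) (h' : Join p d t u) :
    Join p (c + d) s u := by
  by_cases hp : p
  · exact .of_run ((h.run hp).trans (h'.run hp))
  · obtain ⟨k, v, h₁, h₂, -⟩ := h
    obtain ⟨k', v', h₁', h₂', -⟩ := h'
    -- Two runs leave `t`, one from each hypothesis; the longer one supplies the common
    -- continuation.
    rcases h₂.linear h₁' with ⟨j, e, hj⟩ | ⟨j, e, hj⟩
    · exact ⟨k', v', (h₁.trans hj).cast (by omega), h₂', fun h => absurd h hp⟩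
    · exact ⟨k' + j, v, h₁.cast (by omega), h₂'.trans hj, fun h => absurd h hp⟩

theorem Join.halts {p : Prop} {c k : ℕ} {s s' : State} {h : List Code} {v : Val}
    (hj : Join p c s s') (hs : Halts s k h v) : ∃ k', k = c + k' ∧ Halts s' k' h v := by
  obtain ⟨d, u, h₁, h₂, -⟩ := hj
  obtain ⟨j, e, hj⟩ := h₁.to_final hs (final_halt h v)
  exact ⟨d + j, by omega, h₂.trans hj⟩

theorem Join.run_final {p : Prop} {c k : ℕ} {s s' t : State} (hj : Join p c s s')
    (hs : Run k s' t) (ht : Final t) : Run (c + k) s t := by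
  obtain ⟨d, u, h₁, h₂, -⟩ := hj
  obtain ⟨j, e, hj⟩ := h₂.to_final hs ht
  exact (h₁.trans hj).cast (by omega)

/-- This is why `Join` is needed. A cell with a syntactic value returns its machine value at once,
so the run never visits the thunk and meets it only after its free evaluation. Any other cell is a
thunk, and the run passes through it exactly. -/
theorem join_lookup {h : List Code} {K : List Frame} {x : Var} {e e' : Env} {N : Expr}
    (hx : h[e x]? = some (code N e')) :
    Join (¬ IsValue N) 1 ⟨h, K, .thunk (.var x) e⟩
      ⟨h.set (e x) (.val .bul), .upd (e x) :: K, .thunk N e'⟩ := by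
  refine ⟨0, ⟨h.set (e x) (.val .bul), .upd (e x) :: K, code N e'⟩, .single (.var hx), ?_, ?_⟩
  · by_cases hN : IsValue N
    · rw [code_of_value hN]; exact run_value hN _ _ _
    · rw [code_of_not_value hN]; exact .refl _
  · intro hN; exact ⟨rfl, by rw [code_of_not_value hN]⟩

/-! ### Contexts -/

theorem ctx_dep_ind {P : Ctx → Prop} {Q : Dep → Prop} (hole : P .hole)
    (app : ∀ E M, P E → P (.app E M)) (letBody : ∀ D E, P E → P (.letBody D E))
    (letBind : ∀ x E D E', P E → P E' → P (.letBind x E D E'))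
    (letDep : ∀ x' E Δ D E', P E → Q Δ → P E' → P (.letDep x' E Δ D E'))
    (pairL : ∀ E M, P E → P (.pairL E M)) (pairR : ∀ V hV E, P E → P (.pairR V hV E))
    (prj : ∀ i E, P E → P (.prj i E)) (base : ∀ x E, P E → Q (.base x E))
    (snoc : ∀ Δ x'' E, Q Δ → P E → Q (.snoc Δ x'' E)) : (∀ E, P E) ∧ ∀ Δ, Q Δ :=
  ⟨fun E => Ctx.rec (motive_1 := P) (motive_2 := Q) hole app letBody letBind letDep pairL pairR prj
      base snoc E,
    fun Δ => Dep.rec (motive_1 := P) (motive_2 := Q) hole app letBody letBind letDep pairL pairR prj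
      base snoc Δ⟩

/-- The variables defined by a dependency. -/
def Dep.names : Dep → List Var
  | .base x _ => [x]
  | .snoc Δ x _ => Δ.names ++ [x]

/-- The variables that a context binds at its hole. -/
def Ctx.capt : Ctx → List Var
  | .hole => []
  | .app E _ => E.capt
  | .letBody D E => NeedRec.names D ++ E.capt
  | .letBind x E D _ => x :: (NeedRec.names D ++ E.capt)
  | .letDep x' E Δ D _ => x' :: (Δ.names ++ NeedRec.names D ++ E.capt)
  | .pairL E _ => E.capt
  | .pairR _ _ E => E.capt
  | .prj _ E => E.capt

/-- The variables that the last context of a dependency binds at its hole. -/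
def Dep.lastCapt : Dep → List Var
  | .base _ E => E.capt
  | .snoc _ _ E => E.capt

theorem Dep.names_plug (Δ : Dep) (M : Expr) : NeedRec.names (Δ.plug M) = Δ.names := by
  match Δ with
  | .base x E => simp [Dep.plug, Dep.names]
  | .snoc Δ x'' E => simp [Dep.plug, Dep.names, ← Dep.names_plug Δ (.var x'')]

theorem Dep.head_mem (Δ : Dep) : Δ.head ∈ Δ.names := by
  match Δ with
  | .base x E => simp [Dep.head, Dep.names]
  | .snoc Δ x'' E => simp [Dep.head, Dep.names, Dep.head_mem Δ]

theorem names_sublist_binders (D : Defs) : (names D).Sublist (bindersDefs D) := by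
  induction D with
  | nil => simp [bindersDefs]
  | cons p D ih =>
    obtain ⟨x, M⟩ := p
    simpa [bindersDefs] using (ih.trans (List.sublist_append_right _ _))

theorem bindersDefs_append (D D' : Defs) :
    bindersDefs (D ++ D') = bindersDefs D ++ bindersDefs D' := by
  simp [bindersDefs_eq]

theorem bindersDefs_perm {D D' : Defs} (h : D.Perm D') :
    (bindersDefs D).Perm (bindersDefs D') := by
  rw [bindersDefs_eq, bindersDefs_eq]
  exact h.flatMap_right _

theorem binders_plug_sublist {M M' : Expr} (h : M.binders.Sublist M'.binders) :
    (∀ E : Ctx, (E.plug M).binders.Sublist (E.plug M').binders) ∧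
    ∀ Δ : Dep, (bindersDefs (Δ.plug M)).Sublist (bindersDefs (Δ.plug M')) := by
  refine ctx_dep_ind ?_ ?_ ?_ ?_ ?_ ?_ ?_ ?_ ?_ ?_
  · exact h
  · intro E N ih; simpa [Ctx.plug, Expr.binders] using ih
  · intro D E ih; simpa [Ctx.plug, Expr.binders] using ih
  · intro x E D E' ih _
    simpa [Ctx.plug, Expr.binders, bindersDefs] using ih
  · intro x' E Δ D E' ih _ _
    simpa [Ctx.plug, Expr.binders, bindersDefs] using ih
  · intro E N ih; simpa [Ctx.plug, Expr.binders] using ih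
  · intro V hV E ih; simpa [Ctx.plug, Expr.binders] using ih
  · intro i E ih; simpa [Ctx.plug, Expr.binders] using ih
  · intro x E ih; simpa [Dep.plug, bindersDefs] using ih
  · intro Δ x E _ ih; simpa [Dep.plug, bindersDefs_append, bindersDefs] using ih

theorem capt_subset_binders (E : Ctx) (M : Expr) : ∀ x ∈ E.capt, x ∈ (E.plug M).binders := by
  match E with
  | .hole => simp [Ctx.capt]
  | .app E N =>
    intro x hx; simp [Ctx.plug, Expr.binders, capt_subset_binders E M x hx]
  | .letBody D E =>
    intro x hx
    simp only [Ctx.capt, List.mem_append] at hx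
    simp only [Ctx.plug, Expr.binders, List.mem_append]
    exact hx.imp (fun h => (names_sublist_binders D).subset h) (capt_subset_binders E M x)
  | .letBind y E D E' =>
    intro x hx
    simp only [Ctx.capt, List.mem_cons, List.mem_append] at hx
    simp only [Ctx.plug, Expr.binders, bindersDefs, List.mem_cons, List.mem_append]
    rcases hx with h | h | h
    · exact .inl (.inl h)
    · exact .inl (.inr (.inr ((names_sublist_binders D).subset h)))
    · exact .inl (.inr (.inl (capt_subset_binders E M x h)))
  | .letDep y E Δ D E' =>
    intro x hx
    simp only [Ctx.capt, List.mem_cons, List.mem_append] at hx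
    simp only [Ctx.plug, Expr.binders, bindersDefs, bindersDefs_append, List.mem_cons,
      List.mem_append]
    rcases hx with h | (h | h) | h
    · exact .inl (.inl h)
    · refine .inl (.inr (.inr (.inl ((names_sublist_binders _).subset ?_))))
      rwa [Dep.names_plug]
    · exact .inl (.inr (.inr (.inr ((names_sublist_binders D).subset h))))
    · exact .inl (.inr (.inl (capt_subset_binders E M x h)))
  | .pairL E N =>
    intro x hx; simp [Ctx.plug, Expr.binders, capt_subset_binders E M x hx]
  | .pairR V hV E =>
    intro x hx; simp [Ctx.plug, Expr.binders, capt_subset_binders E M x hx]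
  | .prj i E =>
    intro x hx; simpa [Ctx.plug, Expr.binders] using capt_subset_binders E M x hx

theorem lastCapt_subset_binders (Δ : Dep) (M : Expr) :
    ∀ x ∈ Δ.lastCapt, x ∈ bindersDefs (Δ.plug M) := by
  intro x hx
  cases Δ with
  | base y E => simp [Dep.plug, bindersDefs, capt_subset_binders E M x hx]
  | snoc Δ y E =>
    simp [Dep.plug, bindersDefs_append, bindersDefs, capt_subset_binders E M x hx]

/-- Only pair contexts can lie inside a value. Used in the contrapositive: a hole that is not a
value makes the whole binding a thunk, so looking it up is an exact run. -/
theorem isValue_of_plug {M : Expr} (E : Ctx) (h : IsValue (E.plug M)) : IsValue M := by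
  match E with
  | .hole => exact h
  | .app _ _ => nomatch h
  | .letBody _ _ => nomatch h
  | .letBind _ _ _ _ => nomatch h
  | .letDep _ _ _ _ _ => nomatch h
  | .pairL E N => cases h with | pair h _ => exact isValue_of_plug E h
  | .pairR V hV E => cases h with | pair _ h => exact isValue_of_plug E h
  | .prj _ _ => nomatch h

theorem not_isValue_var (x : Var) : ¬ IsValue (.var x) := nofun

/-! ### Loading a context onto the stack -/

/-- The cell of a binding in a block, where the variables in `S` are under evaluation. -/
noncomputable def cell (S : List Var) (e : Env) (p : Var × Expr) : Code :=
  if p.1 ∈ S then .val .bul else code p.2 e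

theorem cell_nil (e : Env) : cell [] e = fun p => code p.2 e := by
  funext p; simp [cell]

theorem map_cell_congr {S S' : List Var} (h : ∀ x, x ∈ S ↔ x ∈ S') (e : Env) (B : Defs) :
    B.map (cell S e) = B.map (cell S' e) := by
  have : cell S e = cell S' e := by funext p; simp only [cell, h]
  rw [this]

/-- The update performed by a lookup: `x` joins the variables under evaluation. -/
theorem set_block {B : Defs} (hB : (names B).Nodup) {x : Var} (hx : x ∈ names B) (S : List Var)
    (e : Env) (h t : List Code) :
    (h ++ (B.map (cell S e) ++ t)).set (h.length + (names B).idxOf x) (.val .bul) =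
      h ++ (B.map (cell (x :: S) e) ++ t) := by
  have hlt : (names B).idxOf x < B.length := by
    simpa using List.idxOf_lt_length_of_mem hx
  rw [List.set_append_right _ _ (by omega), Nat.add_sub_cancel_left,
    List.set_append_left _ _ (by simpa using hlt)]
  congr 2
  refine List.ext_getElem (by simp) fun i h₁ h₂ => ?_
  have hi : i < B.length := by simpa using h₂
  rw [List.getElem_set]
  have hx' : (names B)[(names B).idxOf x]'(by simpa using hlt) = x := List.getElem_idxOf _
  have hn : (names B)[i]'(by simpa using hi) = B[i].1 := by simp
  split_ifs with hix
  · subst hix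
    simp only [List.getElem_map, cell]
    rw [if_pos]
    rw [← hn, hx']; exact List.mem_cons_self
  · have : B[i].1 ≠ x := by
      intro e
      apply hix
      rw [← hx'] at e
      rw [← hn] at e
      exact ((List.Nodup.getElem_inj_iff hB).1 e).symm
    simp [cell, this]

/-- Every expression at the hole of `E` is evaluated first, in a heap, a stack and an environment
that do not depend on it. -/
def Loads (E : Ctx) : Prop :=
  ∀ (e : Env) (n k : ℕ), ∃ (t : List Code) (K' : List Frame) (e₁ : Env) (c : ℕ),
    (∀ y, y ∉ E.capt → e₁ y = e y) ∧ ∀ (M : Expr) (h : List Code) (K : List Frame),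
      h.length = n → K.length = k →
      Join (¬ IsValue M) c ⟨h, K, .thunk (E.plug M) e⟩ ⟨h ++ t, K' ++ K, .thunk M e₁⟩

/-- Every expression at the hole of `Δ` is evaluated first when the head of `Δ` is needed, in a
heap that contains the bindings of `Δ`. -/
def LoadsDep (Δ : Dep) : Prop :=
  ∀ (e : Env) (n k : ℕ), ∃ (t' : List Code) (K' : List Frame) (e' : Env) (c : ℕ),
    (∀ y, y ∉ Δ.lastCapt → e' y = e y) ∧
    ∀ (M : Expr) (B : Defs) (S : List Var) (h t : List Code) (K : List Frame) (ex : Env),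
      (names B).Nodup → (∀ y ∈ names B, e y = h.length + (names B).idxOf y) →
      (∀ p ∈ Δ.plug M, p ∈ B) → (∀ y ∈ Δ.names, y ∉ S) → h.length + (B.length + t.length) = n →
      K.length = k → ex Δ.head = e Δ.head →
      Join (¬ IsValue M) c ⟨h ++ (B.map (cell S e) ++ t), K, .thunk (.var Δ.head) ex⟩
        ⟨h ++ (B.map (cell (Δ.names ++ S) e) ++ (t ++ t')), K' ++ K, .thunk M e'⟩

/-- Looking up `x` puts `•` into its cell and pushes an update frame; then `E` is loaded. -/
theorem loadsDep_base {x : Var} {E : Ctx} (hE : Loads E) : LoadsDep (.base x E) := by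
  intro e n k
  -- One more than `k` for the update frame.
  obtain ⟨t', K', e', c, he', hc⟩ := hE e n (k + 1)
  refine ⟨t', K' ++ [.upd (e x)], e', 1 + c, he', ?_⟩
  intro M B S h t K ex hB he hp hS hn hk hex
  simp only [Dep.head] at hex
  have hxB : (x, E.plug M) ∈ B := hp _ (by simp [Dep.plug])
  have hxn : x ∈ names B := mem_names.2 ⟨_, hxB⟩
  have hxS : x ∉ S := hS x (by simp [Dep.names])
  have h₁ : (h ++ (B.map (cell S e) ++ t))[ex x]? = some (code (E.plug M) e) := by
    rw [hex, he x hxn, getElem?_block hB hxB]; simp [cell, hxS]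
  have j₁ := (join_lookup (K := K) h₁).imp (q := ¬ IsValue M) fun hM h => hM (isValue_of_plug E h)
  have j₂ := hc M ((h ++ (B.map (cell S e) ++ t)).set (ex x) (.val .bul)) (.upd (ex x) :: K)
    (by simp; omega) (by simp [hk])
  rw [hex, he x hxn, set_block hB hxn, ← he x hxn] at j₂
  rw [hex, he x hxn, set_block hB hxn, ← he x hxn] at j₁
  have := j₁.trans j₂
  simpa [Dep.head, Dep.names] using this

/-- Loading `Δ` brings `x` into focus, and then its binding is looked up. By `hx` the cell of `x` is
not yet overwritten; by `hx'` the environment reached still sends `x` to the block. -/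
theorem loadsDep_snoc {Δ : Dep} {x : Var} {E : Ctx} (hΔ : LoadsDep Δ) (hE : Loads E)
    (hx : x ∉ Δ.names) (hx' : x ∉ Δ.lastCapt) : LoadsDep (.snoc Δ x E) := by
  intro e n k
  obtain ⟨t₁, K₁, e₁, c₁, he₁, hc₁⟩ := hΔ e n k
  obtain ⟨t₂, K₂, e₂, c₂, he₂, hc₂⟩ := loadsDep_base (x := x) hE e (n + t₁.length) (K₁.length + k)
  refine ⟨t₁ ++ t₂, K₂ ++ K₁, e₂, c₁ + c₂, he₂, ?_⟩
  intro M B S h t K ex hB he hp hS hn hk hex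
  have j₁ := (hc₁ (.var x) B S h t K ex hB he (fun p hp' => hp p (by simp [Dep.plug, hp']))
    (fun y hy => hS y (by simp [Dep.names, hy])) hn hk hex).imp
      (q := ¬ IsValue M) fun _ => not_isValue_var x
  have j₂ := hc₂ M B (Δ.names ++ S) h (t ++ t₁) (K₁ ++ K) e₁ hB he
    (fun p hp' => hp p (by simp only [Dep.plug] at hp' ⊢; simp [List.mem_singleton.1 hp'])) ?_
    (by simp; omega) (by simp [hk]) (he₁ x hx')
  · have := j₁.trans j₂
    rw [map_cell_congr (S := (Dep.base x E).names ++ (Δ.names ++ S))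
      (S' := (Dep.snoc Δ x E).names ++ S) (by simp [Dep.names]; tauto)] at this
    simpa [Dep.head] using this
  · intro y hy
    simp only [Dep.names, List.mem_singleton] at hy
    subst hy
    simp only [List.mem_append, not_or]
    exact ⟨hx, hS y (by simp [Dep.names])⟩

/-- The common part of both letrec contexts and of all rules that follow a dependency. By `hconst`
the cells no longer depend on `M` when the hole is reached: the binding that contains `M` is under
evaluation. Plugging `•` merely picks a representative of the block. -/
theorem loads_block {E : Ctx} {Δ : Dep} (hE : Loads E) (hΔ : LoadsDep Δ) (hx : Δ.head ∉ E.capt)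
    {B : Expr → Defs} {ns : List Var} (hns : ∀ M, names (B M) = ns) (hnd : ns.Nodup)
    (hsub : ∀ M, ∀ p ∈ Δ.plug M, p ∈ B M)
    (hconst : ∀ M e, (B M).map (cell Δ.names e) = (B .bullet).map (cell Δ.names e))
    (e : Env) (n k : ℕ) : ∃ (t : List Code) (K' : List Frame) (e' : Env) (c : ℕ),
      (∀ y, y ∉ Δ.lastCapt → e' y = ext e ns n y) ∧
      ∀ (M : Expr) (h : List Code) (K : List Frame), h.length = n → K.length = k →
        Join (¬ IsValue M) c ⟨h, K, .thunk (.letrec (B M) (E.plug (.var Δ.head))) e⟩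
          ⟨h ++ ((B .bullet).map (cell Δ.names (ext e ns n)) ++ t), K' ++ K, .thunk M e'⟩ := by
  have hlen : ∀ M, (B M).length = ns.length := fun M => by rw [← hns M]; simp
  obtain ⟨t₁, K₁, e₁, c₁, he₁, hc₁⟩ := hE (ext e ns n) (n + ns.length) k
  obtain ⟨t₂, K₂, e₂, c₂, he₂, hc₂⟩ :=
    hΔ (ext e ns n) (n + (ns.length + t₁.length)) (K₁.length + k)
  refine ⟨t₁ ++ t₂, K₂ ++ K₁, e₂, 1 + k + c₁ + c₂, he₂, ?_⟩
  intro M h K hn hk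
  have j₀ : Join (¬ IsValue M) (1 + k) ⟨h, K, .thunk (.letrec (B M) (E.plug (.var Δ.head))) e⟩
      ⟨h ++ codes (B M) (ext e ns n), K, .thunk (E.plug (.var Δ.head)) (ext e ns n)⟩ := by
    have := @MStep.letrec h K (B M) (E.plug (.var Δ.head)) e
    rw [hns, hn, hk] at this
    exact .of_run (.single this)
  have j₁ := (hc₁ (.var Δ.head) (h ++ codes (B M) (ext e ns n)) K
    (by simp [codes, hn, hlen]) hk).imp (q := ¬ IsValue M) fun _ => not_isValue_var _
  have j₂ := hc₂ M (B M) [] h t₁ (K₁ ++ K) e₁ (by rw [hns]; exact hnd) ?_ (hsub M) (by simp)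
    (by rw [hlen, hn]) (by simp [hk]) (he₁ _ hx)
  · have hc : codes (B M) (ext e ns n) = (B M).map (cell [] (ext e ns n)) := by
      rw [cell_nil]; rfl
    rw [hc, List.append_assoc] at j₁
    rw [hc] at j₀
    have := (j₀.trans j₁).trans j₂
    rw [List.append_nil, hconst] at this
    simpa using this
  · intro y hy
    rw [hns] at hy ⊢
    rw [ext_of_mem hy, hn]

theorem Dep.map_plug_const (Δ : Dep) {α : Type*} {F : Var × Expr → α}
    (hF : ∀ y ∈ Δ.names, ∀ N N', F (y, N) = F (y, N')) (M N : Expr) :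
    (Δ.plug M).map F = (Δ.plug N).map F := by
  cases Δ with
  | base x E => simpa [Dep.plug] using hF x (by simp [Dep.names]) _ _
  | snoc Δ x E => simpa [Dep.plug] using hF x (by simp [Dep.names]) _ _

theorem cell_const {S : List Var} {y : Var} (h : y ∈ S) (e : Env) (N N' : Expr) :
    cell S e (y, N) = cell S e (y, N') := by simp [cell, h]

theorem nodup_binders_plug {E : Ctx} {M M' : Expr} (h : M.binders.Sublist M'.binders)
    (hE : (E.plug M').binders.Nodup) : (E.plug M).binders.Nodup :=
  hE.sublist ((binders_plug_sublist h).1 E)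

/-- Since `•` has no binders, the hypothesis concerns the context alone. Distinct binders ensure
that a needed variable is not captured on the way to its occurrence and that successive links of a
chain have different cells. -/
theorem loads_and_loadsDep : (∀ E : Ctx, (E.plug .bullet).binders.Nodup → Loads E) ∧
    ∀ Δ : Dep, (bindersDefs (Δ.plug .bullet)).Nodup → LoadsDep Δ := by
  have hvb : ∀ x, (Expr.bullet).binders.Sublist (Expr.var x).binders := by simp [Expr.binders]
  have hblock : ∀ {D : Defs} {E : Ctx} {x : Var},
      (Expr.letrec D (E.plug (.var x))).binders.Nodup → (names D).Nodup ∧ (bindersDefs D).Nodup ∧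
        (E.plug .bullet).binders.Nodup ∧ ∀ y ∈ names D, y ∉ E.capt := by
    intro D E x h
    simp only [Expr.binders, List.nodup_append'] at h
    refine ⟨h.1.sublist (names_sublist_binders D), h.1, nodup_binders_plug (hvb x) h.2.1, ?_⟩
    intro y hy hy'
    exact h.2.2 ((names_sublist_binders D).subset hy) (capt_subset_binders E _ y hy')
  refine ctx_dep_ind ?_ ?_ ?_ ?_ ?_ ?_ ?_ ?_ ?_ ?_
  · intro _ e n k
    exact ⟨[], [], e, 0, fun _ _ => rfl, fun M h K _ _ => by simpa [Ctx.plug] using .of_run (.refl _)⟩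
  · intro E N ih hnd e n k
    simp only [Ctx.plug, Expr.binders, List.nodup_append'] at hnd
    obtain ⟨t, K', e', c, he', hc⟩ := ih hnd.1 e n (k + 1)
    refine ⟨t, K' ++ [.arg N e], e', 1 + c, he', fun M h K hn hk => ?_⟩
    simpa [Ctx.plug] using (Join.of_run (.single .app)).trans (hc M h (.arg N e :: K) hn (by simp [hk]))
  · intro D E ih hnd e n k
    simp only [Ctx.plug, Expr.binders, List.nodup_append'] at hnd
    obtain ⟨t, K', e', c, he', hc⟩ := ih hnd.2.1 (ext e (names D) n) (n + D.length) k
    refine ⟨codes D (ext e (names D) n) ++ t, K', e', 1 + k + c, fun y hy => ?_,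
      fun M h K hn hk => ?_⟩
    · simp only [Ctx.capt, List.mem_append, not_or] at hy
      rw [he' y hy.2, ext_of_not_mem hy.1]
    · subst hn hk
      simpa [Ctx.plug] using (Join.of_run (.single .letrec)).trans
        (hc M (h ++ codes D (ext e (names D) h.length)) K (by simp [codes]) rfl)
  · intro x E D E' ih ih' hnd
    obtain ⟨h₁, h₂, h₃, h₄⟩ := hblock hnd
    simp only [bindersDefs, List.nodup_cons, List.nodup_append'] at h₂
    intro e n k
    obtain ⟨t, K', e', c, he', hc⟩ := loads_block (ih' h₃) (loadsDep_base (x := x) (ih h₂.2.1))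
      (h₄ x (by simp)) (B := fun M => (x, E.plug M) :: D) (ns := x :: names D) (by simp)
      (by simpa using h₁) (by simp [Dep.plug]) (by simp [cell, Dep.names]) e n k
    refine ⟨_, K', e', c, fun y hy => ?_, fun M h K hn hk => hc M h K hn hk⟩
    simp only [Ctx.capt, List.mem_cons, List.mem_append, not_or] at hy
    rw [he' y hy.2.2, ext_of_not_mem (by simp [hy.1, hy.2.1])]
  · intro x E Δ D E' ih ihΔ ih' hnd
    obtain ⟨h₁, h₂, h₃, h₄⟩ := hblock hnd
    simp only [bindersDefs, bindersDefs_append, List.nodup_cons, List.nodup_append',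
      List.mem_append, not_or] at h₂
    have hx₁ : x ∉ Δ.lastCapt := fun h => h₂.1.2.1 (lastCapt_subset_binders Δ _ x h)
    have hx₂ : x ∉ Δ.names := fun h => h₂.1.2.1 ((names_sublist_binders _).subset
      (by rwa [Dep.names_plug]))
    have hΔ := ihΔ (h₂.2.2.1.1.sublist ((binders_plug_sublist (hvb x)).2 Δ))
    intro e n k
    obtain ⟨t, K', e', c, he', hc⟩ := loads_block (ih' h₃) (loadsDep_snoc hΔ (ih h₂.2.1) hx₂ hx₁)
      (h₄ Δ.head (by simp [Dep.names_plug, Dep.head_mem]))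
      (B := fun M => (x, E.plug M) :: (Δ.plug (.var x) ++ D)) (ns := x :: (Δ.names ++ names D))
      (by intro M; rw [← Dep.names_plug Δ (.var x)]; simp) (by
        rw [← Dep.names_plug Δ (.var x)]; simpa using h₁)
      (by intro M p hp; simp only [Dep.plug, List.mem_append, List.mem_singleton] at hp
          rcases hp with h | h <;> simp [h])
      (by simp [cell, Dep.names]) e n k
    refine ⟨_, K', e', c, fun y hy => ?_, fun M h K hn hk => hc M h K hn hk⟩
    simp only [Ctx.capt, List.mem_cons, List.mem_append, not_or] at hy
    rw [he' y hy.2.2, ext_of_not_mem (by simp [hy.1, hy.2.1])]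
  · intro E N ih hnd e n k
    simp only [Ctx.plug, Expr.binders, List.nodup_append'] at hnd
    obtain ⟨t, K', e', c, he', hc⟩ := ih hnd.1 e n (k + 1)
    refine ⟨t, K' ++ [.pairL N e], e', 0 + c, he', fun M h K hn hk => ?_⟩
    simpa [Ctx.plug] using
      (Join.of_run (.single .pair)).trans (hc M h (.pairL N e :: K) hn (by simp [hk]))
  · intro V hV E ih hnd e n k
    simp only [Ctx.plug, Expr.binders, List.nodup_append'] at hnd
    obtain ⟨t, K', e', c, he', hc⟩ := ih hnd.2.1 e n (k + 1)
    refine ⟨t, K' ++ [.pairR (valOf V e)], e', 0 + c, he', fun M h K hn hk => ?_⟩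
    have r : Run 0 ⟨h, K, .thunk (.pair V (E.plug M)) e⟩
        ⟨h, .pairR (valOf V e) :: K, .thunk (E.plug M) e⟩ :=
      .head .pair ((run_value hV _ _ _).trans (.single .ret_pairL))
    simpa [Ctx.plug] using
      (Join.of_run r).trans (hc M h (.pairR (valOf V e) :: K) hn (by simp [hk]))
  · intro i E ih hnd e n k
    simp only [Ctx.plug, Expr.binders] at hnd
    obtain ⟨t, K', e', c, he', hc⟩ := ih hnd e n (k + 1)
    refine ⟨t, K' ++ [.prj i], e', 1 + c, he', fun M h K hn hk => ?_⟩
    simpa [Ctx.plug] using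
      (Join.of_run (.single .prj)).trans (hc M h (.prj i :: K) hn (by simp [hk]))
  · intro x E ih hnd
    simp only [Dep.plug, bindersDefs, List.nodup_cons, List.append_nil] at hnd
    exact loadsDep_base (ih hnd.2)
  · intro Δ x E ihΔ ih hnd
    simp only [Dep.plug, bindersDefs, bindersDefs_append, List.append_nil, List.nodup_append',
      List.nodup_cons] at hnd
    refine loadsDep_snoc (ihΔ (hnd.1.sublist ((binders_plug_sublist (hvb x)).2 Δ)))
      (ih hnd.2.1.2) ?_ ?_
    · intro h
      exact hnd.2.2 ((names_sublist_binders _).subset (by rwa [Dep.names_plug])) (by simp)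
    · intro h
      exact hnd.2.2 (lastCapt_subset_binders Δ _ x h) (by simp)

theorem loads {E : Ctx} {M : Expr} (h : (E.plug M).binders.Nodup) : Loads E :=
  loads_and_loadsDep.1 E (nodup_binders_plug (by simp [Expr.binders]) h)

theorem loadsDep {Δ : Dep} {M : Expr} (h : (bindersDefs (Δ.plug M)).Nodup) : LoadsDep Δ :=
  loads_and_loadsDep.2 Δ (h.sublist ((binders_plug_sublist (by simp [Expr.binders])).2 Δ))

/-! ### Equivalent states -/

/-- `s` and `s'` halt with related results, and `s'` does so at a cost that is smaller by `k`. -/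
def Sim (k : ℕ) (s s' : State) : Prop :=
  (∀ c h v, Halts s c h v → ∃ c' h' v' β, Halts s' c' h' v' ∧ c' + k ≤ c ∧
    HRel β ∅ (lk h) (lk h') ∧ VRel β v v') ∧
  ∀ c' h' v', Halts s' c' h' v' → ∃ c h v β, Halts s c h v ∧
    HRel β ∅ (lk h) (lk h') ∧ VRel β v v'

theorem SRel.halts {β : ℕ → ℕ → Prop} {s t : State} (h : SRel β ∅ s t) {c : ℕ} {H : List Code}
    {v : Val} (hs : Halts s c H v) :
    ∃ H' v' β', Halts t c H' v' ∧ HRel β' ∅ (lk H) (lk H') ∧ VRel β' v v' := by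
  obtain ⟨β', t', k₁, -, k₃, -⟩ := bisim_run h hs
  obtain ⟨H', K', c'⟩ := t'
  obtain ⟨l₁, l₂, l₃⟩ := k₃
  cases l₂
  cases l₃ with
  | val l₃ => exact ⟨H', _, β', k₁, l₁, l₃⟩

theorem Join.halts_back {p : Prop} {c k : ℕ} {s s' : State} {h : List Code} {v : Val}
    (hj : Join p c s s') (hs : Halts s' k h v) : Halts s (c + k) h v :=
  hj.run_final hs (final_halt h v)

/-- Halting states are final, so a halting run contains every other run from its start; the costs
can then be compared up to the states `t` and `t'`, after which they agree. -/
theorem Sim.of_join {p q : Prop} {a b k : ℕ} {s s' t t' : State} {β : ℕ → ℕ → Prop}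
    (h : Join p a s t) (h' : Join q b s' t') (ht : SRel β ∅ t t') (hk : b + k ≤ a) :
    Sim k s s' := by
  constructor
  · intro c H v hs
    obtain ⟨c₁, rfl, h₁⟩ := h.halts hs
    obtain ⟨H', v', β', h₂, h₃, h₄⟩ := ht.halts h₁
    exact ⟨b + c₁, H', v', β', h'.halts_back h₂, by omega, h₃, h₄⟩
  · intro c H v hs
    obtain ⟨c₁, rfl, h₁⟩ := h'.halts hs
    obtain ⟨H', v', β', h₂, h₃, h₄⟩ := ht.symm.halts h₁
    exact ⟨a + c₁, H', v', _, h.halts_back h₂, h₃.symm, h₄.symm fun _ _ h => h⟩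

theorem Sim.of_sRel {s t : State} {β : ℕ → ℕ → Prop} (h : SRel β ∅ s t) : Sim 0 s t :=
  .of_join (p := True) (q := True) (.of_run (.refl s)) (.of_run (.refl t)) h (by simp)

theorem Sim.trans {j k : ℕ} {s t u : State} (h : Sim j s t) (h' : Sim k t u) :
    Sim (j + k) s u := by
  constructor
  · intro c H v hs
    obtain ⟨c₁, H₁, v₁, β₁, h₁, e₁, k₁, l₁⟩ := h.1 c H v hs
    obtain ⟨c₂, H₂, v₂, β₂, h₂, e₂, k₂, l₂⟩ := h'.1 c₁ H₁ v₁ h₁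
    exact ⟨c₂, H₂, v₂, _, h₂, by omega, k₁.trans k₂, l₁.trans (fun _ b _ h h' => ⟨b, h, h'⟩) l₂⟩
  · intro c H v hs
    obtain ⟨c₁, H₁, v₁, β₁, h₁, k₁, l₁⟩ := h'.2 c H v hs
    obtain ⟨c₂, H₂, v₂, β₂, h₂, k₂, l₂⟩ := h.2 c₁ H₁ v₁ h₁
    exact ⟨c₂, H₂, v₂, _, h₂, k₂.trans k₁, l₂.trans (fun _ b _ k l => ⟨b, k, l⟩) l₁⟩

/-! ### Self-related states -/

theorem Closed.scoped {h : List Code} {K : List Frame} {M : Expr} {e : Env}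
    (hc : Closed ⟨h, K, .thunk M e⟩) : M.WF ∧ ∀ x ∈ M.fv, e x < h.length := by
  have := hc.idRel.focus
  cases this with
  | thunk hM =>
    refine ⟨hM.wf, fun x hx => ?_⟩
    obtain ⟨y, -, h⟩ := hM.fv x hx
    exact h.2

theorem aeq_env {n : ℕ} {M : Expr} {e e' : Env} (hM : M.WF)
    (he : ∀ x ∈ M.fv, e x = e' x ∧ e x < n) : AEq (fun a b => idRel n (e a) (e' b)) M M :=
  AEq.refl hM he

theorem hrel_idRel {h₁ h₂ : List Code} {n : ℕ} (l₁ : h₁.length = n) (l₂ : h₂.length = n)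
    (hr : ∀ (i : ℕ) c d, h₁[i]? = some c → h₂[i]? = some d → CRel (idRel n) c d) :
    HRel (idRel n) ∅ (lk h₁) (lk h₂) where
  bij := by rintro a b a' b' ⟨rfl, -⟩ ⟨rfl, -⟩; rfl
  rel := by
    rintro a b ⟨rfl, h⟩
    have e₁ : h₁[a]? = some h₁[a] := List.getElem?_eq_getElem _
    have e₂ : h₂[a]? = some h₂[a] := List.getElem?_eq_getElem _
    exact ⟨_, _, e₁, e₂, hr a _ _ e₁ e₂⟩
  totl := fun k => ⟨_, rfl, l₁ ▸ lk_lt k⟩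
  totr := fun k _ => ⟨_, rfl, l₂ ▸ lk_lt k⟩
  excl := fun k => by simp at k
  dom := fun k => by simp at k

theorem ext_lt {e : Env} {xs : List Var} {n : ℕ} {x : Var} (hx : x ∈ xs) :
    n ≤ ext e xs n x ∧ ext e xs n x < n + xs.length := by
  rw [ext_of_mem hx]
  have := List.idxOf_lt_length_of_mem hx
  omega

/-- The update frame writes back the value that the lookup had replaced by `•`, so the heap is
unchanged. -/
theorem run_lookup_value {h : List Code} {K : List Frame} {x : Var} {e : Env} {v : Val}
    (hx : h[e x]? = some (.val v)) :
    Run 1 ⟨h, K, .thunk (.var x) e⟩ ⟨h, K, .val v⟩ := by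
  have r : Run (1 + 0) _ _ := .head (.var (K := K) hx) (.single .ret_upd)
  have e₁ : h.set (e x) (.val v) = h := by
    obtain ⟨hlt, hv⟩ := List.getElem?_eq_some_iff.1 hx
    rw [← hv, List.set_getElem_self]
  rwa [List.set_set, e₁] at r

/-! ### Concatenation of dependencies -/

/-- `D[x,x'], D'[x',·]`, where `x'` is the head of the second dependency. -/
def Dep.append (Δ : Dep) : Dep → Dep
  | .base x E => .snoc Δ x E
  | .snoc Δ' x E => .snoc (Δ.append Δ') x E

theorem Dep.plug_append (Δ Δ' : Dep) (M : Expr) :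
    (Δ.append Δ').plug M = Δ.plug (.var Δ'.head) ++ Δ'.plug M := by
  match Δ' with
  | .base x E => simp [Dep.append, Dep.plug, Dep.head]
  | .snoc Δ' x E => simp [Dep.append, Dep.plug, Dep.head, Dep.plug_append Δ Δ' (.var x)]

theorem Dep.names_append (Δ Δ' : Dep) : (Δ.append Δ').names = Δ.names ++ Δ'.names := by
  match Δ' with
  | .base x E => simp [Dep.append, Dep.names]
  | .snoc Δ' x E => simp [Dep.append, Dep.names, Dep.names_append Δ Δ']

theorem Dep.head_append (Δ Δ' : Dep) : (Δ.append Δ').head = Δ.head := by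
  match Δ' with
  | .base x E => simp [Dep.append, Dep.head]
  | .snoc Δ' x E => simp [Dep.append, Dep.head, Dep.head_append Δ Δ']

theorem Dep.lastCapt_append (Δ Δ' : Dep) : (Δ.append Δ').lastCapt = Δ'.lastCapt := by
  cases Δ' with
  | base => rfl
  | snoc => rfl

/-! ### Blocks in canonical expressions -/

theorem Expr.Canonical.block {D : Defs} {E : Ctx} {x : Var}
    (h : (Expr.letrec D (E.plug (.var x))).Canonical) :
    (names D).Nodup ∧ (bindersDefs D).Nodup ∧ Loads E ∧ ∀ y ∈ names D, y ∉ E.capt := by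
  have h := h.1
  simp only [Expr.binders, List.nodup_append'] at h
  refine ⟨h.1.sublist (names_sublist_binders D), h.1, loads h.2.1, ?_⟩
  intro y hy hy'
  exact h.2.2 ((names_sublist_binders D).subset hy) (capt_subset_binders E _ y hy')

theorem Expr.Canonical.block_fv {D : Defs} {N : Expr} (h : (Expr.letrec D N).Canonical) {y : Var}
    (hy : y ∈ (Expr.letrec D N).binders) (hn : y ∉ names D) :
    (∀ p ∈ D, y ∉ p.2.fv) ∧ y ∉ N.fv :=
  ⟨fun p hp hy' => h.2 y hy (mem_fv_letrec.2 ⟨.inl ⟨p, hp, hy'⟩, hn⟩),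
    fun hy' => h.2 y hy (mem_fv_letrec.2 ⟨.inr hy', hn⟩)⟩

theorem mem_bindersDefs {D : Defs} {p : Var × Expr} (hp : p ∈ D) {y : Var}
    (hy : y ∈ p.2.binders) : y ∈ bindersDefs D := by
  rw [bindersDefs_eq, List.mem_flatMap]
  exact ⟨p, hp, by simp [hy]⟩

/-- The names of a block do not occur as binders in its right-hand sides. -/
theorem not_mem_names_of_binders {D : Defs} (h : (bindersDefs D).Nodup) {p : Var × Expr}
    (hp : p ∈ D) {y : Var} (hy : y ∈ p.2.binders) : y ∉ names D := by
  induction D with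
  | nil => simp
  | cons q D ih =>
    obtain ⟨x, M⟩ := q
    simp only [bindersDefs, List.nodup_cons, List.nodup_append', List.mem_append, not_or] at h
    simp only [names, List.map_cons, List.mem_cons, not_or]
    rcases List.mem_cons.1 hp with rfl | hp
    · exact ⟨fun e => h.1.1 (e ▸ hy),
        fun h' => h.2.2.2 hy ((names_sublist_binders D).subset h')⟩
    · exact ⟨fun e => h.1.2 (e ▸ mem_bindersDefs hp hy), ih h.2.2.1 hp⟩

/-! ### Contraction preserves results -/

section Contraction

variable {h : List Code} {K : List Frame} {e : Env}

/-- Both sides allocate one cell at the same stack height, and the application pays one more for its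
frame. The letrec closes `N` over an environment that knows `x`, which is harmless as `x` is not
free in `N`. -/
theorem sim_beta {x : Var} {M N : Expr} (hcan : (Expr.app (.lam x M) N).Canonical)
    (hcl : Closed ⟨h, K, .thunk (.app (.lam x M) N) e⟩) :
    Sim 1 ⟨h, K, .thunk (.app (.lam x M) N) e⟩ ⟨h, K, .thunk (.letrec [(x, N)] M) e⟩ := by
  have r₁ : Run (1 + (0 + (1 + K.length))) ⟨h, K, .thunk (.app (.lam x M) N) e⟩ _ :=
    .head .app (.head .lam (.single .ret_arg))
  have r₂ : Run (1 + K.length) ⟨h, K, .thunk (.letrec [(x, N)] M) e⟩ _ := .single .letrec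
  have c₁ := (hcl.run r₁).idRel
  obtain ⟨hw, hfv⟩ := hcl.scoped
  have hx : x ∉ N.fv := fun hx => hcan.2 x (by simp [Expr.binders]) (by simp [Expr.fv, hx])
  refine .of_join (p := True) (q := True) (.of_run r₁) (.of_run r₂) (β := idRel (h.length + 1))
    ⟨hrel_idRel (by simp) (by simp [codes]) ?_, by simpa using c₁.stack, by simpa using c₁.focus⟩
    (by omega)
  intro i c d hc hd
  by_cases hi : i < h.length
  · have hd' : (h ++ [code N e])[i]? = some d := by
      simpa [List.getElem?_append_left hi] using hd
    obtain ⟨c', d', k₁, k₂, k₃⟩ := c₁.heap.rel (a := i) (b := i) ⟨rfl, by simp; omega⟩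
    simp only [lk] at k₁ k₂
    rw [hc, Option.some_inj] at k₁
    rw [hd', Option.some_inj] at k₂
    subst k₁ k₂
    simpa using k₃
  · have hi' : i = h.length := by
      have := (List.getElem?_eq_some_iff.1 hc).1
      simp at this; omega
    subst hi'
    simp only [List.getElem?_concat_length, Option.some_inj, codes, List.map_cons,
      List.map_nil] at hc hd
    subst hc hd
    refine crel_code.2 (aeq_env hw.2 fun y hy => ?_)
    rw [ext_of_not_mem (by simp; rintro rfl; exact hx hy)]
    exact ⟨rfl, Nat.lt_succ_of_lt (hfv y (by simp [Expr.fv, hy]))⟩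

theorem aeq_ext {D : Defs} {N : Expr} {m : ℕ} (hN : N.WF) (hn : ∀ y ∈ N.fv, y ∉ names D)
    (hfv : ∀ y ∈ N.fv, e y < h.length) (hm : h.length ≤ m) :
    AEq (fun a b => idRel m (e a) (ext e (names D) h.length b)) N N :=
  aeq_env hN fun y hy => ⟨(ext_of_not_mem (hn y hy)).symm, (hfv y hy).trans_le hm⟩

/-- The steps are swapped, and the allocation then happens below a stack without the argument frame;
this saves one unit. The larger environment of `N` is harmless because the names of `D` are not free
in it. -/
theorem sim_lift {D : Defs} {A N : Expr} (hcan : (Expr.app (.letrec D A) N).Canonical)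
    (hcl : Closed ⟨h, K, .thunk (.app (.letrec D A) N) e⟩) :
    Sim 1 ⟨h, K, .thunk (.app (.letrec D A) N) e⟩ ⟨h, K, .thunk (.letrec D (.app A N)) e⟩ := by
  have r₁ : Run _ ⟨h, K, .thunk (.app (.letrec D A) N) e⟩ _ := .head .app (.single .letrec)
  have r₂ : Run _ ⟨h, K, .thunk (.letrec D (.app A N)) e⟩ _ := .head .letrec (.single .app)
  have c₁ := (hcl.run r₁).idRel
  obtain ⟨hw, hfv⟩ := hcl.scoped
  refine .of_join (p := True) (q := True) (.of_run r₁) (.of_run r₂)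
    ⟨c₁.heap, .cons (.arg (aeq_ext hw.2 ?_ ?_ (by simp))) ?_, c₁.focus⟩ (by simp; omega)
  · intro y hy hy'
    exact hcan.2 y (by simp [Expr.binders, (names_sublist_binders D).subset hy'])
      (by simp [Expr.fv, hy])
  · intro y hy; exact hfv y (by simp [Expr.fv, hy])
  · have := c₁.stack; cases this with | cons _ h => exact h

theorem sim_lift_prj {i : Fin 2} {D : Defs} {A : Expr}
    (hcl : Closed ⟨h, K, .thunk (.prj i (.letrec D A)) e⟩) :
    Sim 1 ⟨h, K, .thunk (.prj i (.letrec D A)) e⟩ ⟨h, K, .thunk (.letrec D (.prj i A)) e⟩ := by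
  have r₁ : Run _ ⟨h, K, .thunk (.prj i (.letrec D A)) e⟩ _ := .head .prj (.single .letrec)
  have r₂ : Run _ ⟨h, K, .thunk (.letrec D (.prj i A)) e⟩ _ := .head .letrec (.single .prj)
  exact .of_join (p := True) (q := True) (.of_run r₁) (.of_run r₂) (hcl.run r₁).idRel
    (by simp; omega)

theorem sim_lift_pair₁ {D : Defs} {A N : Expr} (hcan : (Expr.pair (.letrec D A) N).Canonical)
    (hcl : Closed ⟨h, K, .thunk (.pair (.letrec D A) N) e⟩) :
    Sim 1 ⟨h, K, .thunk (.pair (.letrec D A) N) e⟩ ⟨h, K, .thunk (.letrec D (.pair A N)) e⟩ := by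
  have r₁ : Run _ ⟨h, K, .thunk (.pair (.letrec D A) N) e⟩ _ := .head .pair (.single .letrec)
  have r₂ : Run _ ⟨h, K, .thunk (.letrec D (.pair A N)) e⟩ _ := .head .letrec (.single .pair)
  have c₁ := (hcl.run r₁).idRel
  obtain ⟨hw, hfv⟩ := hcl.scoped
  refine .of_join (p := True) (q := True) (.of_run r₁) (.of_run r₂)
    ⟨c₁.heap, .cons (.pairL (aeq_ext hw.2 ?_ ?_ (by simp))) ?_, c₁.focus⟩ (by simp)
  · intro y hy hy'
    exact hcan.2 y (by simp [Expr.binders, (names_sublist_binders D).subset hy'])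
      (by simp [Expr.fv, hy])
  · intro y hy; exact hfv y (by simp [Expr.fv, hy])
  · have := c₁.stack; cases this with | cons _ h => exact h

/-- Here `V` is evaluated before the allocation on one side and after it on the other; its machine
values agree because the names of `D` are not free in `V`. -/
theorem sim_lift_pair₂ {V : Expr} {D : Defs} {A : Expr} (hV : IsValue V)
    (hcan : (Expr.pair V (.letrec D A)).Canonical)
    (hcl : Closed ⟨h, K, .thunk (.pair V (.letrec D A)) e⟩) :
    Sim 1 ⟨h, K, .thunk (.pair V (.letrec D A)) e⟩ ⟨h, K, .thunk (.letrec D (.pair V A)) e⟩ := by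
  have r₁ : Run _ ⟨h, K, .thunk (.pair V (.letrec D A)) e⟩ _ :=
    .head .pair ((run_value hV _ _ _).trans (.head .ret_pairL (.single .letrec)))
  have r₂ : Run _ ⟨h, K, .thunk (.letrec D (.pair V A)) e⟩ _ :=
    .head .letrec (.head .pair ((run_value hV _ _ _).trans (.single .ret_pairL)))
  have c₁ := (hcl.run r₁).idRel
  obtain ⟨hw, hfv⟩ := hcl.scoped
  refine .of_join (p := True) (q := True) (.of_run r₁) (.of_run r₂)
    ⟨c₁.heap, .cons (.pairR ((vrel_valOf hV hV).2 (aeq_ext hw.1 ?_ ?_ (by simp)))) ?_, c₁.focus⟩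
    (by simp)
  · intro y hy hy'
    exact hcan.2 y (by simp [Expr.binders, (names_sublist_binders D).subset hy'])
      (by simp [Expr.fv, hy])
  · intro y hy; exact hfv y (by simp [Expr.fv, hy])
  · have := c₁.stack; cases this with | cons _ h => exact h

theorem sim_error_beta {M : Expr} (hcl : Closed ⟨h, K, .thunk (.app .bullet M) e⟩) :
    Sim 1 ⟨h, K, .thunk (.app .bullet M) e⟩ ⟨h, K, .thunk .bullet e⟩ := by
  have r₁ : Run _ ⟨h, K, .thunk (.app .bullet M) e⟩ _ :=
    .head .app (.head .bullet (.single .ret_arg_bul))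
  have r₂ : Run _ ⟨h, K, .thunk .bullet e⟩ _ := .single .bullet
  exact .of_join (p := True) (q := True) (.of_run r₁) (.of_run r₂) (hcl.run r₁).idRel (by simp)

theorem sim_prj {i : Fin 2} {V : Fin 2 → Expr} (h₀ : IsValue (V 0)) (h₁ : IsValue (V 1))
    (hcl : Closed ⟨h, K, .thunk (.prj i (.pair (V 0) (V 1))) e⟩) :
    Sim 1 ⟨h, K, .thunk (.prj i (.pair (V 0) (V 1))) e⟩ ⟨h, K, .thunk (V i) e⟩ := by
  have r₁ : Run _ ⟨h, K, .thunk (.prj i (.pair (V 0) (V 1))) e⟩ _ :=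
    .head .prj ((run_value (.pair h₀ h₁) _ _ _).trans
      (.single (.ret_prj (v := fun j => valOf (V j) e))))
  have hi : IsValue (V i) := by fin_cases i; exacts [h₀, h₁]
  exact .of_join (p := True) (q := True) (.of_run r₁) (.of_run (run_value hi _ _ _))
    (hcl.run r₁).idRel (by simp)

/-- Substituting a value for a variable that is bound to it. -/
theorem sim_deref {x : Var} {V : Expr} {D : Defs} {E : Ctx} (hV : IsValue V)
    (hcan : (Expr.letrec ((x, V) :: D) (E.plug (.var x))).Canonical)
    (hcl : Closed ⟨h, K, .thunk (.letrec ((x, V) :: D) (E.plug (.var x))) e⟩) :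
    Sim 1 ⟨h, K, .thunk (.letrec ((x, V) :: D) (E.plug (.var x))) e⟩
      ⟨h, K, .thunk (.letrec ((x, V) :: D) (E.plug V)) e⟩ := by
  obtain ⟨hn, hb, hE, hcapt⟩ := hcan.block
  obtain ⟨hw, hfv⟩ := hcl.scoped
  set B : Defs := (x, V) :: D with hB
  have hxB : (x, V) ∈ B := by simp [hB]
  have hxn : x ∈ names B := mem_names.2 ⟨V, hxB⟩
  obtain ⟨t, K', e', c, he', hc⟩ := hE (ext e (names B) h.length) (h.length + B.length) K.length
  have hlen : (h ++ codes B (ext e (names B) h.length)).length = h.length + B.length := by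
    simp [codes]
  have r₁ := Run.head .letrec ((hc (.var x) _ K hlen rfl).run (not_isValue_var x))
  have c₁ := (hcl.run r₁).idRel
  have hlook : ((h ++ codes B (ext e (names B) h.length)) ++ t)[e' x]? =
      some (.val (valOf V (ext e (names B) h.length))) := by
    rw [he' x (hcapt x hxn), ext_of_mem hxn, List.append_assoc,
      ← code_of_value hV]
    exact getElem?_block hn (F := fun p => code p.2 (ext e (names B) h.length)) hxB h t
  -- The saved unit is this lookup: `V` in place of the variable evaluates for free.
  have r₂ := r₁.trans (run_lookup_value hlook)
  have j₁ := ((Join.of_run (.single .letrec)).trans (hc V _ K hlen rfl)).trans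
    (.of_run (run_value hV _ _ _))
  refine .of_join (p := True) (.of_run r₂) j₁ (β := idRel _)
    ⟨c₁.heap, c₁.stack, .val ((vrel_valOf hV hV).2 (aeq_env ?_ ?_))⟩ (by omega)
  · exact wfRhs_iff.1 hw.2.1 _ hxB
  · intro y hy
    constructor
    · rw [he' y]
      intro hy'
      -- A free variable of `V` captured by `E` would be both a binder and free, or defined twice,
      -- in a canonical expression.
      have hyb : y ∈ (E.plug (.var x)).binders := capt_subset_binders E _ y hy'
      refine (hcan.block_fv (y := y) (by simp [Expr.binders, hyb]) ?_).1 _ hxB hy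
      exact fun h => hcapt y h hy'
    · by_cases hyn : y ∈ names B
      · have := (ext_lt (e := e) (n := h.length) hyn).2
        simp [codes] at this ⊢; omega
      · rw [ext_of_not_mem hyn]
        have := hfv y (mem_fv_letrec.2 ⟨.inl ⟨_, hxB, hy⟩, hyn⟩)
        simp; omega

/-- A block whose dependency `Δ` has its last occurrence replaced. -/
theorem sim_dep {Δ : Dep} {E : Ctx} {B : Expr → Defs} {ns : List Var} {y : Var} {V : Expr}
    (hE : Loads E) (hΔ : LoadsDep Δ) (hx : Δ.head ∉ E.capt)
    (hns : ∀ M, names (B M) = ns) (hnd : ns.Nodup) (hsub : ∀ M, ∀ p ∈ Δ.plug M, p ∈ B M)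
    (hconst : ∀ M e, (B M).map (cell Δ.names e) = (B .bullet).map (cell Δ.names e))
    (hV : IsValue V) (hy : y ∉ Δ.lastCapt) (hyn : y ∈ ns)
    (hcase : (y ∈ Δ.names ∧ V = .bullet) ∨ (y ∉ Δ.names ∧ ∀ M, (y, V) ∈ B M))
    (hVc : ∀ z ∈ V.fv, z ∉ Δ.lastCapt)
    (hVfv : ∀ z ∈ V.fv, z ∉ ns → z ∈ (Expr.letrec (B (.var y)) (E.plug (.var Δ.head))).fv)
    (hVw : V.WF)
    (hcl : Closed ⟨h, K, .thunk (.letrec (B (.var y)) (E.plug (.var Δ.head))) e⟩) :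
    Sim 1 ⟨h, K, .thunk (.letrec (B (.var y)) (E.plug (.var Δ.head))) e⟩
      ⟨h, K, .thunk (.letrec (B V) (E.plug (.var Δ.head))) e⟩ := by
  obtain ⟨t, K', e', c, he', hc⟩ := loads_block hE hΔ hx hns hnd hsub hconst e h.length K.length
  obtain ⟨-, hfv⟩ := hcl.scoped
  have r₁ := (hc (.var y) h K rfl rfl).run (not_isValue_var y)
  have c₁ := (hcl.run r₁).idRel
  obtain ⟨N, hN⟩ := mem_names.1 (show y ∈ names (B .bullet) by rw [hns]; exact hyn)
  have hlook : (h ++ ((B .bullet).map (cell Δ.names (ext e ns h.length)) ++ t))[e' y]? =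
      some (.val (valOf V (ext e ns h.length))) := by
    rw [he' y hy, ext_of_mem hyn, ← hns .bullet, getElem?_block (by rw [hns]; exact hnd) hN]
    -- Either `y` is under evaluation and its cell holds `•`, or it lies off the chain and its cell
    -- still holds `V`.
    rcases hcase with ⟨h₁, rfl⟩ | ⟨h₁, h₂⟩
    · simp [cell, h₁, valOf]
    · have : N = V := names_inj (by rw [hns]; exact hnd) hN (h₂ .bullet)
      subst this
      simp [cell, h₁, code_of_value hV]
  have r₂ := r₁.trans (run_lookup_value hlook)
  have j₁ := (hc V h K rfl rfl).trans (.of_run (run_value hV _ _ _))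
  refine .of_join (p := True) (.of_run r₂) j₁ (β := idRel _)
    ⟨c₁.heap, c₁.stack, .val ((vrel_valOf hV hV).2 (aeq_env hVw fun z hz => ?_))⟩ (by omega)
  rw [he' z (hVc z hz)]
  refine ⟨rfl, ?_⟩
  by_cases hzn : z ∈ ns
  · have := (ext_lt (e := e) (n := h.length) hzn).2
    have hl : (B .bullet).length = ns.length := by rw [← hns .bullet]; simp
    simp only [List.length_append, List.length_map, hl]; omega
  · rw [ext_of_not_mem hzn]
    have := hfv z (hVfv z hz hzn)
    simp; omega

end Contraction

/-! ### Flattening of blocks -/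

theorem final_prj_bul {h : List Code} {i : Fin 2} {K : List Frame} :
    Final ⟨h, .prj i :: K, .val .bul⟩ := by
  intro c t h; cases h

theorem Dep.exists_binder_of_lastCapt (Δ : Dep) (M : Expr) {z : Var} (hz : z ∈ Δ.lastCapt) :
    ∃ p ∈ Δ.plug M, z ∈ p.2.binders := by
  cases Δ with
  | base y E =>
    exact ⟨(y, E.plug M), by simp [Dep.plug], capt_subset_binders E M z hz⟩
  | snoc Δ y E =>
    exact ⟨(y, E.plug M), by simp [Dep.plug], capt_subset_binders E M z hz⟩

/-- A closed expression that gets stuck in every stack. -/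
def stuckExpr : Expr := .prj 0 .bullet

theorem run_stuckExpr (h : List Code) (K : List Frame) (e : Env) :
    Run 1 ⟨h, K, .thunk stuckExpr e⟩ ⟨h, .prj 0 :: K, .val .bul⟩ :=
  .head .prj (.single .bullet)

/-- The states just after the nested and the merged block are allocated, with the needed right-hand
side replaced by a stuck expression. That expression makes no use of `D`, so the cells of `D` can
remain without partners; they form the excluded set. -/
theorem sRel_assoc_start {h : List Code} {K : List Frame} {e : Env} {B₀ D : Defs} {x : Var}
    {N : Expr} (hnd : (names (D ++ (x, stuckExpr) :: B₀)).Nodup)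
    (hwf : ∀ p ∈ B₀, p.2.WF) (hN : N.WF)
    (hB₀ : ∀ p ∈ B₀, ∀ y ∈ p.2.fv, y ∉ x :: names B₀ → y ∉ names D ∧ e y < h.length)
    (hfv : ∀ y ∈ N.fv, y ∉ x :: names B₀ → y ∉ names D ∧ e y < h.length)
    (hh : HRel (idRel h.length) ∅ (lk h) (lk h))
    (hK : List.Forall₂ (FRel (idRel h.length)) K K) :
    SRel (fun a b => idRel h.length a b ∨ ∃ y ∈ x :: names B₀,
        a = ext e (x :: names B₀) h.length y ∧
        b = ext e (names (D ++ (x, stuckExpr) :: B₀)) h.length y)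
      {b | ∃ y ∈ names D, b = ext e (names (D ++ (x, stuckExpr) :: B₀)) h.length y}
      ⟨h ++ codes ((x, stuckExpr) :: B₀) (ext e (x :: names B₀) h.length), K,
        .thunk N (ext e (x :: names B₀) h.length)⟩
      ⟨h ++ codes (D ++ (x, stuckExpr) :: B₀)
          (ext e (names (D ++ (x, stuckExpr) :: B₀)) h.length), K,
        .thunk N (ext e (names (D ++ (x, stuckExpr) :: B₀)) h.length)⟩ := by
  set ns₁ := x :: names B₀ with hns₁
  set B₂ : Defs := D ++ (x, stuckExpr) :: B₀ with hB₂
  set f := ext e ns₁ h.length with hf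
  set g := ext e (names B₂) h.length with hg
  have hns₂ : names B₂ = names D ++ ns₁ := by simp [hB₂, hns₁]
  have hn₁ : (names ((x, stuckExpr) :: B₀)).Nodup := by
    rw [hns₂] at hnd; exact hnd.of_append_right
  have hdisj : ∀ y ∈ names D, y ∉ ns₁ := by
    rw [hns₂, List.nodup_append'] at hnd; exact fun y hy hy' => hnd.2.2 hy hy'
  have hmem : ∀ y ∈ ns₁, y ∈ names B₂ := fun y hy => by rw [hns₂]; simp [hy]
  have hmemD : ∀ y ∈ names D, y ∈ names B₂ := fun y hy => by rw [hns₂]; simp [hy]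
  have henv : ∀ y, (y ∉ ns₁ → y ∉ names D ∧ e y < h.length) → idRel h.length (f y) (g y) ∨
      ∃ z ∈ ns₁, f y = f z ∧ g y = g z := by
    intro y hy
    by_cases hyn : y ∈ ns₁
    · exact .inr ⟨y, hyn, rfl, rfl⟩
    · obtain ⟨h₁, h₂⟩ := hy hyn
      left
      rw [hf, hg, ext_of_not_mem hyn, ext_of_not_mem (by rw [hns₂]; simp [h₁, hyn])]
      exact ⟨rfl, h₂⟩
  refine ⟨?_, stackRel_mono (fun _ _ => .inl) hK, .thunk (AEq.refl hN fun y hy =>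
    henv y (hfv y hy))⟩
  refine hh.extend (γ := fun a b => ∃ y ∈ ns₁, a = f y ∧ b = g y) ?_ ?_ ?_ ?_ ?_ ?_ ?_ ?_ ?_ ?_
  · intro a c k
    have := lk_lt k
    simpa [lk, List.getElem?_append_left this] using k
  · intro a c k
    have := lk_lt k
    simpa [lk, List.getElem?_append_left this] using k
  · rintro a b a' b' ⟨y, hy, rfl, rfl⟩ ⟨z, hz, rfl, rfl⟩
    exact ⟨fun k => by rw [ext_inj hy hz k], fun k => by rw [ext_inj (hmem y hy) (hmem z hz) k]⟩
  · rintro a b b' ⟨y, hy, rfl, rfl⟩ ⟨-, k⟩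
    exact absurd k (not_lt.2 (ext_lt hy).1)
  · rintro a b b' ⟨y, hy, rfl, rfl⟩ ⟨rfl, k⟩
    exact absurd k (not_lt.2 (ext_lt (hmem y hy)).1)
  · rintro a b ⟨y, hy, rfl, rfl⟩
    obtain ⟨M, hM⟩ := mem_names.1 (show y ∈ names ((x, stuckExpr) :: B₀) from hy)
    refine ⟨_, _, lk_codes hn₁ hM h f e, lk_codes hnd (M := M) ?_ h g e, crel_code.2 ?_⟩
    · rw [hB₂]; exact List.mem_append_right _ hM
    · rcases List.mem_cons.1 hM with hM | hM
      · obtain ⟨rfl, rfl⟩ := Prod.mk.inj hM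
        exact AEq.refl (by simp [stuckExpr, Expr.WF]) (by simp [stuckExpr, Expr.fv])
      · exact AEq.refl (hwf _ hM) fun z hz => henv z (hB₀ _ hM z hz)
  · intro a c k
    by_cases ha : ∃ y ∈ ns₁, a = f y
    · obtain ⟨y, hy, rfl⟩ := ha; exact .inr ⟨_, y, hy, rfl, rfl⟩
    · push Not at ha
      left
      have := lk_codes_keep (D := (x, stuckExpr) :: B₀) (h := h) (e := f) (e' := e) (a := a)
        (fun y hy => ha y hy) hn₁
      rw [← this]; exact k
  · intro b d k hb
    by_cases hb' : ∃ y ∈ names B₂, b = g y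
    · obtain ⟨y, hy, rfl⟩ := hb'
      rw [hns₂, List.mem_append] at hy
      rcases hy with hy | hy
      · exact absurd ⟨y, hy, rfl⟩ hb
      · exact .inr ⟨_, y, hy, rfl, rfl⟩
    · push Not at hb'
      have := lk_codes_keep (D := B₂) (h := h) (e := g) (e' := e) (a := b)
        (fun y hy => hb' y hy) hnd
      exact .inl ⟨by rw [← this]; exact k, by simp⟩
  · rintro a b ⟨y, hy, rfl⟩
    constructor
    · rintro ⟨rfl, k⟩
      exact absurd k (not_lt.2 (ext_lt (hmemD y hy)).1)
    · rintro ⟨z, hz, -, k⟩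
      have := ext_inj (hmemD y hy) (hmem z hz) k
      subst this
      exact hdisj y hy hz
  · rintro b ⟨y, hy, rfl⟩
    obtain ⟨M, hM⟩ := mem_names.1 (hmemD y hy)
    exact ⟨_, lk_codes hnd hM h g e⟩

/-- The block of a needed binding is merged into the surrounding block. -/
theorem sim_assoc {h : List Code} {K : List Frame} {e : Env} {Δ : Dep} {E : Ctx} {B₀ D : Defs}
    {x : Var} {A : Expr} (hE : Loads E) (hΔ : LoadsDep Δ) (hx : Δ.head ∉ E.capt)
    (hlast : Δ.lastCapt = []) (hxΔ : x ∈ Δ.names) (hsub : ∀ M, ∀ p ∈ Δ.plug M, p ∈ (x, M) :: B₀)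
    (hnd : (names (D ++ (x, A) :: B₀)).Nodup)
    (hD : ∀ y ∈ names D, (∀ p ∈ B₀, y ∉ p.2.fv) ∧ y ∉ (E.plug (.var Δ.head)).fv)
    (hcl : Closed ⟨h, K, .thunk (.letrec ((x, .letrec D A) :: B₀) (E.plug (.var Δ.head))) e⟩) :
    Sim 1 ⟨h, K, .thunk (.letrec ((x, .letrec D A) :: B₀) (E.plug (.var Δ.head))) e⟩
      ⟨h, K, .thunk (.letrec (D ++ (x, A) :: B₀) (E.plug (.var Δ.head))) e⟩ := by
  set N := E.plug (.var Δ.head) with hN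
  obtain ⟨hw, hfv⟩ := hcl.scoped
  have hwB := wfRhs_iff.1 hw.2.1
  have hwD : (Expr.letrec D A).WF := hwB (x, .letrec D A) (by simp)
  set B₂ : Expr → Defs := fun M => D ++ (x, M) :: B₀ with hB₂
  have hns₂ : ∀ M, names (B₂ M) = names D ++ x :: names B₀ := by simp [hB₂]
  have hnd₂ : (names D ++ x :: names B₀).Nodup := by rw [← hns₂ A]; exact hnd
  obtain ⟨t₁, K₁, e₁, c₁, he₁, hc₁⟩ := loads_block hE hΔ hx (B := fun M => (x, M) :: B₀)
    (ns := x :: names B₀) (by simp) hnd₂.of_append_right hsub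
    (fun M e => by simp [cell, hxΔ]) e h.length K.length
  obtain ⟨t₂, K₂, e₂, c₂, he₂, hc₂⟩ := loads_block hE hΔ hx (B := B₂)
    (ns := names D ++ x :: names B₀) hns₂ hnd₂
    (fun M p hp => List.mem_append_right _ (hsub M p hp))
    (fun M e => by simp [hB₂, cell, hxΔ]) e h.length K.length
  have ee₁ : e₁ = ext e (x :: names B₀) h.length := funext fun y => he₁ y (by simp [hlast])
  have ee₂ : e₂ = ext e (names (B₂ stuckExpr)) h.length := by
    rw [hns₂]; exact funext fun y => he₂ y (by simp [hlast])
  -- The heaps and stacks produced by loading the two blocks come from unrelated existence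
  -- statements. A probe in the needed position relates them: it is closed, it is not a value (so
  -- loading is exact), and it stops the machine above any stack.
  have hst : ¬ IsValue stuckExpr := nofun
  obtain ⟨T₁, hT₁⟩ : ∃ T, T = h ++ (((x, Expr.bullet) :: B₀).map
    (cell Δ.names (ext e (x :: names B₀) h.length)) ++ t₁) := ⟨_, rfl⟩
  obtain ⟨T₂, hT₂⟩ : ∃ T, T = h ++ ((B₂ .bullet).map
    (cell Δ.names (ext e (names D ++ x :: names B₀) h.length)) ++ t₂) := ⟨_, rfl⟩
  replace hc₁ := fun M => hc₁ M h K rfl rfl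
  replace hc₂ := fun M => hc₂ M h K rfl rfl
  rw [← hT₁] at hc₁
  rw [← hT₂] at hc₂
  -- the two blocks with a stuck expression in the place of the needed binding
  have R₁ := ((hc₁ stuckExpr).run hst).trans (run_stuckExpr _ _ _)
  have R₂ := ((hc₂ stuckExpr).run hst).trans (run_stuckExpr _ _ _)
  obtain ⟨k₁, hk₁, S₁⟩ := (Run.single .letrec).to_final R₁ final_prj_bul
  obtain ⟨k₂, hk₂, S₂⟩ := (Run.single .letrec).to_final R₂ final_prj_bul
  have hid := hcl.idRel
  have start := sRel_assoc_start (h := h) (K := K) (e := e) (B₀ := B₀) (D := D) (x := x) (N := N)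
    (by rw [show names (D ++ (x, stuckExpr) :: B₀) = _ from hns₂ stuckExpr]; exact hnd₂)
    (fun p hp => hwB p (by simp [hp])) hw.2.2
    (fun p hp y hy hyn => ⟨fun hyD => (hD y hyD).1 p hp hy,
      hfv y (mem_fv_letrec.2 ⟨.inl ⟨p, by simp [hp], hy⟩, by simpa using hyn⟩)⟩)
    (fun y hy hyn => ⟨fun hyD => (hD y hyD).2 hy,
      hfv y (mem_fv_letrec.2 ⟨.inr hy, by simpa using hyn⟩)⟩) hid.heap hid.stack
  -- Lockstep from the related starts. Both ends are final, so `F` is the end of the second run: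
  -- loading costs the same in both blocks, yields related heaps and stacks, and leaves the cells of
  -- `D` untouched.
  obtain ⟨β, F, hF, hβ, hrel, hX⟩ := bisim_run start S₁
  have hFfin : Final F := by
    obtain ⟨H, KF, cF⟩ := F
    have l₁ := hrel.stack
    have l₂ := hrel.focus
    cases l₁ with
    | cons l _ =>
      cases l
      cases l₂ with
      | val l => cases l; exact final_prj_bul
  obtain ⟨j, hj, hj'⟩ := hF.to_final S₂ final_prj_bul
  obtain ⟨rfl, rfl⟩ := hj'.of_final hFfin
  have hcost : c₁ = c₂ := by omega
  -- the actual runs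
  have r₁ := ((hc₁ (.letrec D A)).run nofun).trans (.single .letrec)
  have j₂ := hc₂ A
  rw [ee₁] at r₁
  rw [ee₂] at j₂
  set f := ext e (x :: names B₀) h.length with hf
  set g := ext e (names (B₂ stuckExpr)) h.length with hg
  set d := ext f (names D) T₁.length with hd
  have hgmem : ∀ y ∈ names D, y ∈ names (B₂ stuckExpr) := fun y hy => by
    rw [hns₂]; simp [hy]
  have henv : ∀ y, (y ∉ names D → y ∉ x :: names B₀ → e y < h.length) →
      β (d y) (g y) ∨ ∃ z ∈ names D, d y = d z ∧ g y = g z := by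
    intro y hy
    by_cases hyD : y ∈ names D
    · exact .inr ⟨y, hyD, rfl, rfl⟩
    · left
      apply hβ
      rw [hd, ext_of_not_mem hyD]
      by_cases hyn : y ∈ x :: names B₀
      · exact .inr ⟨y, hyn, rfl, rfl⟩
      · left
        rw [hf, hg, ext_of_not_mem hyn, ext_of_not_mem (by
          rw [hns₂, List.mem_append, not_or]; exact ⟨hyD, hyn⟩)]
        exact ⟨rfl, hy hyD hyn⟩
  have hfvD : ∀ y, ((∃ p ∈ D, y ∈ p.2.fv) ∨ y ∈ A.fv) → y ∉ names D → y ∉ x :: names B₀ →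
      e y < h.length := fun y hy hyD hyn =>
    hfv y (mem_fv_letrec.2 ⟨.inl ⟨(x, .letrec D A), by simp, mem_fv_letrec.2 ⟨hy, hyD⟩⟩,
      by simpa using hyn⟩)
  have hnS : (names (B₂ stuckExpr)).Nodup := by rw [hns₂]; exact hnd₂
  -- The bindings of `D` are allocated last on the left, at `d`, and from the start on the right, at
  -- `g`; these pairs complete `β`. The second allocation on the left is the cost that is saved.
  refine .of_join (p := True) (.of_run r₁) j₂
    (β := fun a b => β a b ∨ ∃ y ∈ names D, a = d y ∧ b = g y)
    ⟨?_, ?_, .thunk (AEq.refl hwD.2.2 fun y hy => henv y (hfvD y (.inr hy)))⟩ (by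
      simp only [List.length_append]; omega)
  · refine hrel.heap.extend (γ := fun a b => ∃ y ∈ names D, a = d y ∧ b = g y)
      ?_ id ?_ ?_ ?_ ?_ ?_ ?_ ?_ ?_
    · intro a c k
      have := lk_lt k
      simpa [lk, List.getElem?_append_left this] using k
    · rintro a b a' b' ⟨y, hy, rfl, rfl⟩ ⟨z, hz, rfl, rfl⟩
      exact ⟨fun k => by rw [ext_inj hy hz k],
        fun k => by rw [ext_inj (hgmem y hy) (hgmem z hz) k]⟩
    · rintro a b b' ⟨y, hy, rfl, rfl⟩ k
      obtain ⟨_, _, k, -⟩ := hrel.heap.rel k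
      exact absurd (lk_lt k) (not_lt.2 (ext_lt hy).1)
    · rintro a b b' ⟨y, hy, rfl, rfl⟩
      exact hrel.heap.excl ⟨y, hy, rfl⟩
    · rintro a b ⟨y, hy, rfl, rfl⟩
      obtain ⟨M, hM⟩ := mem_names.1 hy
      have l := hX (g y) ⟨y, hy, rfl⟩
      simp only at l
      rw [lk_codes hnS (M := M) (List.mem_append_left _ hM) h g e] at l
      refine ⟨_, _, lk_codes hwD.1 hM T₁ d f, l, crel_code.2 (AEq.refl
        (wfRhs_iff.1 hwD.2.1 _ hM) fun z hz => henv z (hfvD z (.inl ⟨_, hM, hz⟩)))⟩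
    · intro a c k
      by_cases ha : ∃ y ∈ names D, a = d y
      · obtain ⟨y, hy, rfl⟩ := ha; exact .inr ⟨_, y, hy, rfl, rfl⟩
      · push Not at ha
        left
        have := lk_codes_keep (D := D) (h := T₁) (e := d) (e' := f) (a := a)
          (fun y hy => ha y hy) hwD.1
        exact this ▸ k
    · intro b c k _
      by_cases hb : ∃ y ∈ names D, b = g y
      · obtain ⟨y, hy, rfl⟩ := hb; exact .inr ⟨_, y, hy, rfl, rfl⟩
      · exact .inl ⟨k, fun h => hb h⟩
    · intro a b k; simp at k
    · intro b k; simp at k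
  · have := hrel.stack
    cases this with
    | cons _ l => exact stackRel_mono (fun _ _ => .inl) l

/-! ### All contractions -/

theorem sim_contract {h : List Code} {K : List Frame} {e : Env} {M N : Expr} (hMN : Contract M N)
    (hcan : M.Canonical) (hcl : Closed ⟨h, K, .thunk M e⟩) :
    Sim 1 ⟨h, K, .thunk M e⟩ ⟨h, K, .thunk N e⟩ := by
  cases hMN with
  | beta_need x M N => exact sim_beta hcan hcl
  | lift D A N _ => exact sim_lift hcan hcl
  | deref x V D E hV => exact sim_deref hV hcan hcl
  | deref_env Δ x' V D E hV =>
    obtain ⟨hn, hb, hE, hcapt⟩ := hcan.block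
    obtain ⟨hw, hfv⟩ := hcl.scoped
    have hb' := hb
    rw [bindersDefs_append, List.nodup_append'] at hb'
    have hns : ∀ M, names (Δ.plug M ++ (x', V) :: D) = Δ.names ++ x' :: names D := by
      intro M; rw [← Dep.names_plug Δ M]; simp
    have hVm : ∀ M, (x', V) ∈ Δ.plug M ++ (x', V) :: D := by simp
    refine sim_dep (B := fun M => Δ.plug M ++ (x', V) :: D) hE (loadsDep hb'.1)
      (hcapt _ (by rw [hns]; simp [Dep.head_mem])) hns (by rw [← hns]; exact hn)
      (fun M p hp => List.mem_append_left _ hp)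
      (fun M e => by
        rw [List.map_append, List.map_append, Δ.map_plug_const fun y hy => cell_const hy e]) hV
      ?_ (by simp) (.inr ⟨?_, hVm⟩) ?_ ?_ (wfRhs_iff.1 hw.2.1 _ (hVm _)) hcl
    · intro h'
      exact hb'.2.2 (lastCapt_subset_binders Δ _ _ h') (by simp [bindersDefs])
    · intro h'
      rw [hns, List.nodup_append'] at hn
      exact hn.2.2 h' (by simp)
    · intro z hz hz'
      have hzb := lastCapt_subset_binders Δ (.var x') z hz'
      refine (hcan.block_fv (y := z) (by simp [Expr.binders, bindersDefs_append, hzb]) ?_).1 _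
        (hVm _) hz
      obtain ⟨p, hp, hzp⟩ := Δ.exists_binder_of_lastCapt (.var x') hz'
      exact not_mem_names_of_binders hb (List.mem_append_left _ hp) hzp
    · intro z hz hzn
      exact mem_fv_letrec.2 ⟨.inl ⟨_, hVm _, hz⟩, by rw [hns]; exact hzn⟩
  | assoc x D A D' E hA =>
    obtain ⟨hn, hb, hE, hcapt⟩ := hcan.block
    have hb' := hb
    simp only [bindersDefs, Expr.binders, List.nodup_cons, List.nodup_append', List.mem_append,
      not_or] at hb'
    -- A chain with a single link whose hole is the entire right-hand side of `x`.
    refine sim_assoc (Δ := .base x .hole) hE (loadsDep_base (loads (M := .bullet)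
      (by simp [Ctx.plug, Expr.binders]))) (hcapt x (by simp)) rfl (by simp [Dep.names])
      (by simp [Dep.plug, Ctx.plug]) ?_ ?_ hcl
    · have p : (bindersDefs (D ++ (x, .bullet) :: D')).Nodup := by
        simp only [bindersDefs_append, bindersDefs, Expr.binders, List.nodup_append',
          List.nodup_cons, List.nil_append]
        refine ⟨hb'.2.1.1, ⟨hb'.1.2, hb'.2.2.1⟩, ?_⟩
        rw [List.disjoint_cons_right]
        exact ⟨hb'.1.1.1, fun y hy hy' => hb'.2.2.2 (by simp [hy]) hy'⟩
      have := p.sublist (names_sublist_binders _)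
      simpa using this
    · intro y hy
      have hyb : y ∈ (Expr.letrec D A).binders := by
        simp [Expr.binders, (names_sublist_binders D).subset hy]
      have := hcan.block_fv (y := y)
        (by simp only [Expr.binders, bindersDefs, List.mem_append, List.mem_cons] at hyb ⊢; tauto)
        (not_mem_names_of_binders hb (p := (x, .letrec D A)) (by simp) hyb)
      exact ⟨fun p hp => this.1 p (by simp [hp]), this.2⟩
  | assoc_env x D A Δ D' E hA =>
    obtain ⟨hn, hb, hE, hcapt⟩ := hcan.block
    have hb' := hb
    simp only [bindersDefs, bindersDefs_append, Expr.binders, List.nodup_cons, List.nodup_append',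
      List.mem_append, not_or] at hb'
    have hx₁ : x ∉ Δ.lastCapt := fun h => hb'.1.2.1 (lastCapt_subset_binders Δ _ x h)
    have hx₂ : x ∉ Δ.names := fun h => hb'.1.2.1 ((names_sublist_binders _).subset
      (by rwa [Dep.names_plug]))
    -- The chain is prolonged by the needed binding, with its entire right-hand side as hole.
    refine sim_assoc (Δ := .snoc Δ x .hole) (B₀ := Δ.plug (.var x) ++ D') hE
      (loadsDep_snoc (loadsDep hb'.2.2.1.1) (loads (M := .bullet)
        (by simp [Ctx.plug, Expr.binders])) hx₂ hx₁)
      (hcapt _ (by simp [Dep.names_plug, Dep.head, Dep.head_mem])) rfl (by simp [Dep.names])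
      (by intro M p hp
          simp only [Dep.plug, Ctx.plug, List.mem_append, List.mem_singleton] at hp
          rcases hp with h | h <;> simp [h]) ?_ ?_ hcl
    · have p : (bindersDefs (D ++ (x, .bullet) :: (Δ.plug (.var x) ++ D'))).Nodup := by
        simp only [bindersDefs_append, bindersDefs, Expr.binders, List.nodup_append',
          List.nodup_cons, List.nil_append, List.mem_append, not_or]
        refine ⟨hb'.2.1.1, ⟨hb'.1.2, hb'.2.2.1⟩, ?_⟩
        rw [List.disjoint_cons_right]
        exact ⟨hb'.1.1.1, fun y hy hy' => hb'.2.2.2 (List.mem_append_left _ hy) hy'⟩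
      have := p.sublist (names_sublist_binders _)
      simpa using this
    · intro y hy
      have hyb : y ∈ (Expr.letrec D A).binders := by
        simp [Expr.binders, (names_sublist_binders D).subset hy]
      have := hcan.block_fv (y := y)
        (by simp only [Expr.binders, bindersDefs, List.mem_append, List.mem_cons] at hyb ⊢; tauto)
        (not_mem_names_of_binders hb (p := (x, .letrec D A)) (by simp) hyb)
      exact ⟨fun p hp => this.1 p (List.mem_cons_of_mem _ hp), this.2⟩
  | error Δ D E =>
    obtain ⟨hn, hb, hE, hcapt⟩ := hcan.block
    have hb' := hb
    rw [bindersDefs_append, List.nodup_append'] at hb'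
    have hns : ∀ M, names (Δ.plug M ++ D) = Δ.names ++ names D := by
      intro M; rw [← Dep.names_plug Δ M]; simp
    have hhead : Δ.head ∈ names (Δ.plug (.var Δ.head) ++ D) := by rw [hns]; simp [Dep.head_mem]
    -- When the last occurrence is reached, the head of the chain is under evaluation, so its lookup
    -- returns `•`.
    refine sim_dep (B := fun M => Δ.plug M ++ D) (V := .bullet) hE (loadsDep hb'.1)
      (hcapt _ hhead) hns (by rw [← hns]; exact hn)
      (fun M p hp => List.mem_append_left _ hp)
      (fun M e => by
        rw [List.map_append, List.map_append, Δ.map_plug_const fun y hy => cell_const hy e])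
      .bullet ?_ (by rw [← hns (.var Δ.head)]; exact hhead) (.inl ⟨Δ.head_mem, rfl⟩)
      (by simp [Expr.fv]) (by simp [Expr.fv]) (by simp [Expr.WF]) hcl
    intro h'
    obtain ⟨p, hp, hzp⟩ := Δ.exists_binder_of_lastCapt (.var Δ.head) h'
    exact not_mem_names_of_binders hb (List.mem_append_left _ hp) hzp hhead
  | error_env Δ' Δ D E =>
    obtain ⟨hn, hb, hE, hcapt⟩ := hcan.block
    have hb' := hb
    simp only [bindersDefs_append, List.nodup_append'] at hb'
    have hns : ∀ M, names (Δ'.plug M ++ Δ.plug (.var Δ'.head) ++ D) =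
        Δ'.names ++ Δ.names ++ names D := by
      intro M; rw [← Dep.names_plug Δ' M, ← Dep.names_plug Δ (.var Δ'.head)]; simp
    have hhead : Δ'.head ∈ names (Δ'.plug (.var Δ'.head) ++ Δ.plug (.var Δ'.head) ++ D) := by
      rw [hns]; simp [Dep.head_mem]
    -- The path to the cycle and the cycle form one chain; the variable at its end is a member of
    -- the chain, hence under evaluation.
    have hL : LoadsDep (Δ.append Δ') := by
      refine loadsDep (M := .var Δ'.head) ?_
      rw [Dep.plug_append, bindersDefs_append]
      exact List.nodup_append'.2 ⟨hb'.1.2.1, hb'.1.1, hb'.1.2.2.symm⟩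
    have hcap : (Δ.append Δ').head ∉ E.capt := by
      rw [Dep.head_append]; exact hcapt _ (by rw [hns]; simp [Dep.head_mem])
    have key := sim_dep (h := h) (K := K) (e := e)
      (B := fun M => Δ'.plug M ++ Δ.plug (.var Δ'.head) ++ D) (V := .bullet) (y := Δ'.head) hE
      hL hcap hns (by rw [← hns]; exact hn)
      (fun M p hp => by rw [Dep.plug_append] at hp; simp at hp ⊢; tauto)
      (fun M e => by
        rw [List.map_append, List.map_append, List.map_append, List.map_append,
          Δ'.map_plug_const fun y hy => cell_const (by rw [Dep.names_append]; simp [hy]) e])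
      .bullet ?_ (by rw [← hns (.var Δ'.head)]; exact hhead)
      (.inl ⟨by rw [Dep.names_append]; simp [Dep.head_mem], rfl⟩)
      (by simp [Expr.fv]) (by simp [Expr.fv]) (by simp [Expr.WF])
    · rw [Dep.head_append] at key
      exact key hcl
    · intro h'
      rw [Dep.lastCapt_append] at h'
      obtain ⟨p, hp, hzp⟩ := Δ'.exists_binder_of_lastCapt (.var Δ'.head) h'
      exact not_mem_names_of_binders hb
        (List.mem_append_left _ (List.mem_append_left _ hp)) hzp hhead
  | error_beta M => exact sim_error_beta hcl
  | prj i V h₀ h₁ => exact sim_prj h₀ h₁ hcl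
  | lift_prj i D A _ => exact sim_lift_prj hcl
  | lift_pair₁ D A M _ => exact sim_lift_pair₁ hcan hcl
  | lift_pair₂ V D A hV _ => exact sim_lift_pair₂ hV hcan hcl

/-! ### The natural semantics and the machine -/

/-- A heap of the natural semantics as a heap of the machine, whose locations are variables. -/
noncomputable def raw (Ψ : Heap) : ℕ → Option Code := fun x => (Ψ x).map fun M => code M id

theorem raw_some {Ψ : Heap} {x : Var} {M : Expr} (h : Ψ x = some M) :
    raw Ψ x = some (code M id) := by simp [raw, h]

theorem raw_none {Ψ : Heap} {x : Var} (h : Ψ x = none) : raw Ψ x = none := by simp [raw, h]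

theorem exists_of_raw {Ψ : Heap} {x : Var} {c : Code} (h : raw Ψ x = some c) :
    ∃ M, Ψ x = some M ∧ c = code M id := by
  simp only [raw, Option.map_eq_some_iff] at h
  obtain ⟨M, h₁, h₂⟩ := h
  exact ⟨M, h₁, h₂.symm⟩

theorem raw_set (Ψ : Heap) (x : Var) (M : Expr) :
    raw (Ψ.set x M) = Function.update (raw Ψ) x (some (code M id)) := by
  funext y
  by_cases h : y = x
  · subst h; simp [raw, Heap.set]
  · simp [raw, Heap.set, h]

theorem lookup_of_mem {D : Defs} (hD : (names D).Nodup) {x : Var} {M : Expr} (h : (x, M) ∈ D) :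
    D.lookup x = some M := by
  induction D with
  | nil => simp at h
  | cons p D ih =>
    obtain ⟨y, N⟩ := p
    simp only [names, List.map_cons, List.nodup_cons] at hD
    rcases List.mem_cons.1 h with h₁ | h₁
    · obtain ⟨rfl, rfl⟩ := Prod.mk.inj h₁; simp
    · have : x ≠ y := by rintro rfl; exact hD.1 (mem_names.2 ⟨M, h₁⟩)
      rw [List.lookup_cons, beq_false_of_ne this]
      exact ih hD.2 h₁

theorem lookup_eq_none {D : Defs} {x : Var} (h : x ∉ names D) : D.lookup x = none := by
  induction D with
  | nil => rfl
  | cons p D ih =>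
    obtain ⟨y, N⟩ := p
    simp only [names, List.map_cons, List.mem_cons, not_or] at h
    rw [List.lookup_cons, beq_false_of_ne h.1]
    exact ih h.2

theorem Eval.isValue {Ψ Φ : Heap} {M V : Expr} (h : Eval Ψ M Φ V) : IsValue V := by
  induction h with
  | value h => exact h
  | app _ _ _ _ _ _ ih => exact ih
  | var _ _ ih => exact ih
  | letrec _ _ _ _ _ ih => exact ih
  | error_beta _ _ => exact .bullet
  | pair _ _ ih₁ ih₂ => exact .pair ih₁ ih₂
  | prj i V _ ih =>
    cases ih with | pair h₀ h₁ => fin_cases i; exacts [h₀, h₁]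

/-- The value rule and the pair rule overlap on pairs of values, but they give the same result. -/
theorem Eval.of_isValue {Ψ Φ : Heap} {M V : Expr} (h : Eval Ψ M Φ V) (hM : IsValue M) :
    Φ = Ψ ∧ V = M := by
  induction h with
  | value h => exact ⟨rfl, rfl⟩
  | pair _ _ ih₁ ih₂ =>
    cases hM with
    | pair h₁ h₂ =>
      obtain ⟨rfl, rfl⟩ := ih₁ h₁
      obtain ⟨rfl, rfl⟩ := ih₂ h₂
      exact ⟨rfl, rfl⟩
  | app => cases hM
  | var => cases hM
  | letrec => cases hM
  | error_beta => cases hM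
  | prj => cases hM

/-- The fresh variable of the natural semantics is paired with the next location. Substituting it in
the body corresponds to extending the environment; freshness prevents capture. Shared by both
directions of the comparison, as is `alloc_letrec`. -/
theorem alloc_arg {β : ℕ → ℕ → Prop} {Φ : Heap} {h : List Code} {x y x' : Var}
    {M N M' N' : Expr} {e e' : Env} (hh : HRel β ∅ (raw Φ) (lk h)) (hx' : Φ.Fresh x')
    (hxN : x' ∉ (Expr.lam x N).vars) (hM : AEq (fun a b => β a (e b)) M M')
    (hN : AEq (Bd [(x, y)] fun a b => β a (e' b)) N N') :
    ∃ β', (∀ a b, β a b → β' a b) ∧ HRel β' ∅ (raw (Φ.set x' M)) (lk (h ++ [code M' e])) ∧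
      AEq (fun a b => β' a (ext e' [y] h.length b)) (N.subst x' x) N' := by
  refine ⟨allocRel β [(x, y)] (Function.update id x x') (ext e' [y] h.length), fun _ _ => .inl,
    ?_, ?_⟩
  · refine hh.alloc (by simp) (by simp) (by simp) (by simp) ?_ ?_ ?_ ?_ ?_
    · simpa using raw_none hx'.1
    · simp [ext_singleton, lk]
    · intro a ha
      simp only [List.mem_singleton, forall_eq, Function.update_self] at ha
      rw [raw_set, Function.update_of_ne ha]
    · intro a ha
      simp only [List.mem_singleton, forall_eq, ext_singleton] at ha
      simp only [lk]
      rcases lt_or_gt_of_ne ha with h' | h'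
      · rw [List.getElem?_append_left h']
      · rw [List.getElem?_eq_none_iff.2 (by simp; omega), List.getElem?_eq_none_iff.2 (by omega)]
    · intro p hp
      obtain rfl := List.mem_singleton.1 hp
      refine ⟨code M id, code M' e, by simp [raw_set], by simp [ext_singleton, lk], ?_⟩
      exact (crel_code.2 hM).mono fun _ _ => .inl
  · refine hN.rename (fun a _ b hab => ?_) fun a ha => ?_
    · refine allocRel_of_bd (e₁ := id) (e₂ := e') ?_ ?_ hab
      · intro z hz; exact Function.update_of_ne (by simpa [eq_comm] using hz) _ _
      · intro z hz; exact ext_of_not_mem (by simpa [eq_comm] using hz)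
    · by_cases hax : a = x
      · right
        subst hax
        rw [Function.update_self]
        exact fun h => hxN (by simp [Expr.vars, binders_subset_vars _ _ h])
      · left; simp [hax]

theorem alloc_letrec {β : ℕ → ℕ → Prop} {Ψ : Heap} {h : List Code} {D D' : Defs} {N N' : Expr}
    {e : Env} {ρ : Var → Var} (hh : HRel β ∅ (raw Ψ) (lk h))
    (hM : AEq (fun a b => β a (e b)) (.letrec D N) (.letrec D' N'))
    (h₁ : ∀ y, y ∉ names D → ρ y = y) (h₂ : Set.InjOn ρ {y | y ∈ names D})
    (h₃ : ∀ y ∈ names D, Ψ.Fresh (ρ y) ∧ ρ y ∉ (Expr.letrec D N).vars) :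
    ∃ β', (∀ a b, β a b → β' a b) ∧
      HRel β' ∅ (raw (Ψ.extend (D.map fun b => (ρ b.1, b.2.rename ρ))))
        (lk (h ++ codes D' (ext e (names D') h.length))) ∧
      AEq (fun a b => β' a (ext e (names D') h.length b)) (N.rename ρ) N' := by
  cases hM with
  | @letrec _ _ _ _ _ L n₁ n₂ p₁ p₂ k₁ k₂ =>
    have hbd : ∀ a b, Bd (pnames L) (fun a b => β a (e b)) a b →
        allocRel β (pnames L) ρ (ext e (names D') h.length) (ρ a)
          (ext e (names D') h.length b) := fun a b hab =>
      allocRel_of_bd (e₁ := id) (e₂ := e) (fun x hx => h₁ x (by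
          rw [matching_left_names p₁]; rintro ⟨p, hp, e⟩; exact hx p hp e))
        (fun x hx => ext_of_not_mem (by
          rw [matching_right_names p₂]; rintro ⟨p, hp, e⟩; exact hx p hp e)) hab
    have hρ : ∀ a (M : Expr), (∀ z ∈ M.binders, z ∈ (Expr.letrec D N).binders) →
        ρ a = a ∨ ρ a ∉ M.binders := by
      intro a M hz
      by_cases ha : a ∈ names D
      · exact .inr fun h => (h₃ a ha).2 (binders_subset_vars _ _ (hz _ h))
      · exact .inl (h₁ a ha)
    have hnd : (names (D.map fun b => (ρ b.1, b.2.rename ρ))).Nodup := by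
      have : names (D.map fun b => (ρ b.1, b.2.rename ρ)) = (names D).map ρ := by simp
      rw [this]
      exact n₁.map_on fun x hx y hy hxy => h₂ hx hy hxy
    refine ⟨allocRel β (pnames L) ρ (ext e (names D') h.length), fun _ _ => .inl, ?_, ?_⟩
    · refine hh.alloc_block n₂ p₂ (pnames_fst_nodup n₁ p₁) ?_ ?_ ?_ ?_
      · intro p hp q hq hpq
        exact h₂ ((matching_left_names p₁).2 ⟨p, hp, rfl⟩)
          ((matching_left_names p₁).2 ⟨q, hq, rfl⟩) hpq
      · intro p hp
        exact raw_none (h₃ _ ((matching_left_names p₁).2 ⟨p, hp, rfl⟩)).1.1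
      · intro a ha
        have : a ∉ names (D.map fun b => (ρ b.1, b.2.rename ρ)) := by
          intro ha'
          obtain ⟨x, hx, rfl⟩ : ∃ x ∈ names D, ρ x = a := by
            simpa using ha'
          obtain ⟨p, hp, rfl⟩ := (matching_left_names p₁).1 hx
          exact ha p hp rfl
        simp [raw, Heap.extend, lookup_eq_none this]
      · intro q hq
        have hq₁ := (matching_left p₁).2 ⟨q, hq, rfl⟩
        refine ⟨code (q.1.2.rename ρ) id, raw_some ?_, crel_code.2 ?_⟩
        · rw [Heap.extend, lookup_of_mem hnd (M := q.1.2.rename ρ)]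
          · rfl
          · exact List.mem_map.2 ⟨q.1, hq₁, rfl⟩
        · refine (k₁ q hq).rename (fun a _ b => hbd a b) fun a _ => hρ a _ fun z hz => ?_
          simp only [Expr.binders, List.mem_append]
          exact .inl (mem_bindersDefs hq₁ hz)
    · exact k₂.rename (fun a _ b => hbd a b) fun a _ => hρ a _ fun z hz => by
        simp [Expr.binders, hz]

theorem hrel_set_raw {β : ℕ → ℕ → Prop} {Ψ : Heap} {h : List Code}
    (hh : HRel β ∅ (raw Ψ) (lk h)) {x : Var} {l : ℕ} (hxl : β x l) {V : Expr} {v : Val}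
    (hV : IsValue V) (hv : VRel β (valOf V id) v) :
    HRel β ∅ (raw (Ψ.set x V)) (lk (h.set l (.val v))) := by
  obtain ⟨c, d, -, k, -⟩ := hh.rel hxl
  rw [raw_set, lk_set k, code_of_value hV]
  exact hh.set hxl (.val hv)

/-- The natural semantics is simulated by the machine. -/
theorem Eval.run {Ψ Φ : Heap} {M V : Expr} (hE : Eval Ψ M Φ V) {β : ℕ → ℕ → Prop}
    {h : List Code} (K : List Frame) {M' : Expr} {e : Env} (hh : HRel β ∅ (raw Ψ) (lk h))
    (hM : AEq (fun a b => β a (e b)) M M') :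
    ∃ c h' v β', Run c ⟨h, K, .thunk M' e⟩ ⟨h', K, .val v⟩ ∧ (∀ a b, β a b → β' a b) ∧
      HRel β' ∅ (raw Φ) (lk h') ∧ VRel β' (valOf V id) v := by
  induction hE generalizing β h K M' e with
  | value hV =>
    have hV' := hM.isValue hV
    exact ⟨0, h, _, β, run_value hV' _ _ _, fun _ _ h => h, hh, (vrel_valOf hV hV').2 hM⟩
  | app h₁ hx' hxN _ h₂ ih₁ ih₂ =>
    cases hM with
    | app hM₁ hM₂ =>
      obtain ⟨c₁, H₁, v₁, β₁, r₁, m₁, hh₁, hv₁⟩ := ih₁ (.arg _ e :: K) hh hM₁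
      cases hv₁ with
      | clo hN =>
        obtain ⟨β₂, m₂, hh₂, hN₂⟩ := alloc_arg hh₁ hx' hxN (hM₂.mono fun _ _ _ _ => m₁ _ _) hN
        obtain ⟨c₂, H₂, v₂, β₃, r₂, m₃, hh₃, hv₃⟩ := ih₂ K hh₂ hN₂
        exact ⟨_, H₂, v₂, β₃, .head .app (r₁.trans (.head .ret_arg r₂)),
          fun a b h => m₃ a b (m₂ a b (m₁ a b h)), hh₃, hv₃⟩
  | @var Ψ Φ x N V hx hN ih =>
    cases hM with
    | @var _ _ y hxy =>
      obtain ⟨c, d, k₁, k₂, k₃⟩ := hh.rel hxy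
      rw [raw_some hx, Option.some_inj] at k₁
      subst k₁
      have hh₀ := hrel_set_raw hh hxy .bullet (VRel.bul)
      -- A stored value is returned by the machine without evaluation, which fits the derivation
      -- because values evaluate to themselves in an unchanged heap.
      by_cases hNv : IsValue N
      · obtain ⟨rfl, rfl⟩ := hN.of_isValue hNv
        rw [code_of_value hNv] at k₃
        cases k₃ with
        | val k₃ =>
          exact ⟨_, _, _, β, .head (.var k₂) (.single .ret_upd), fun _ _ h => h,
            hrel_set_raw hh₀ hxy hNv k₃, k₃⟩
      · rw [code_of_not_value hNv] at k₃
        cases k₃ with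
        | thunk k₃ =>
          obtain ⟨c₁, H₁, v₁, β₁, r₁, m₁, hh₁, hv₁⟩ := ih (.upd (e y) :: K) hh₀ k₃
          exact ⟨_, _, v₁, β₁, .head (.var k₂) (r₁.trans (.single .ret_upd)), m₁,
            hrel_set_raw hh₁ (m₁ _ _ hxy) hN.isValue hv₁, hv₁⟩
  | letrec ρ h₁ h₂ h₃ _ ih =>
    cases hM with
    | @letrec _ _ D' _ N' L n₁ n₂ p₁ p₂ k₁ k₂ =>
      obtain ⟨β₁, m₁, hh₁, hN₁⟩ := alloc_letrec hh (.letrec L n₁ n₂ p₁ p₂ k₁ k₂) h₁ h₂ h₃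
      obtain ⟨c₂, H₂, v₂, β₂, r₂, m₂, hh₂, hv₂⟩ := ih K hh₁ hN₁
      exact ⟨_, H₂, v₂, β₂, .head .letrec r₂, fun a b h => m₂ a b (m₁ a b h), hh₂, hv₂⟩
  | error_beta _ ih =>
    cases hM with
    | app hM₁ hM₂ =>
      obtain ⟨c₁, H₁, v₁, β₁, r₁, m₁, hh₁, hv₁⟩ := ih (.arg _ e :: K) hh hM₁
      cases hv₁ with
      | bul => exact ⟨_, H₁, _, β₁, .head .app (r₁.trans (.single .ret_arg_bul)), m₁, hh₁, .bul⟩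
  | pair _ _ ih₁ ih₂ =>
    cases hM with
    | pair hM₁ hM₂ =>
      obtain ⟨c₁, H₁, v₁, β₁, r₁, m₁, hh₁, hv₁⟩ := ih₁ (.pairL _ e :: K) hh hM₁
      obtain ⟨c₂, H₂, v₂, β₂, r₂, m₂, hh₂, hv₂⟩ :=
        ih₂ (.pairR v₁ :: K) hh₁ (hM₂.mono fun _ _ _ _ => m₁ _ _)
      exact ⟨_, H₂, _, β₂, .head .pair (r₁.trans (.head .ret_pairL (r₂.trans (.single .ret_pairR)))),
        fun a b h => m₂ a b (m₁ a b h), hh₂, .pr (hv₁.mono m₂) hv₂⟩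
  | prj i V _ ih =>
    cases hM with
    | prj hM =>
      obtain ⟨c₁, H₁, v₁, β₁, r₁, m₁, hh₁, hv₁⟩ := ih (.prj i :: K) hh hM
      cases hv₁ with
      | @pr _ _ w₀ w₁ k₀ k₁ =>
        refine ⟨_, H₁, _, β₁, .head .prj (r₁.trans (.single (.ret_prj (v := ![w₀, w₁])))), m₁,
          hh₁, ?_⟩
        fin_cases i
        exacts [k₀, k₁]

/-- `β` injects the domain into the positions of a list. -/
theorem finite_dom {β : ℕ → ℕ → Prop} {Ψ : Heap} {h : List Code}
    (hh : HRel β ∅ (raw Ψ) (lk h)) : {x | Ψ x ≠ none}.Finite := by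
  have hex : ∀ x, ∃ l, Ψ x ≠ none → β x l := by
    intro x
    by_cases hx : Ψ x = none
    · exact ⟨0, fun h => absurd hx h⟩
    · obtain ⟨M, hM⟩ := Option.ne_none_iff_exists'.1 hx
      obtain ⟨l, hl⟩ := hh.totl (raw_some hM)
      exact ⟨l, fun _ => hl⟩
  choose f hf using hex
  refine Set.Finite.of_injOn (f := f) (t := {l | l < h.length}) ?_ ?_ (Set.finite_lt_nat _)
  · intro x hx
    obtain ⟨_, _, -, k, -⟩ := hh.rel (hf x hx)
    exact lk_lt k
  · intro x hx y hy hxy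
    exact (hh.bij (hf x hx) (hf y hy)).2 hxy

theorem infinite_fresh {Ψ : Heap} (hΨ : {x | Ψ x ≠ none}.Finite) (S : Finset Var) :
    {x | Ψ.Fresh x ∧ x ∉ S}.Infinite := by
  have hfin : ({x | Ψ x ≠ none} ∪ (⋃ y ∈ {x | Ψ x ≠ none},
      (((Ψ y).elim ∅ Expr.vars : Finset Var) : Set Var)) ∪ (S : Set Var)).Finite :=
    (hΨ.union (hΨ.biUnion fun _ _ => Finset.finite_toSet _)).union S.finite_toSet
  refine hfin.infinite_compl.mono fun x hx => ?_
  simp only [Set.mem_compl_iff, Set.mem_union, Set.mem_iUnion, Set.mem_ofPred_eq, not_or,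
    not_exists, not_not] at hx
  refine ⟨⟨hx.1.1, fun y M hM hxM => ?_⟩, fun h => hx.2 h⟩
  exact hx.1.2 y (by simp [hM]) (by simpa [hM] using hxM)

/-- A halting run of the machine begins with an evaluation of the focus in the natural
semantics. -/
theorem eval_of_steps {H : List Code} {w : Val} (n : ℕ) : ∀ {c : ℕ} {h : List Code}
    {K : List Frame} {M' : Expr} {e : Env}, Steps n c ⟨h, K, .thunk M' e⟩ ⟨H, [], .val w⟩ →
    ∀ {β : ℕ → ℕ → Prop} {Ψ : Heap} {M : Expr}, HRel β ∅ (raw Ψ) (lk h) →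
    AEq (fun a b => β a (e b)) M M' → ∃ Φ V β' h' v n' c', n' < n ∧
      Steps n' c' ⟨h', K, .val v⟩ ⟨H, [], .val w⟩ ∧ Eval Ψ M Φ V ∧ (∀ a b, β a b → β' a b) ∧
      HRel β' ∅ (raw Φ) (lk h') ∧ VRel β' (valOf V id) v := by
  induction n using Nat.strong_induction_on with
  | _ n ih =>
  intro c h K M' e hs β Ψ M hh hM
  cases hs with
  | @head n c d _ t _ hs hr =>
  cases hs with
  | @var _ _ y _ c' hy =>
    cases hM with
    | @var _ x _ hxy =>
      obtain ⟨_, d', k₁, k₂, k₃⟩ := hh.rel hxy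
      obtain rfl : c' = d' := by simpa [lk, hy] using k₂
      obtain ⟨N, hN, rfl⟩ := exists_of_raw k₁
      have hh₀ := hrel_set_raw hh hxy .bullet (VRel.bul)
      by_cases hNv : IsValue N
      · rw [code_of_value hNv] at k₃
        cases k₃ with
        | val k₃ =>
          cases hr with
          | head hs hr =>
            cases hs with
            | ret_upd =>
              exact ⟨_, N, β, _, _, _, _, by omega, hr, .var hN (.value hNv), fun _ _ h => h,
                hrel_set_raw hh₀ hxy hNv k₃, k₃⟩
      · rw [code_of_not_value hNv] at k₃
        cases k₃ with
        | thunk k₃ =>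
          -- The run reaches a halted state with empty stack, so it must return to the update frame;
          -- what remains from there is shorter.
          obtain ⟨Φ₁, V₁, β₁, h₁, v₁, n₁, c₁, l₁, r₁, e₁, m₁, hh₁, hv₁⟩ :=
            ih n (by omega) hr hh₀ k₃
          cases r₁ with
          | head hs hr =>
            cases hs with
            | ret_upd =>
              exact ⟨_, V₁, β₁, _, _, _, _, by omega, hr, .var hN e₁, m₁,
                hrel_set_raw hh₁ (m₁ _ _ hxy) e₁.isValue hv₁, hv₁⟩
  | lam =>
    cases hM with
    | lam hM =>
      exact ⟨Ψ, _, β, _, _, _, _, by omega, hr, .value (.lam _ _), fun _ _ h => h, hh, .clo hM⟩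
  | bullet =>
    cases hM with
    | bullet =>
      exact ⟨Ψ, _, β, _, _, _, _, by omega, hr, .value .bullet, fun _ _ h => h, hh, .bul⟩
  | app =>
    cases hM with
    | app hM₁ hM₂ =>
      obtain ⟨Φ₁, V₁, β₁, h₁, v₁, n₁, c₁, l₁, r₁, e₁, m₁, hh₁, hv₁⟩ := ih n (by omega) hr hh hM₁
      have hV₁ := e₁.isValue
      cases r₁ with
      | head hs hr =>
        cases hs with
        | ret_arg =>
          cases hV₁ with
          | bullet => cases hv₁
          | pair => cases hv₁
          | lam x N =>
            cases hv₁ with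
            | clo hN =>
              obtain ⟨x', hx', hxS⟩ := (infinite_fresh (finite_dom hh₁)
                ((Expr.lam x N).vars ∪ Expr.vars _)).nonempty
              rw [Finset.mem_union, not_or] at hxS
              obtain ⟨β₂, m₂, hh₂, hN₂⟩ :=
                alloc_arg hh₁ hx' hxS.1 (hM₂.mono fun _ _ _ _ => m₁ _ _) hN
              obtain ⟨Φ₃, V₃, β₃, h₃, v₃, n₃, c₃, l₃, r₃, e₃, m₃, hh₃, hv₃⟩ :=
                ih _ (by omega) hr hh₂ hN₂
              exact ⟨Φ₃, V₃, β₃, h₃, v₃, n₃, c₃, by omega, r₃, .app e₁ hx' hxS.1 hxS.2 e₃,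
                fun a b h => m₃ a b (m₂ a b (m₁ a b h)), hh₃, hv₃⟩
        | ret_arg_bul =>
          cases hV₁ with
          | lam => cases hv₁
          | pair => cases hv₁
          | bullet =>
            exact ⟨Φ₁, _, β₁, h₁, _, _, _, by omega, hr, .error_beta e₁, m₁, hh₁, .bul⟩
  | letrec =>
    cases hM with
    | @letrec _ D _ N _ L n₁ n₂ p₁ p₂ k₁ k₂ =>
      have hinf := infinite_fresh (finite_dom hh) (Expr.letrec D N).vars
      -- There are infinitely many fresh variables; an injective enumeration makes the chosen names
      -- pairwise distinct.
      let ι := hinf.natEmbedding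
      let ρ : Var → Var := fun y => if y ∈ names D then (ι y : Var) else y
      have hρ : ∀ y ∈ names D, ρ y = (ι y : Var) := fun y hy => if_pos hy
      have h₁ : ∀ y, y ∉ names D → ρ y = y := fun y hy => if_neg hy
      have h₂ : Set.InjOn ρ {y | y ∈ names D} := by
        intro x hx y hy hxy
        rw [hρ x hx, hρ y hy] at hxy
        exact ι.injective (Subtype.ext hxy)
      have h₃ : ∀ y ∈ names D, Ψ.Fresh (ρ y) ∧ ρ y ∉ (Expr.letrec D N).vars := by
        intro y hy
        rw [hρ y hy]; exact (ι y).2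
      obtain ⟨β₁, m₁, hh₁, hN₁⟩ := alloc_letrec hh (.letrec L n₁ n₂ p₁ p₂ k₁ k₂) h₁ h₂ h₃
      obtain ⟨Φ₃, V₃, β₃, h₃', v₃, n₃, c₃, l₃, r₃, e₃, m₃, hh₃, hv₃⟩ :=
        ih _ (by omega) hr hh₁ hN₁
      exact ⟨Φ₃, V₃, β₃, h₃', v₃, n₃, c₃, by omega, r₃, .letrec ρ h₁ h₂ h₃ e₃,
        fun a b h => m₃ a b (m₁ a b h), hh₃, hv₃⟩
  | pair =>
    cases hM with
    | pair hM₁ hM₂ =>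
      obtain ⟨Φ₁, V₁, β₁, h₁, v₁, n₁, c₁, l₁, r₁, e₁, m₁, hh₁, hv₁⟩ := ih n (by omega) hr hh hM₁
      cases r₁ with
      | head hs hr =>
        cases hs with
        | ret_pairL =>
          obtain ⟨Φ₂, V₂, β₂, h₂, v₂, n₂, c₂, l₂, r₂, e₂, m₂, hh₂, hv₂⟩ :=
            ih _ (by omega) hr hh₁ (hM₂.mono fun _ _ _ _ => m₁ _ _)
          cases r₂ with
          | head hs hr =>
            cases hs with
            | ret_pairR =>
              exact ⟨Φ₂, _, β₂, _, _, _, _, by omega, hr, .pair e₁ e₂,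
                fun a b h => m₂ a b (m₁ a b h), hh₂, .pr (hv₁.mono m₂) hv₂⟩
  | @prj _ _ i _ _ =>
    cases hM with
    | prj hM =>
      obtain ⟨Φ₁, V₁, β₁, h₁, v₁, n₁, c₁, l₁, r₁, e₁, m₁, hh₁, hv₁⟩ := ih n (by omega) hr hh hM
      have hV₁ := e₁.isValue
      -- As for determinism, the state of the projection rule mentions `v 0` and `v 1`, so the
      -- equation between states is handled by hand.
      generalize hst : (⟨h₁, .prj i :: K, .val v₁⟩ : State) = st at r₁
      cases r₁ with
      | refl => cases hst
      | head hs hr =>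
        cases hs with
        | @ret_prj _ _ i' v =>
          obtain ⟨rfl, hF, hv⟩ := State.mk.inj hst
          obtain rfl := Frame.prj.inj (List.cons.inj hF).1
          obtain rfl := (List.cons.inj hF).2
          obtain rfl := Code.val.inj hv
          cases hV₁ with
          | lam => cases hv₁
          | bullet => cases hv₁
          | @pair V₀ V₁ q₀ q₁ =>
            have hpr : VRel β₁ (.pr (valOf V₀ id) (valOf V₁ id)) (.pr (v 0) (v 1)) := hv₁
            have hpr' : VRel β₁ (valOf V₀ id) (v 0) ∧ VRel β₁ (valOf V₁ id) (v 1) := by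
              generalize v 0 = w₀ at hpr
              generalize v 1 = w₁ at hpr
              cases hpr with | pr a b => exact ⟨a, b⟩
            refine ⟨Φ₁, ![V₀, V₁] i, β₁, _, _, _, _, ?_, hr, .prj i ![V₀, V₁] e₁, m₁, hh₁, ?_⟩
            · omega
            fin_cases i
            exacts [hpr'.1, hpr'.2]
        | _ => cases hst

/-! ### Scope -/

/-- `M` is well-formed, and its free variables are in `S`. -/
def Sc (S : Set Var) (M : Expr) : Prop := M.WF ∧ ∀ x ∈ M.fv, x ∈ S

theorem Sc.mono {S T : Set Var} {M : Expr} (h : Sc S M) (hS : S ⊆ T) : Sc T M :=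
  ⟨h.1, fun x hx => hS (h.2 x hx)⟩

theorem sc_lam {S : Set Var} {x : Var} {M : Expr} :
    Sc S (.lam x M) ↔ Sc (insert x S) M := by
  simp only [Sc, Expr.WF, Expr.fv, Finset.mem_erase, Set.mem_insert_iff]
  refine and_congr_right fun _ => forall_congr' fun y => ?_
  tauto

theorem sc_app {S : Set Var} {M N : Expr} : Sc S (.app M N) ↔ Sc S M ∧ Sc S N := by
  simp only [Sc, Expr.WF, Expr.fv, Finset.mem_union, or_imp, forall_and]
  tauto

theorem sc_pair {S : Set Var} {M N : Expr} : Sc S (.pair M N) ↔ Sc S M ∧ Sc S N := by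
  simp only [Sc, Expr.WF, Expr.fv, Finset.mem_union, or_imp, forall_and]
  tauto

theorem sc_prj {S : Set Var} {i : Fin 2} {M : Expr} : Sc S (.prj i M) ↔ Sc S M := by
  simp only [Sc, Expr.WF, Expr.fv]

theorem sc_bullet {S : Set Var} : Sc S .bullet := by
  simp [Sc, Expr.WF, Expr.fv]

theorem sc_letrec {S : Set Var} {D : Defs} {N : Expr} :
    Sc S (.letrec D N) ↔ (names D).Nodup ∧ (∀ p ∈ D, Sc (S ∪ {x | x ∈ names D}) p.2) ∧
      Sc (S ∪ {x | x ∈ names D}) N := by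
  simp only [Sc, Expr.WF, wfRhs_iff, mem_fv_letrec, Set.mem_union, Set.mem_ofPred_eq]
  constructor
  · rintro ⟨⟨h₁, h₂, h₃⟩, h₄⟩
    refine ⟨h₁, fun p hp => ⟨h₂ p hp, fun x hx => ?_⟩, h₃, fun x hx => ?_⟩
    · by_cases hn : x ∈ names D
      · exact .inr hn
      · exact .inl (h₄ x ⟨.inl ⟨p, hp, hx⟩, hn⟩)
    · by_cases hn : x ∈ names D
      · exact .inr hn
      · exact .inl (h₄ x ⟨.inr hx, hn⟩)
  · rintro ⟨h₁, h₂, h₃, h₄⟩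
    refine ⟨⟨h₁, fun p hp => (h₂ p hp).1, h₃⟩, ?_⟩
    rintro x ⟨⟨p, hp, hx⟩ | hx, hn⟩
    · exact ((h₂ p hp).2 x hx).resolve_right hn
    · exact (h₄ x hx).resolve_right hn

/-- `T` is the scope at the hole: `S` together with what the context binds there. Anything in that
scope may replace `M`. -/
theorem sc_plug : (∀ E : Ctx, ∀ S M, Sc S (E.plug M) →
      ∃ T, S ⊆ T ∧ Sc T M ∧ ∀ N, Sc T N → Sc S (E.plug N)) ∧
    ∀ Δ : Dep, ∀ S M, (∀ p ∈ Δ.plug M, Sc S p.2) →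
      ∃ T, S ⊆ T ∧ Sc T M ∧ ∀ N, Sc T N → ∀ p ∈ Δ.plug N, Sc S p.2 := by
  refine ctx_dep_ind ?_ ?_ ?_ ?_ ?_ ?_ ?_ ?_ ?_ ?_
  · intro S M h
    exact ⟨S, subset_rfl, h, fun _ h => h⟩
  · intro E N ih S M h
    rw [Ctx.plug, sc_app] at h
    obtain ⟨T, h₁, h₂, h₃⟩ := ih S M h.1
    exact ⟨T, h₁, h₂, fun P hP => sc_app.2 ⟨h₃ P hP, h.2⟩⟩
  · intro D E ih S M h
    rw [Ctx.plug, sc_letrec] at h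
    obtain ⟨T, h₁, h₂, h₃⟩ := ih _ M h.2.2
    exact ⟨T, Set.subset_union_left.trans h₁, h₂,
      fun P hP => sc_letrec.2 ⟨h.1, h.2.1, h₃ P hP⟩⟩
  · intro x E D E' ih _ S M h
    rw [Ctx.plug, sc_letrec] at h
    obtain ⟨T, h₁, h₂, h₃⟩ := ih _ M (h.2.1 _ List.mem_cons_self)
    refine ⟨T, Set.subset_union_left.trans h₁, h₂, fun P hP => sc_letrec.2 ⟨h.1, ?_, h.2.2⟩⟩
    intro p hp
    rcases List.mem_cons.1 hp with rfl | hp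
    · exact h₃ P hP
    · exact h.2.1 p (List.mem_cons_of_mem _ hp)
  · intro x E Δ D E' ih _ _ S M h
    rw [Ctx.plug, sc_letrec] at h
    obtain ⟨T, h₁, h₂, h₃⟩ := ih _ M (h.2.1 _ List.mem_cons_self)
    refine ⟨T, Set.subset_union_left.trans h₁, h₂, fun P hP => sc_letrec.2 ⟨h.1, ?_, h.2.2⟩⟩
    intro p hp
    rcases List.mem_cons.1 hp with rfl | hp
    · exact h₃ P hP
    · exact h.2.1 p (List.mem_cons_of_mem _ hp)
  · intro E N ih S M h
    rw [Ctx.plug, sc_pair] at h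
    obtain ⟨T, h₁, h₂, h₃⟩ := ih S M h.1
    exact ⟨T, h₁, h₂, fun P hP => sc_pair.2 ⟨h₃ P hP, h.2⟩⟩
  · intro V hV E ih S M h
    rw [Ctx.plug, sc_pair] at h
    obtain ⟨T, h₁, h₂, h₃⟩ := ih S M h.2
    exact ⟨T, h₁, h₂, fun P hP => sc_pair.2 ⟨h.1, h₃ P hP⟩⟩
  · intro i E ih S M h
    rw [Ctx.plug, sc_prj] at h
    obtain ⟨T, h₁, h₂, h₃⟩ := ih S M h
    exact ⟨T, h₁, h₂, fun P hP => sc_prj.2 (h₃ P hP)⟩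
  · intro x E ih S M h
    simp only [Dep.plug, List.forall_mem_singleton] at h ⊢
    exact ih S M h
  · intro Δ x E _ ih S M h
    simp only [Dep.plug, List.mem_append, or_imp, forall_and, List.mem_singleton,
      forall_eq] at h ⊢
    obtain ⟨T, h₁, h₂, h₃⟩ := ih S M h.2
    exact ⟨T, h₁, h₂, fun _ _ => h.1, h₃⟩

theorem sc_dep_block {S : Set Var} {Δ : Dep} {M N P : Expr} {D : Defs}
    (h : Sc S (.letrec (Δ.plug M ++ D) P))
    (hN : ∀ T, (S ∪ {x | x ∈ Δ.names ++ names D}) ⊆ T → Sc T M → Sc T N) :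
    Sc S (.letrec (Δ.plug N ++ D) P) := by
  have e : ∀ Q, names (Δ.plug Q ++ D) = Δ.names ++ names D := fun Q => by
    rw [← Dep.names_plug Δ Q]; simp
  rw [sc_letrec, e] at h ⊢
  refine ⟨h.1, fun p hp => ?_, h.2.2⟩
  rcases List.mem_append.1 hp with hp | hp
  · obtain ⟨T, h₁, h₂, h₃⟩ := sc_plug.2 Δ _ M fun p hp => h.2.1 p (List.mem_append_left _ hp)
    exact h₃ N (hN T h₁ h₂) p hp
  · exact h.2.1 p (List.mem_append_right _ hp)

/-- Distinct binders keep the names of the merged block distinct, and every right-hand side sees at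
least the variables that it saw before. -/
theorem sc_assoc {S : Set Var} {x : Var} {A P : Expr} {D D' : Defs}
    (hn : (bindersDefs ((x, .letrec D A) :: D')).Nodup)
    (h : Sc S (.letrec ((x, .letrec D A) :: D') P)) :
    Sc S (.letrec (D ++ (x, A) :: D') P) := by
  have hnd : (names (D ++ (x, A) :: D')).Nodup := by
    have h₁ : (names (D ++ (x, A) :: D')).Perm (x :: (names D ++ names D')) := by
      simp [names, List.perm_middle]
    refine h₁.nodup_iff.2 (hn.sublist ?_)
    simp only [bindersDefs, Expr.binders]
    exact ((names_sublist_binders D).trans (List.sublist_append_left _ _)).append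
      (names_sublist_binders D') |>.cons_cons x
  rw [sc_letrec] at h ⊢
  have hA := h.2.1 _ List.mem_cons_self
  rw [sc_letrec] at hA
  have e₁ : S ∪ {y | y ∈ names ((x, Expr.letrec D A) :: D')} ∪ {y | y ∈ names D} ⊆
      S ∪ {y | y ∈ names (D ++ (x, A) :: D')} := by
    rintro y ((hy | hy) | hy)
    · exact .inl hy
    · right; simp only [names, List.map_cons, List.map_append, Set.mem_ofPred_eq, List.mem_cons,
        List.mem_append] at hy ⊢; tauto
    · right; simp only [names, List.map_cons, List.map_append, Set.mem_ofPred_eq, List.mem_cons,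
        List.mem_append] at hy ⊢; tauto
  have e₂ := Set.subset_union_left.trans e₁
  refine ⟨hnd, fun p hp => ?_, h.2.2.mono e₂⟩
  rcases List.mem_append.1 hp with hp | hp
  · exact (hA.2.1 p hp).mono e₁
  · rcases List.mem_cons.1 hp with rfl | hp
    · exact hA.2.2.mono e₁
    · exact (h.2.1 p (List.mem_cons_of_mem _ hp)).mono e₂

theorem Contract.sc {S : Set Var} {M N : Expr} (hMN : Contract M N) (hn : M.binders.Nodup)
    (h : Sc S M) : Sc S N := by
  cases hMN with
  | beta_need x M N =>
    rw [sc_app, sc_lam] at h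
    rw [sc_letrec]
    refine ⟨by simp, ?_, h.1.mono ?_⟩
    · intro p hp
      obtain rfl := List.mem_singleton.1 hp
      exact h.2.mono Set.subset_union_left
    · rintro y (rfl | hy)
      · right; simp
      · exact .inl hy
  | lift D A N hA =>
    rw [sc_app, sc_letrec] at h
    rw [sc_letrec, sc_app]
    exact ⟨h.1.1, h.1.2.1, h.1.2.2, h.2.mono Set.subset_union_left⟩
  | deref x V D E hV =>
    rw [sc_letrec] at h ⊢
    obtain ⟨T, h₁, -, h₃⟩ := sc_plug.1 E _ _ h.2.2
    exact ⟨h.1, h.2.1, h₃ V ((h.2.1 _ List.mem_cons_self).mono h₁)⟩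
  | deref_env Δ x' V D E hV =>
    refine sc_dep_block h fun T hT _ => ?_
    rw [sc_letrec] at h
    refine (h.2.1 (x', V) (by simp)).mono (subset_trans ?_ hT)
    rw [← Dep.names_plug Δ (.var x')]; simp [names]
  | assoc x D A D' E hA =>
    exact sc_assoc (by simp only [Expr.binders, List.nodup_append'] at hn; exact hn.1) h
  | assoc_env x' D A Δ D' E hA =>
    exact sc_assoc (by simp only [Expr.binders, List.nodup_append'] at hn; exact hn.1) h
  | error Δ D E => exact sc_dep_block h fun T hT _ => sc_bullet
  | error_env Δ' Δ D E =>
    rw [List.append_assoc] at h ⊢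
    exact sc_dep_block h fun T hT _ => sc_bullet
  | error_beta M => exact sc_bullet
  | prj i V h₀ h₁ =>
    rw [sc_prj, sc_pair] at h
    match i with
    | 0 => exact h.1
    | 1 => exact h.2
  | lift_prj i D A hA =>
    rw [sc_prj, sc_letrec] at h
    rw [sc_letrec, sc_prj]
    exact h
  | lift_pair₁ D A M hA =>
    rw [sc_pair, sc_letrec] at h
    rw [sc_letrec, sc_pair]
    exact ⟨h.1.1, h.1.2.1, h.1.2.2, h.2.mono Set.subset_union_left⟩
  | lift_pair₂ V D A hV hA =>
    rw [sc_pair, sc_letrec] at h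
    rw [sc_letrec, sc_pair]
    exact ⟨h.2.1, h.2.2.1, h.1.mono Set.subset_union_left, h.2.2.2⟩

theorem isProgram_iff {M : Expr} : M.IsProgram ↔ Sc ∅ M := by
  simp [Expr.IsProgram, Sc, Finset.eq_empty_iff_forall_notMem]

/-! ### Canonical subexpressions -/

theorem Expr.Canonical.app {M N : Expr} (h : (Expr.app M N).Canonical) :
    M.Canonical ∧ N.Canonical := by
  simp only [Expr.Canonical, Expr.binders, Expr.fv, List.nodup_append', List.mem_append,
    Finset.mem_union, not_or] at h ⊢
  exact ⟨⟨h.1.1, fun x hx => (h.2 x (.inl hx)).1⟩, h.1.2.1, fun x hx => (h.2 x (.inr hx)).2⟩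

theorem Expr.Canonical.pair {M N : Expr} (h : (Expr.pair M N).Canonical) :
    M.Canonical ∧ N.Canonical := Expr.Canonical.app (by
  simpa only [Expr.Canonical, Expr.binders, Expr.fv] using h)

theorem Expr.Canonical.prj {i : Fin 2} {M : Expr} (h : (Expr.prj i M).Canonical) :
    M.Canonical := by
  simpa only [Expr.Canonical, Expr.binders, Expr.fv] using h

theorem Expr.Canonical.body {D : Defs} {N : Expr} (h : (Expr.letrec D N).Canonical) :
    N.Canonical := by
  have hn := h.1
  simp only [Expr.binders, List.nodup_append'] at hn
  refine ⟨hn.2.1, fun x hx => (h.block_fv (y := x) ?_ ?_).2⟩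
  · simp [Expr.binders, hx]
  · exact fun hx' => hn.2.2 ((names_sublist_binders D).subset hx') hx

theorem Expr.Canonical.rhs {D : Defs} {N : Expr} (h : (Expr.letrec D N).Canonical)
    {p : Var × Expr} (hp : p ∈ D) : p.2.Canonical := by
  have hn := h.1
  simp only [Expr.binders, List.nodup_append'] at hn
  refine ⟨?_, fun x hx => (h.block_fv (y := x) ?_ ?_).1 p hp⟩
  · have := hn.1
    rw [bindersDefs_eq, List.nodup_flatMap] at this
    exact (List.nodup_cons.1 (this.1 p hp)).2
  · simp [Expr.binders, mem_bindersDefs hp hx]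
  · exact not_mem_names_of_binders hn.1 hp hx

theorem Expr.Canonical.of_plug {E : Ctx} {M : Expr} (h : (E.plug M).Canonical) :
    M.Canonical := by
  match E with
  | .hole => exact h
  | .app E N => exact Expr.Canonical.of_plug (E := E) h.app.1
  | .letBody D E => exact Expr.Canonical.of_plug (E := E) h.body
  | .letBind x E D E' =>
    exact Expr.Canonical.of_plug (E := E) (h.rhs (p := (x, E.plug M)) List.mem_cons_self)
  | .letDep x E Δ D E' =>
    exact Expr.Canonical.of_plug (E := E) (h.rhs (p := (x, E.plug M)) List.mem_cons_self)
  | .pairL E N => exact Expr.Canonical.of_plug (E := E) h.pair.1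
  | .pairR V hV E => exact Expr.Canonical.of_plug (E := E) h.pair.2
  | .prj i E => exact Expr.Canonical.of_plug (E := E) h.prj

/-! ### Reduction preserves results -/

/-- The initial state for a program. -/
def init (M : Expr) : State := ⟨[], [], .thunk M fun _ => 0⟩

theorem sRel_init {M N : Expr} (h : AlphaEq M N) (hM : M.fv = ∅) :
    SRel (fun _ _ => False) ∅ (init M) (init N) where
  heap := ⟨nofun, nofun, fun h => by simp [lk, init] at h, fun h => by simp [lk, init] at h,
    fun h => by simp at h, fun h => by simp at h⟩
  stack := .nil
  focus := .thunk ((alphaEq_iff.1 h).mono fun x hx => by simp [hM] at hx)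

theorem Contract.not_isValue {M N : Expr} (h : Contract M N) : ¬ IsValue M := by
  intro hV
  cases h with
  | lift_pair₁ => cases hV with | pair h _ => cases h
  | lift_pair₂ => cases hV with | pair _ h => cases h
  | _ => cases hV

/-- Loading `E` leads to the same heap, stack and environment for redex and contractum, where
`sim_contract` applies. A redex is not a value, so its state is reached exactly and is closed; the
contractum may be a value, for which joining suffices. -/
theorem Sim.init_contract {E : Ctx} {M N : Expr} (hMN : Contract M N)
    (hcan : (E.plug M).Canonical) (hp : (E.plug M).IsProgram) :
    Sim 1 (init (E.plug M)) (init (E.plug N)) := by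
  obtain ⟨t, K, e, c, -, hc⟩ := loads hcan.1 (fun _ => 0) 0 0
  have j₁ := hc M [] [] rfl rfl
  have j₂ := hc N [] [] rfl rfl
  have hcl : Closed (init (E.plug M)) := ⟨_, sRel_init (.refl hp.1) hp.2⟩
  have hs := sim_contract hMN hcan.of_plug (hcl.run (j₁.run hMN.not_isValue))
  constructor
  · intro k h v hk
    obtain ⟨k₁, rfl, h₁⟩ := j₁.halts hk
    obtain ⟨k₂, h₂, v₂, β, l₁, l₂, l₃⟩ := hs.1 _ _ _ h₁
    exact ⟨c + k₂, h₂, v₂, β, j₂.halts_back l₁, by omega, l₃⟩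
  · intro k h v hk
    obtain ⟨k₁, rfl, h₁⟩ := j₂.halts hk
    obtain ⟨k₂, h₂, v₂, β, l₁, l₃⟩ := hs.2 _ _ _ h₁
    exact ⟨c + k₂, h₂, v₂, β, j₁.halts_back l₁, l₃⟩

theorem AlphaEq.isProgram {M N : Expr} (h : AlphaEq M N) (hM : M.IsProgram) : N.IsProgram :=
  ⟨(alphaEq_iff.1 h.symm).wf, (alphaEq_iff.1 h).fv_eq ▸ hM.2⟩

theorem Contract.isProgram_plug {E : Ctx} {M N : Expr} (hMN : Contract M N)
    (hcan : (E.plug M).Canonical) (hp : (E.plug M).IsProgram) : (E.plug N).IsProgram := by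
  rw [isProgram_iff] at hp ⊢
  obtain ⟨T, -, h₂, h₃⟩ := sc_plug.1 E _ _ hp
  exact h₃ N (hMN.sc hcan.of_plug.1 h₂)

theorem Step.sim {M N : Expr} (h : Step M N) (hM : M.IsProgram) :
    N.IsProgram ∧ Sim 1 (init M) (init N) := by
  obtain ⟨E, M', N', hc, hcan, h₁, h₂⟩ := h
  have hp := h₁.isProgram hM
  have hq := hc.isProgram_plug hcan hp
  exact ⟨h₂.isProgram hq, ((Sim.of_sRel (sRel_init h₁ hM.2)).trans
    (Sim.init_contract hc hcan hp)).trans (Sim.of_sRel (sRel_init h₂ hq.2))⟩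

/-! ### Canonical representatives -/

theorem exists_fresh_list (S : Finset Var) (n : ℕ) :
    ∃ l : List Var, l.length = n ∧ l.Nodup ∧ ∀ x ∈ l, x ∉ S := by
  obtain ⟨t, h₁, h₂⟩ := (Set.Finite.infinite_compl S.finite_toSet).exists_subset_card_eq n
  exact ⟨t.toList, by simp [h₂], t.nodup_toList, fun x hx => by
    simpa using h₁ (by simpa using hx)⟩

/-- A representative whose binders are pairwise distinct and not in `S`. -/
def HasRep (M : Expr) : Prop :=
  ∀ (f : Var → Var) (S : Finset Var), (∀ x ∈ M.fv, f x ∈ S) →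
    ∃ M', AEq (fun x y => y = f x) M M' ∧ M'.binders.Nodup ∧ ∀ x ∈ M'.binders, x ∉ S

/-- The second representative also avoids the binders already used by the first. -/
theorem HasRep.two {M N : Expr} (hM : HasRep M) (hN : HasRep N) (f : Var → Var) (S : Finset Var)
    (hM' : ∀ x ∈ M.fv, f x ∈ S) (hN' : ∀ x ∈ N.fv, f x ∈ S) :
    ∃ M' N', AEq (fun x y => y = f x) M M' ∧ AEq (fun x y => y = f x) N N' ∧
      (M'.binders ++ N'.binders).Nodup ∧ ∀ x ∈ M'.binders ++ N'.binders, x ∉ S := by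
  obtain ⟨M', h₁, h₂, h₃⟩ := hM f S hM'
  obtain ⟨N', k₁, k₂, k₃⟩ := hN f (S ∪ M'.binders.toFinset) fun x hx => by simp [hN' x hx]
  refine ⟨M', N', h₁, k₁, List.nodup_append'.2 ⟨h₂, k₂, fun x hx hx' => ?_⟩, ?_⟩
  · exact k₃ x hx' (by simp [hx])
  · intro x hx
    rcases List.mem_append.1 hx with hx | hx
    · exact h₃ x hx
    · exact fun h => k₃ x hx (by simp [h])

/-- The new names `l` of the block are fixed in advance and counted in `S`, so the binders inside
the right-hand sides avoid them. -/
theorem HasRep.block {D : Defs} (hD : ∀ p ∈ D, HasRep p.2) (f : Var → Var) (S : Finset Var)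
    (h : ∀ p ∈ D, ∀ x ∈ p.2.fv, f x ∈ S) (l : List Var) (hl : l.length = D.length) (hn : l.Nodup)
    (hlS : ∀ x ∈ l, x ∈ S) :
    ∃ L : List ((Var × Expr) × (Var × Expr)), L.map Prod.fst = D ∧ names (L.map Prod.snd) = l ∧
      (∀ q ∈ L, AEq (fun x y => y = f x) q.1.2 q.2.2) ∧ (bindersDefs (L.map Prod.snd)).Nodup ∧
      ∀ x ∈ bindersDefs (L.map Prod.snd), x ∈ l ∨ x ∉ S := by
  induction D generalizing S l with
  | nil => exact ⟨[], rfl, by simpa using (List.length_eq_zero_iff.1 hl).symm, by simp,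
      by simp [bindersDefs], by simp [bindersDefs]⟩
  | cons p D ih =>
    obtain ⟨x, M⟩ := p
    match l, hl with
    | y :: l, hl =>
    obtain ⟨M', h₁, h₂, h₃⟩ := hD (x, M) (by simp) f S (h (x, M) (by simp))
    obtain ⟨L, k₁, k₂, k₃, k₄, k₅⟩ := ih (fun p hp => hD p (by simp [hp]))
      (S ∪ M'.binders.toFinset) (fun p hp x hx => by simp [h p (by simp [hp]) x hx]) l
      (by simpa using hl) (List.nodup_cons.1 hn).2 (fun x hx => by simp [hlS x (by simp [hx])])
    refine ⟨((x, M), (y, M')) :: L, by simp [k₁], by simpa using k₂, ?_, ?_, ?_⟩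
    · intro q hq
      rcases List.mem_cons.1 hq with rfl | hq
      · exact h₁
      · exact k₃ q hq
    · simp only [List.map_cons, bindersDefs, List.nodup_cons, List.nodup_append', List.mem_append,
        not_or]
      refine ⟨⟨fun h => h₃ y h (hlS y (by simp)), fun h => ?_⟩, h₂, k₄, fun z hz hz' => ?_⟩
      · rcases k₅ y h with h | h
        · exact (List.nodup_cons.1 hn).1 h
        · exact h (by simp [hlS y (by simp)])
      · rcases k₅ z hz' with h | h
        · exact h₃ z hz (hlS z (by simp [h]))
        · exact h (by simp [hz])
    · intro z hz
      simp only [List.map_cons, bindersDefs, List.mem_cons, List.mem_append] at hz ⊢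
      rcases hz with hz | hz | hz
      · exact .inl (.inl hz)
      · exact .inr (h₃ z hz)
      · exact (k₅ z hz).imp .inr fun h h' => h (by simp [h'])

/-- The map `f` records the new names given to enclosing binders. It must land in `S` on the free
variables, so that binders chosen outside `S` capture nothing. -/
theorem hasRep {M : Expr} (hM : M.WF) : HasRep M := by
  induction M using Expr.ind with
  | var x =>
    intro f S h
    exact ⟨.var (f x), .var rfl, by simp [Expr.binders], by simp [Expr.binders]⟩
  | lam x M ih =>
    intro f S h
    obtain ⟨y, hy⟩ := Infinite.exists_notMem_finset S
    obtain ⟨M', h₁, h₂, h₃⟩ := ih hM (Function.update f x y) (insert y S) (by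
      intro z hz
      by_cases e : z = x
      · subst e; simp
      · rw [Function.update_of_ne e]
        exact Finset.mem_insert_of_mem (h z (by simp [Expr.fv, hz, e])))
    refine ⟨.lam y M', .lam (h₁.mono ?_), ?_, ?_⟩
    · intro z hz w _ hw
      by_cases e : z = x
      · subst e; left; simpa using hw
      · rw [Function.update_of_ne e] at hw
        refine .inr ⟨by simpa using Ne.symm e, ?_, hw⟩
        rintro p hp rfl
        obtain rfl := List.mem_singleton.1 hp
        simp only at hw
        exact hy (hw ▸ h z (by simp [Expr.fv, hz, e]))
    · exact List.nodup_cons.2 ⟨fun h => h₃ y h (by simp), h₂⟩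
    · intro z hz
      rcases List.mem_cons.1 hz with rfl | hz
      · exact hy
      · exact fun h => h₃ z hz (by simp [h])
  | app M N ihM ihN =>
    intro f S h
    obtain ⟨M', N', h₁, h₂, h₃, h₄⟩ := (ihM hM.1).two (ihN hM.2) f S
      (fun x hx => h x (by simp [Expr.fv, hx])) (fun x hx => h x (by simp [Expr.fv, hx]))
    exact ⟨.app M' N', .app h₁ h₂, h₃, h₄⟩
  | pair M N ihM ihN =>
    intro f S h
    obtain ⟨M', N', h₁, h₂, h₃, h₄⟩ := (ihM hM.1).two (ihN hM.2) f S
      (fun x hx => h x (by simp [Expr.fv, hx])) (fun x hx => h x (by simp [Expr.fv, hx]))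
    exact ⟨.pair M' N', .pair h₁ h₂, h₃, h₄⟩
  | bullet => intro f S h; exact ⟨.bullet, .bullet, by simp [Expr.binders], by simp [Expr.binders]⟩
  | prj i M ih =>
    intro f S h
    obtain ⟨M', h₁, h₂, h₃⟩ := ih hM f S h
    exact ⟨.prj i M', .prj h₁, h₂, h₃⟩
  | letrec D N ihD ihN =>
    intro f S h
    obtain ⟨hn, hD, hN⟩ := hM
    rw [wfRhs_iff] at hD
    obtain ⟨l, hl₁, hl₂, hl₃⟩ := exists_fresh_list S D.length
    -- The names of the block go to the entries of `l` in order; the default `0` is never reached,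
    -- as both lists have the same length.
    let g : Var → Var := fun z => if z ∈ names D then l.getD ((names D).idxOf z) 0 else f z
    have hg : ∀ i (hi : i < D.length), g (D[i]).1 = l[i]'(hl₁ ▸ hi) := by
      intro i hi
      have hi' : i < (names D).length := by simpa using hi
      have e : D[i].1 = (names D)[i] := by simp
      simp only [g, e, List.getElem_mem, if_true, hn.idxOf_getElem]
      rw [List.getD_eq_getElem]
    have hgl : ∀ z ∈ names D, g z ∈ l := by
      intro z hz
      obtain ⟨i, hi, rfl⟩ := List.getElem_of_mem hz
      have := hg i (by simpa using hi)
      simp only [names, List.getElem_map] at this ⊢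
      rw [this]; exact List.getElem_mem _
    have hgS : ∀ z, (z ∈ (Expr.letrec D N).fv ∨ z ∈ names D) → g z ∈ S ∪ l.toFinset := by
      intro z hz
      by_cases e : z ∈ names D
      · simp [hgl z e]
      · simp only [g, e, if_false]
        simp [h z (hz.resolve_right e)]
    have hfvD : ∀ p ∈ D, ∀ z ∈ p.2.fv, z ∈ (Expr.letrec D N).fv ∨ z ∈ names D := by
      intro p hp z hz
      rw [mem_fv_letrec]
      by_cases e : z ∈ names D
      · exact .inr e
      · exact .inl ⟨.inl ⟨p, hp, hz⟩, e⟩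
    have hfvN : ∀ z ∈ N.fv, z ∈ (Expr.letrec D N).fv ∨ z ∈ names D := by
      intro z hz
      rw [mem_fv_letrec]
      by_cases e : z ∈ names D
      · exact .inr e
      · exact .inl ⟨.inr hz, e⟩
    obtain ⟨L, k₁, k₂, k₃, k₄, k₅⟩ := HasRep.block (fun p hp => ihD p hp (hD p hp)) g
      (S ∪ l.toFinset) (fun p hp z hz => hgS z (hfvD p hp z hz)) l hl₁ hl₂ (by simp +contextual)
    obtain ⟨N', l₁, l₂, l₃⟩ := ihN hN g
      (S ∪ l.toFinset ∪ (bindersDefs (L.map Prod.snd)).toFinset) (fun z hz => by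
        have := hgS z (hfvN z hz)
        rw [Finset.mem_union]; exact .inl this)
    have hL : ∀ q ∈ L, q.2.1 = g q.1.1 := by
      intro q hq
      obtain ⟨i, hi, rfl⟩ := List.getElem_of_mem hq
      have hi' : i < D.length := by rw [← k₁]; simpa using hi
      have e₁ : D[i] = L[i].1 := by simp [← k₁]
      rw [← e₁, hg i hi']
      simp [← k₂]
    have hbd : ∀ z, (z ∈ (Expr.letrec D N).fv ∨ z ∈ names D) → ∀ w, w = g z →
        Bd (pnames L) (fun x y => y = f x) z w := by
      intro z hz w hw
      by_cases e : z ∈ names D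
      · left
        rw [← k₁] at e
        obtain ⟨q, hq, hq'⟩ : ∃ q ∈ L, q.1.1 = z := by simpa [names] using e
        refine List.mem_map.2 ⟨q, hq, ?_⟩
        rw [hL q hq, hq', hw]
      · right
        have hgz : g z = f z := by simp [g, e]
        refine ⟨?_, ?_, hw.trans hgz⟩
        · rintro p hp rfl
          obtain ⟨q, hq, rfl⟩ := List.mem_map.1 hp
          exact e (by rw [← k₁]; simpa [names] using ⟨_, _, _, hq⟩)
        · rintro p hp rfl
          obtain ⟨q, hq, rfl⟩ := List.mem_map.1 hp
          refine hl₃ q.2.1 ?_ ?_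
          · rw [← k₂]; simpa [names] using ⟨_, _, _, hq⟩
          · simp only at hw
            rw [hw, hgz]
            exact h z (hz.resolve_right e)
    refine ⟨.letrec (L.map Prod.snd) N', .letrec L hn (k₂ ▸ hl₂) (k₁ ▸ .rfl) .rfl ?_ ?_, ?_, ?_⟩
    · intro q hq
      have hq' : q.1 ∈ D := by rw [← k₁]; exact List.mem_map_of_mem hq
      exact (k₃ q hq).mono fun z hz w _ hw => hbd z (hfvD _ hq' z hz) w hw
    · exact l₁.mono fun z hz w _ hw => hbd z (hfvN z hz) w hw
    · simp only [Expr.binders, List.nodup_append']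
      exact ⟨k₄, l₂, fun z hz hz' => l₃ z hz' (by simp [hz])⟩
    · intro z hz
      simp only [Expr.binders, List.mem_append] at hz
      rcases hz with hz | hz
      · rcases k₅ z hz with hz | hz
        · exact hl₃ z hz
        · exact fun h => hz (by simp [h])
      · exact fun h => l₃ z hz (by simp [h])

theorem exists_canonical {M : Expr} (hM : M.WF) : ∃ M', M'.Canonical ∧ AlphaEq M M' := by
  obtain ⟨M', h₁, h₂, h₃⟩ := hasRep hM id M.fv fun x hx => hx
  have h : AEq Eq M M' := h₁.mono fun _ _ _ _ e => e.symm
  exact ⟨M', ⟨h₂, fun x hx => h.fv_eq ▸ h₃ x hx⟩, alphaEq_iff.2 h⟩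

/-! ### Reordering of blocks -/

/-- α-equivalence with the same multiset of binders. -/
def PE (M N : Expr) : Prop := AEq Eq M N ∧ M.binders.Perm N.binders

theorem PE.refl {M : Expr} (h : M.WF) : PE M M := ⟨.refl h fun _ _ => rfl, .rfl⟩

theorem PE.trans {M N P : Expr} (h : PE M N) (h' : PE N P) : PE M P :=
  ⟨alphaEq_iff.1 ((alphaEq_iff.2 h.1).trans (alphaEq_iff.2 h'.1)), h.2.trans h'.2⟩

theorem PE.app {M M' N N' : Expr} (h : PE M M') (h' : PE N N') : PE (.app M N) (.app M' N') :=
  ⟨.app h.1 h'.1, h.2.append h'.2⟩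

theorem PE.pair {M M' N N' : Expr} (h : PE M M') (h' : PE N N') :
    PE (.pair M N) (.pair M' N') :=
  ⟨.pair h.1 h'.1, h.2.append h'.2⟩

theorem PE.prj {i : Fin 2} {M M' : Expr} (h : PE M M') : PE (.prj i M) (.prj i M') :=
  ⟨.prj h.1, h.2⟩

/-- Blocks with the same names and equivalent right-hand sides, up to order. -/
def BE (B D : Defs) : Prop :=
  Relation.Comp (List.Forall₂ fun p q => p.1 = q.1 ∧ PE p.2 q.2) List.Perm B D

theorem BE.refl {D : Defs} (h : ∀ p ∈ D, p.2.WF) : BE D D :=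
  ⟨D, List.forall₂_same.2 fun p hp => ⟨rfl, .refl (h p hp)⟩, .rfl⟩

theorem BE.perm {B B' D : Defs} (h : BE B D) (hB : B'.Perm B) : BE B' D := by
  obtain ⟨D', h₁, h₂⟩ := h
  obtain ⟨D'', k₁, k₂⟩ := List.perm_comp_forall₂ hB h₁
  exact ⟨D'', k₁, k₂.trans h₂⟩

theorem BE.replace {B D : Defs} {x : Var} {M N : Expr} (h : BE ((x, N) :: B) D) (hM : PE M N) :
    BE ((x, M) :: B) D := by
  obtain ⟨D', h₁, h₂⟩ := h
  cases h₁ with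
  | cons k l => exact ⟨_, .cons ⟨k.1, hM.trans k.2⟩ l, h₂⟩

theorem BE.names {B D : Defs} (h : BE B D) : (names B).Perm (names D) := by
  obtain ⟨D', h₁, h₂⟩ := h
  have e : NeedRec.names B = NeedRec.names D' := by
    clear h₂
    induction h₁ with
    | nil => rfl
    | cons k _ ih => simp only [NeedRec.names, List.map_cons, k.1] at ih ⊢; rw [ih]
  rw [e]
  exact h₂.map _

/-- Contexts and rules display their bindings in a fixed order, so a block has to be rearranged
before a redex becomes visible. Names are kept, hence the binders only change their order and
canonicity is preserved. -/
theorem PE.letrec {B D : Defs} {M N : Expr} (hB : BE B D) (hD : (names D).Nodup) (h : PE M N) :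
    PE (.letrec B M) (.letrec D N) := by
  have hnB : (names B).Nodup := hB.names.nodup_iff.2 hD
  obtain ⟨D', h₁, h₂⟩ := hB
  have hlen := h₁.length_eq
  have e₁ : (B.zip D').map Prod.fst = B := List.map_fst_zip hlen.le
  have e₂ : (B.zip D').map Prod.snd = D' := List.map_snd_zip hlen.ge
  have hz : ∀ q ∈ B.zip D', q.1.1 = q.2.1 ∧ PE q.1.2 q.2.2 := fun q hq =>
    (List.forall₂_iff_zip.1 h₁).2 hq
  have hbd : ∀ x y, x = y → Bd (pnames (B.zip D')) Eq x y := by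
    rintro x _ rfl
    by_cases hx : x ∈ names B
    · left
      rw [← e₁] at hx
      obtain ⟨q, hq, hq'⟩ : ∃ q ∈ B.zip D', q.1.1 = x := by simpa [names] using hx
      exact List.mem_map.2 ⟨q, hq, by rw [← (hz q hq).1, hq']⟩
    · have : ∀ q ∈ B.zip D', q.1.1 ≠ x := by
        rintro q hq rfl
        refine hx ?_
        rw [← e₁]
        simpa [names] using ⟨_, _, _, hq⟩
      refine .inr ⟨?_, ?_, rfl⟩
      · intro p hp
        obtain ⟨q, hq, rfl⟩ := List.mem_map.1 hp
        exact this q hq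
      · intro p hp
        obtain ⟨q, hq, rfl⟩ := List.mem_map.1 hp
        exact (hz q hq).1 ▸ this q hq
  refine ⟨.letrec (B.zip D') hnB hD (.of_eq e₁) (e₂.symm ▸ h₂) ?_ ?_, ?_⟩
  · exact fun q hq => (hz q hq).2.1.mono fun x _ y _ => hbd x y
  · exact h.1.mono fun x _ y _ => hbd x y
  · refine List.Perm.append (.trans ?_ (bindersDefs_perm h₂)) h.2
    clear * - h₁
    induction h₁ with
    | nil => exact .rfl
    | @cons p q _ _ k _ ih =>
      obtain ⟨x, M⟩ := p
      obtain ⟨y, N⟩ := q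
      obtain ⟨rfl, k⟩ := k
      exact (k.2.append ih).cons _

/-! ### Progress -/

/-- Expressions that neither are redexes nor have a value. -/
inductive Stuck : Expr → Prop
  | prj_lam (i : Fin 2) (x : Var) (M : Expr) : Stuck (.prj i (.lam x M))
  | prj_bullet (i : Fin 2) : Stuck (.prj i .bullet)
  | app_pair {V W : Expr} (N : Expr) : IsValue V → IsValue W → Stuck (.app (.pair V W) N)

/-- The machine arrives at a value below a frame that does not accept it; this state is final but
its stack is not empty. -/
theorem Stuck.not_halts {M : Expr} (hM : Stuck M) {h h' : List Code} {K : List Frame} {e : Env}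
    {c : ℕ} {v : Val} (hh : Halts ⟨h, K, .thunk M e⟩ c h' v) : False := by
  have key : ∃ c F w, Run c ⟨h, K, .thunk M e⟩ ⟨h, F :: K, .val w⟩ ∧
      Final ⟨h, F :: K, .val w⟩ := by
    cases hM with
    | prj_lam i x M =>
      refine ⟨_, _, _, .head .prj (run_value (.lam x M) _ _ _), fun _ _ k => ?_⟩
      generalize hv : valOf (.lam x M) e = v at k
      cases k
      cases hv
    | prj_bullet i =>
      exact ⟨_, _, _, .head .prj (run_value .bullet _ _ _), final_prj_bul⟩
    | app_pair N hV hW =>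
      exact ⟨_, _, _, .head .app (run_value (.pair hV hW) _ _ _), fun _ _ k => by cases k⟩
  obtain ⟨c', F, w, hr, hf⟩ := key
  obtain ⟨j, -, hj⟩ := hh.to_final hr hf
  have := (hj.of_final (final_halt h' v)).2
  cases this

/-- Redexes and stuck expressions. -/
def Redex (M : Expr) : Prop := (∃ N, Contract M N) ∨ Stuck M

/-- `M` is an answer, or has a redex or a free variable in evaluation position. -/
def Prog (M : Expr) : Prop :=
  IsAnswer M ∨ (∃ (E : Ctx) (M' : Expr), Redex M' ∧ PE (E.plug M') M) ∨
    ∃ (E : Ctx) (x : Var), x ∉ E.capt ∧ PE (E.plug (.var x)) M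

theorem Prog.redex {M' M : Expr} (h : Redex M') (h' : PE M' M) : Prog M :=
  .inr (.inl ⟨.hole, M', h, h'⟩)

theorem Prog.contract {M' M N' : Expr} (h : Contract M' N') (h' : PE M' M) : Prog M :=
  .redex (.inl ⟨N', h⟩) h'

/-- The two outcomes are the two cyclic rules: the cycle closes at the head of the chain, or at a
later link, with a path leading to it. -/
theorem Dep.split (Δ : Dep) {w : Var} (hw : w ∈ Δ.names) :
    Δ.head = w ∨ ∃ Δ₁ Δ₂ : Dep, Δ = Δ₁.append Δ₂ ∧ Δ₂.head = w := by
  match Δ with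
  | .base x E => left; simpa [Dep.names, Dep.head, eq_comm] using hw
  | .snoc Δ x E =>
    simp only [Dep.names, List.mem_append, List.mem_singleton] at hw
    rcases hw with hw | rfl
    · rcases Dep.split Δ hw with h | ⟨Δ₁, Δ₂, rfl, h⟩
      · exact .inl h
      · exact .inr ⟨Δ₁, .snoc Δ₂ x E, rfl, h⟩
    · exact .inr ⟨Δ, .base w E, rfl, rfl⟩

theorem exists_perm_cons {D : Defs} {x : Var} (h : x ∈ names D) :
    ∃ M D', D.Perm ((x, M) :: D') := by
  obtain ⟨M, hM⟩ := mem_names.1 h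
  obtain ⟨s, t, rfl⟩ := List.append_of_mem hM
  exact ⟨M, s ++ t, List.perm_middle⟩

/-- Follows the needed variables through the block: `Δ` is the chain so far, `w` the variable needed
at its end, `B` the bindings not yet visited. If `w` is on the chain there is a cycle. Otherwise its
binding is an answer, contains a redex, needs a variable from outside, or prolongs the chain while
`B` shrinks. -/
theorem prog_dep {D : Defs} {N : Expr} {E : Ctx} (hD : (names D).Nodup) (n : ℕ) :
    ∀ (Δ : Dep) (B : Defs) (w : Var), B.length = n → BE (Δ.plug (.var w) ++ B) D →
      (∀ p ∈ B, Prog p.2) → w ∈ names D → PE (E.plug (.var Δ.head)) N →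
      Prog (.letrec D N) := by
  induction n using Nat.strong_induction_on with
  | _ n ih =>
  intro Δ B w hn hB hp hw hN
  by_cases hwΔ : w ∈ Δ.names
  · rcases Δ.split hwΔ with rfl | ⟨Δ₁, Δ₂, rfl, rfl⟩
    · exact .contract (.error Δ B E) (.letrec hB hD hN)
    · rw [Dep.plug_append] at hB
      rw [Dep.head_append] at hN
      exact .contract (.error_env Δ₂ Δ₁ B E)
        (.letrec (hB.perm (List.perm_append_comm.append_right B)) hD hN)
  have hwB : w ∈ names B := by
    have := hB.names.mem_iff.2 hw
    rw [names, List.map_append, List.mem_append] at this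
    exact this.resolve_left fun h => hwΔ (Dep.names_plug Δ _ ▸ h)
  obtain ⟨R, B', hBB'⟩ := exists_perm_cons hwB
  have hB₁ : BE (Δ.plug (.var w) ++ (w, R) :: B') D := hB.perm (hBB'.symm.append_left _)
  have hB₂ : BE ((w, R) :: (Δ.plug (.var w) ++ B')) D := hB₁.perm List.perm_middle.symm
  rcases hp (w, R) (hBB'.mem_iff.2 List.mem_cons_self) with hR | ⟨E₁, M', hM', hR⟩ |
    ⟨E₁, v, hv, hR⟩
  · cases hR with
    | value hV => exact .contract (.deref_env Δ w R B' E hV) (.letrec hB₁ hD hN)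
    | letrec D₁ hA => exact .contract (.assoc_env w D₁ _ Δ B' E hA) (.letrec hB₂ hD hN)
  · exact .inr (.inl ⟨.letDep w E₁ Δ B' E, M', hM', .letrec (hB₂.replace hR) hD hN⟩)
  · by_cases hvD : v ∈ names D
    · refine ih B'.length ?_ (.snoc Δ w E₁) B' v rfl ?_ ?_ hvD hN
      · rw [← hn, hBB'.length_eq]; simp
      · simpa [Dep.plug] using (hB₂.replace hR).perm List.perm_middle
      · exact fun p h => hp p (hBB'.mem_iff.2 (List.mem_cons_of_mem _ h))
    · refine .inr (.inr ⟨.letDep w E₁ Δ B' E, v, ?_, .letrec (hB₂.replace hR) hD hN⟩)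
      rw [← hB₂.names.mem_iff] at hvD
      simp only [names, List.map_cons, List.map_append, ← Dep.names_plug Δ (.var w),
        Ctx.capt, List.mem_cons, List.mem_append, not_or] at hvD ⊢
      exact ⟨hvD.1, hvD.2, hv⟩

theorem prog_letrec {D : Defs} {N : Expr} {E : Ctx} {w : Var} (hD : (names D).Nodup)
    (hwf : ∀ p ∈ D, p.2.WF) (hp : ∀ p ∈ D, Prog p.2) (hw : w ∈ names D)
    (hN : PE (E.plug (.var w)) N) : Prog (.letrec D N) := by
  obtain ⟨R, B, hDB⟩ := exists_perm_cons hw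
  have hB : BE ((w, R) :: B) D := (BE.refl hwf).perm hDB.symm
  rcases hp (w, R) (hDB.mem_iff.2 List.mem_cons_self) with hR | ⟨E₁, M', hM', hR⟩ |
    ⟨E₁, v, hv, hR⟩
  · cases hR with
    | value hV => exact .contract (.deref w R B E hV) (.letrec hB hD hN)
    | letrec D₁ hA => exact .contract (.assoc w D₁ _ B E hA) (.letrec hB hD hN)
  · exact .inr (.inl ⟨.letBind w E₁ B E, M', hM', .letrec (hB.replace hR) hD hN⟩)
  · by_cases hvD : v ∈ names D
    · exact prog_dep hD B.length (.base w E₁) B v rfl (hB.replace hR)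
        (fun p h => hp p (hDB.mem_iff.2 (List.mem_cons_of_mem _ h))) hvD hN
    · refine .inr (.inr ⟨.letBind w E₁ B E, v, ?_, .letrec (hB.replace hR) hD hN⟩)
      rw [← hB.names.mem_iff] at hvD
      simp only [names, List.map_cons, Ctx.capt, List.mem_cons, List.mem_append, not_or] at hvD ⊢
      exact ⟨hvD.1, hvD.2, hv⟩

/-- A variable in evaluation position is passed outwards until a block binds it; there the search
through the block takes over. -/
theorem prog {M : Expr} (hM : M.WF) : Prog M := by
  induction M using Expr.ind with
  | var x => exact .inr (.inr ⟨.hole, x, by simp [Ctx.capt], .refl hM⟩)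
  | lam x M ih => exact .inl (.value (.lam x M))
  | bullet => exact .inl (.value .bullet)
  | app M N ihM ihN =>
    rcases ihM hM.1 with hR | ⟨E, M', hM', hR⟩ | ⟨E, v, hv, hR⟩
    · cases hR with
      | value hV =>
        cases hV with
        | lam x M => exact .contract (.beta_need x M N) (.refl hM)
        | bullet => exact .contract (.error_beta N) (.refl hM)
        | pair hV hW => exact .redex (.inr (.app_pair N hV hW)) (.refl hM)
      | letrec D hA => exact .contract (.lift D _ N hA) (.refl hM)
    · exact .inr (.inl ⟨.app E N, M', hM', hR.app (.refl hM.2)⟩)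
    · exact .inr (.inr ⟨.app E N, v, hv, hR.app (.refl hM.2)⟩)
  | pair M N ihM ihN =>
    rcases ihM hM.1 with hR | ⟨E, M', hM', hR⟩ | ⟨E, v, hv, hR⟩
    · cases hR with
      | value hV =>
        rcases ihN hM.2 with hS | ⟨E, M', hM', hS⟩ | ⟨E, v, hv, hS⟩
        · cases hS with
          | value hW => exact .inl (.value (.pair hV hW))
          | letrec D hA => exact .contract (.lift_pair₂ M D _ hV hA) (.refl hM)
        · exact .inr (.inl ⟨.pairR M hV E, M', hM', (PE.refl hM.1).pair hS⟩)
        · exact .inr (.inr ⟨.pairR M hV E, v, hv, (PE.refl hM.1).pair hS⟩)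
      | letrec D hA => exact .contract (.lift_pair₁ D _ N hA) (.refl hM)
    · exact .inr (.inl ⟨.pairL E N, M', hM', hR.pair (.refl hM.2)⟩)
    · exact .inr (.inr ⟨.pairL E N, v, hv, hR.pair (.refl hM.2)⟩)
  | prj i M ih =>
    rcases ih hM with hR | ⟨E, M', hM', hR⟩ | ⟨E, v, hv, hR⟩
    · cases hR with
      | value hV =>
        cases hV with
        | lam x M => exact .redex (.inr (.prj_lam i x M)) (.refl hM)
        | bullet => exact .redex (.inr (.prj_bullet i)) (.refl hM)
        | @pair V W hV hW => exact .contract (.prj i ![V, W] hV hW) (.refl hM)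
      | letrec D hA => exact .contract (.lift_prj i D _ hA) (.refl hM)
    · exact .inr (.inl ⟨.prj i E, M', hM', hR.prj⟩)
    · exact .inr (.inr ⟨.prj i E, v, hv, hR.prj⟩)
  | letrec D N ihD ihN =>
    obtain ⟨hD, hwf, hN⟩ := hM
    rw [wfRhs_iff] at hwf
    have hB := BE.refl hwf
    rcases ihN hN with hR | ⟨E, M', hM', hR⟩ | ⟨E, v, hv, hR⟩
    · exact .inl (.letrec D hR)
    · exact .inr (.inl ⟨.letBody D E, M', hM', .letrec hB hD hR⟩)
    · by_cases hvD : v ∈ names D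
      · exact prog_letrec hD hwf (fun p hp => ihD p hp (hwf p hp)) hvD hR
      · refine .inr (.inr ⟨.letBody D E, v, ?_, .letrec hB hD hR⟩)
        simp only [Ctx.capt, List.mem_append, not_or]
        exact ⟨hvD, hv⟩

theorem mem_fv_plug {E : Ctx} {x : Var} (h : x ∉ E.capt) : x ∈ (E.plug (.var x)).fv := by
  match E with
  | .hole => simp [Ctx.plug, Expr.fv]
  | .app E N => simp [Ctx.plug, Expr.fv, mem_fv_plug (E := E) h]
  | .letBody D E =>
    simp only [Ctx.capt, List.mem_append, not_or] at h
    exact mem_fv_letrec.2 ⟨.inr (mem_fv_plug h.2), h.1⟩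
  | .letBind y E D E' =>
    simp only [Ctx.capt, List.mem_cons, List.mem_append, not_or] at h
    exact mem_fv_letrec.2 ⟨.inl ⟨_, List.mem_cons_self, mem_fv_plug h.2.2⟩, by simp [h.1, h.2.1]⟩
  | .letDep y E Δ D E' =>
    simp only [Ctx.capt, List.mem_cons, List.mem_append, not_or] at h
    refine mem_fv_letrec.2 ⟨.inl ⟨_, List.mem_cons_self, mem_fv_plug h.2.2⟩, ?_⟩
    have h' := h.2.1.1
    rw [← Dep.names_plug Δ (.var y)] at h'
    simp only [names, List.map_cons, List.map_append, List.mem_cons, List.mem_append, not_or]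
    exact ⟨h.1, h', h.2.1.2⟩
  | .pairL E N => simp [Ctx.plug, Expr.fv, mem_fv_plug (E := E) h]
  | .pairR V hV E => simp [Ctx.plug, Expr.fv, mem_fv_plug (E := E) h]
  | .prj i E => simpa [Ctx.plug, Expr.fv] using mem_fv_plug (E := E) h

/-- A program with a halting run is an answer or can be reduced. -/
theorem progress {M : Expr} (hM : M.IsProgram) {c : ℕ} {h : List Code} {v : Val}
    (hh : Halts (init M) c h v) : IsAnswer M ∨ ∃ N, Step M N := by
  obtain ⟨M₁, hcan, hα⟩ := exists_canonical hM.1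
  have hM₁ := hα.isProgram hM
  -- The reordered representative that displays the redex is still canonical, as `Step` requires.
  have can : ∀ {M'}, PE M' M₁ → M'.Canonical ∧ AlphaEq M M' := fun {M'} h =>
    ⟨⟨h.2.nodup_iff.2 hcan.1, fun x hx => by
      rw [h.1.fv_eq]; exact hcan.2 x (h.2.mem_iff.1 hx)⟩, hα.trans (alphaEq_iff.2 h.1).symm⟩
  rcases prog hM₁.1 with hA | ⟨E, M', hM' | hM', hR⟩ | ⟨E, x, hx, hR⟩
  · exact .inl ((alphaEq_iff.1 hα.symm).isAnswer hA)
  · obtain ⟨N', hN'⟩ := hM'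
    obtain ⟨h₁, h₂⟩ := can hR
    exact .inr ⟨E.plug N', E, M', N', hN', h₁, h₂,
      .refl (hN'.isProgram_plug h₁ (h₂.isProgram hM)).1⟩
  · obtain ⟨h₁, h₂⟩ := can hR
    obtain ⟨t, K, e, c', -, hc⟩ := loads h₁.1 (fun _ => 0) 0 0
    obtain ⟨H', v', β', k, -, -⟩ := (sRel_init h₂ hM.2).halts hh
    obtain ⟨_, -, k'⟩ := (hc M' [] [] rfl rfl).halts k
    exact (hM'.not_halts k').elim
  · have := mem_fv_plug hx
    rw [hR.1.fv_eq, hM₁.2] at this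
    simp at this

/-! ### From heaps to frames -/

/-- An answer runs to a state from which it can be read back, with the names of any related
heap. -/
theorem readback {A : Expr} (hA : IsAnswer A) : ∀ (e : Env) (h : List Code), A.WF →
    (∀ x ∈ A.fv, e x < h.length) → ∃ (c : ℕ) (t : List Code) (v : Val),
      Run c ⟨h, [], .thunk A e⟩ ⟨h ++ t, [], .val v⟩ ∧
      ∀ (Ψ : Heap) (β : ℕ → ℕ → Prop) (V : Expr), HRel β ∅ (raw Ψ) (lk (h ++ t)) →
        VRel β (valOf V id) v → IsValue V → ∃ Θ : Letrecs, (names Θ.bindings).Nodup ∧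
          (∀ x M, (x, M) ∈ Θ.bindings ↔ Ψ x = some M ∧ ∃ l, h.length ≤ l ∧ β x l) ∧
          AEq (fun x y => β x (e y) ∧ e y < h.length) (Θ.plug V) A := by
  induction hA with
  | @value W hW =>
    intro e h hwf hfv
    refine ⟨0, [], valOf W e, by simpa using run_value hW h [] e, fun Ψ β V hh hv hV => ?_⟩
    rw [List.append_nil] at hh
    have hlt : ∀ {x l}, β x l → l < h.length := fun k => by
      obtain ⟨_, _, -, k, -⟩ := hh.rel k
      exact lk_lt k
    refine ⟨[], by simp [Letrecs.bindings], fun x M => ?_, ?_⟩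
    · simp only [Letrecs.bindings, List.flatten_nil, List.not_mem_nil, false_iff, not_and,
        not_exists]
      exact fun _ l hl k => absurd (hlt k) (by omega)
    · exact ((vrel_valOf hV hW).1 hv).mono fun x _ y _ k => ⟨k, hlt k⟩
  | @letrec D A hA ih =>
    intro e h hwf hfv
    obtain ⟨hD, hDwf, hAwf⟩ := hwf
    set e₁ := ext e (names D) h.length with he₁
    set h₁ := h ++ codes D e₁ with hh₁
    have hlen : h₁.length = h.length + D.length := by simp [hh₁, codes]
    have hmem : ∀ x ∈ names D, h.length ≤ e₁ x ∧ e₁ x < h₁.length := fun x hx => by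
      have := ext_lt (e := e) (n := h.length) hx
      rw [hlen]; simpa using this
    have hnot : ∀ x, x ∉ names D → e₁ x = e x := fun x hx => ext_of_not_mem hx
    obtain ⟨c, t, v, hr, hback⟩ := ih e₁ h₁ hAwf (fun x hx => by
      by_cases hn : x ∈ names D
      · exact (hmem x hn).2
      · have := hfv x (mem_fv_letrec.2 ⟨.inr hx, hn⟩)
        rw [hnot x hn]; omega)
    refine ⟨_, codes D e₁ ++ t, v, .head .letrec (by simpa [hh₁, he₁] using hr),
      fun Ψ β V hh hv hV => ?_⟩
    rw [← List.append_assoc, ← hh₁] at hh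
    obtain ⟨Θ, k₁, k₂, k₃⟩ := hback Ψ β V hh hv hV
    -- The cells of the outermost frame keep their contents to the end of the run, so each has a
    -- counterpart in `Ψ` that supplies the name and the right-hand side for the frame.
    have hex : ∀ p ∈ D, ∃ q : Var × Expr, β q.1 (e₁ p.1) ∧ Ψ q.1 = some q.2 ∧
        AEq (fun a b => β a (e₁ b)) q.2 p.2 := by
      rintro ⟨y, R⟩ hp
      have hl : lk (h₁ ++ t) (e₁ y) = some (code R e₁) := by
        have := lk_codes hD hp h e₁ e
        rw [← this]
        exact List.getElem?_append_left (hmem y (mem_names.2 ⟨R, hp⟩)).2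
      obtain ⟨x, hx⟩ := hh.totr hl (by simp)
      obtain ⟨c, d, h₁, h₂, h₃⟩ := hh.rel hx
      rw [hl, Option.some_inj] at h₂
      subst h₂
      obtain ⟨M, hM, rfl⟩ := exists_of_raw h₁
      exact ⟨(x, M), hx, hM, crel_code.1 h₃⟩
    choose! g hg₁ hg₂ hg₃ using hex
    have hinj : ∀ p ∈ D, ∀ q ∈ D, (g p).1 = (g q).1 → p = q := fun p hp q hq k =>
      eq_of_nodup_map hD hp hq (ext_inj (mem_names.2 ⟨p.2, hp⟩) (mem_names.2 ⟨q.2, hq⟩)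
        ((hh.bij (hg₁ p hp) (hg₁ q hq)).1 k))
    have hnd : (names (D.map g)).Nodup := by
      rw [names, List.map_map]
      exact (List.Nodup.of_map _ hD).map_on fun p hp q hq => hinj p hp q hq
    have hloc : ∀ p ∈ D, h.length ≤ e₁ p.1 ∧ e₁ p.1 < h₁.length :=
      fun p hp => hmem _ (mem_names.2 ⟨p.2, hp⟩)
    have hbd : ∀ (P : Expr), (∀ y ∈ P.fv, y ∉ names D → e y < h.length) → ∀ y ∈ P.fv, ∀ x,
        β x (e₁ y) → Bd (pnames (D.map fun p => (g p, p)))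
          (fun x y => β x (e y) ∧ e y < h.length) x y := by
      intro P hP y hy x hx
      by_cases hn : y ∈ names D
      · left
        obtain ⟨R, hR⟩ := mem_names.1 hn
        refine List.mem_map.2 ⟨(g (y, R), (y, R)), List.mem_map.2 ⟨_, hR, rfl⟩, ?_⟩
        rw [(hh.bij (hg₁ _ hR) hx).2 rfl]
      -- A variable free in the frame points below `h.length`, while all cells of the frame lie
      -- above; so the new names do not capture it.
      · have hlt := hP y hy hn
        rw [hnot y hn] at hx
        refine .inr ⟨?_, ?_, hx, hlt⟩
        · rintro _ hp rfl
          obtain ⟨_, hp', rfl⟩ := List.mem_map.1 hp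
          obtain ⟨q, hq, rfl⟩ := List.mem_map.1 hp'
          have := (hh.bij (hg₁ q hq) hx).1 rfl
          have := hloc q hq
          omega
        · rintro _ hp rfl
          obtain ⟨_, hp', rfl⟩ := List.mem_map.1 hp
          obtain ⟨q, hq, rfl⟩ := List.mem_map.1 hp'
          exact hn (mem_names.2 ⟨q.2, hq⟩)
    refine ⟨D.map g :: Θ, ?_, fun x M => ?_, ?_⟩
    · simp only [Letrecs.bindings, List.flatten_cons, names, List.map_append]
      refine List.nodup_append'.2 ⟨hnd, k₁, fun x hx hx' => ?_⟩
      obtain ⟨M, hM⟩ := mem_names.1 hx'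
      obtain ⟨-, l, hl, hxl⟩ := (k₂ x M).1 hM
      obtain ⟨_, hq, rfl⟩ := List.mem_map.1 hx
      obtain ⟨p, hp, rfl⟩ := List.mem_map.1 hq
      have := (hh.bij (hg₁ p hp) hxl).1 rfl
      have := hloc p hp
      omega
    · have : Letrecs.bindings (D.map g :: Θ) = D.map g ++ Letrecs.bindings Θ := by
        simp [Letrecs.bindings]
      rw [this, List.mem_append, k₂]
      constructor
      · rintro (hx | ⟨hx, l, hl, hxl⟩)
        · obtain ⟨p, hp, hpx⟩ := List.mem_map.1 hx
          have h₁ := hg₁ p hp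
          have h₂ := hg₂ p hp
          rw [hpx] at h₁ h₂
          exact ⟨h₂, _, (hloc p hp).1, h₁⟩
        · exact ⟨hx, l, by omega, hxl⟩
      · rintro ⟨hx, l, hl, hxl⟩
        -- Later locations belong to the inner frames; the others are the cells of this block, at
        -- offset `l - h.length`.
        by_cases hl' : h₁.length ≤ l
        · exact .inr ⟨hx, l, hl', hxl⟩
        · left
          have hi : l - h.length < D.length := by omega
          have hp : D[l - h.length] ∈ D := List.getElem_mem _
          have hloc' : e₁ D[l - h.length].1 = l := by
            have hi' : l - h.length < (names D).length := by simpa using hi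
            have e' : D[l - h.length].1 = (names D)[l - h.length] := by simp
            rw [he₁, e', ext_of_mem (List.getElem_mem _), hD.idxOf_getElem]; omega
          have h₁ := hg₁ _ hp
          rw [hloc'] at h₁
          have h₂ := hg₂ _ hp
          obtain rfl := (hh.bij h₁ hxl).2 rfl
          rw [hx, Option.some_inj] at h₂
          exact List.mem_map.2 ⟨_, hp, by rw [h₂]⟩
    · refine .letrec (D.map fun p => (g p, p)) hnd hD (.of_eq (by simp [Function.comp_def]))
        (.of_eq (by simp [Function.comp_def])) ?_ ?_
      · intro q hq
        obtain ⟨p, hp, rfl⟩ := List.mem_map.1 hq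
        exact (hg₃ p hp).mono fun x _ y hy k => hbd p.2 (fun y hy hn =>
          hfv y (mem_fv_letrec.2 ⟨.inl ⟨p, hp, hy⟩, hn⟩)) y hy x k
      · exact k₃.mono fun x _ y hy k => hbd A (fun y hy hn =>
          hfv y (mem_fv_letrec.2 ⟨.inr hy, hn⟩)) y hy x k.1

/-- Starting from the empty heap, every cell belongs to some frame, so the frames exhaust `Ψ`. -/
theorem readback_program {A : Expr} (hA : IsAnswer A) (hp : A.IsProgram) :
    ∃ (c : ℕ) (h : List Code) (v : Val), Halts (init A) c h v ∧
      ∀ (Ψ : Heap) (β : ℕ → ℕ → Prop) (V : Expr), HRel β ∅ (raw Ψ) (lk h) →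
        VRel β (valOf V id) v → IsValue V → ∃ Θ : Letrecs, Θ.HasHeap Ψ ∧
          AlphaEq (Θ.plug V) A := by
  obtain ⟨c, t, v, hr, hb⟩ := readback hA (fun _ => 0) [] hp.1 (by simp [hp.2])
  refine ⟨c, t, v, hr, fun Ψ β V hh hv hV => ?_⟩
  obtain ⟨Θ, h₁, h₂, h₃⟩ := hb Ψ β V hh hv hV
  refine ⟨Θ, ⟨h₁, fun x M => ?_⟩, alphaEq_iff.2 (h₃.mono fun x _ y hy => by simp [hp.2] at hy)⟩
  rw [h₂]
  refine ⟨fun h => ⟨h, ?_⟩, fun h => h.1⟩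
  obtain ⟨l, hl⟩ := hh.totl (raw_some h)
  exact ⟨l, by simp, hl⟩

/-! ### Equivalence of the two semantics -/

theorem Sim.of_reflTransGen {M N : Expr} (h : Relation.ReflTransGen Step M N)
    (hM : M.IsProgram) : N.IsProgram ∧ ∃ k, Sim k (init M) (init N) := by
  induction h with
  | refl => exact ⟨hM, 0, .of_sRel (sRel_init (.refl hM.1) hM.2)⟩
  | tail _ hs ih =>
    obtain ⟨hN, k, hk⟩ := ih
    obtain ⟨hP, hs⟩ := hs.sim hN
    exact ⟨hP, _, hk.trans hs⟩

theorem hrel_empty : HRel (fun _ _ => False) ∅ (raw Heap.empty) (lk []) where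
  bij := nofun
  rel := nofun
  totl := fun h => by simp [raw, Heap.empty] at h
  totr := fun h => by simp [lk] at h
  excl := fun h => by simp at h
  dom := fun h => by simp at h

theorem Expr.IsProgram.aeq_refl {M : Expr} (hM : M.IsProgram) {R : Var → Var → Prop} :
    AEq R M M :=
  .refl hM.1 fun x hx => by simp [hM.2] at hx

/-- The answer halts, and simulation carries halting back to `M`. The derivation extracted from the
run of `M` provides `Ψ` and `V`, and the answer is read back with these names. -/
theorem eval_of_reduces {M A : Expr} (hM : M.IsProgram) (hA : IsAnswer A) (h : Reduces M A) :
    ∃ (Θ : Letrecs) (V : Expr) (Ψ : Heap),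
      IsValue V ∧ AlphaEq (Θ.plug V) A ∧ Θ.HasHeap Ψ ∧ Eval Heap.empty M Ψ V := by
  obtain ⟨N, hMN, hNA⟩ := h
  obtain ⟨hN, k, hk⟩ := Sim.of_reflTransGen hMN hM
  obtain ⟨c, H, v, hh, hb⟩ := readback_program hA (hNA.isProgram hN)
  obtain ⟨c', H', v', β, ⟨n, hs⟩, hβ, hv⟩ :=
    (hk.trans (Sim.of_sRel (sRel_init hNA hN.2))).2 _ _ _ hh
  obtain ⟨Ψ, V, β', H'', v'', n', c'', -, hs', hE, -, hβ', hv'⟩ :=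
    eval_of_steps n hs hrel_empty hM.aeq_refl
  have := (Run.of_final ⟨n', hs'⟩ (final_halt H'' v'')).2
  obtain ⟨rfl, -, hvv⟩ := State.mk.inj this
  obtain rfl := Code.val.inj hvv
  obtain ⟨Θ, h₁, h₂⟩ := hb Ψ _ V (hβ'.trans hβ)
    (hv'.trans (fun _ b _ k k' => ⟨b, k, k'⟩) hv) hE.isValue
  exact ⟨Θ, V, Ψ, hE.isValue, h₂, h₁, hE⟩

/-- Induction on the cost of the halting run, which every reduction step lowers. `Ψ` and `V` stay
fixed; only the relation to the final state is recomposed at each step. -/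
theorem reduces_of_halts {Ψ : Heap} {V : Expr} (hV : IsValue V) (c : ℕ) : ∀ {M : Expr}
    {h : List Code} {v : Val} {β : ℕ → ℕ → Prop}, M.IsProgram → Halts (init M) c h v →
    HRel β ∅ (raw Ψ) (lk h) → VRel β (valOf V id) v →
    ∃ Θ : Letrecs, Θ.HasHeap Ψ ∧ Reduces M (Θ.plug V) := by
  induction c using Nat.strong_induction_on with
  | _ c ih =>
  intro M h v β hM hh hβ hv
  rcases progress hM hh with hA | ⟨N, hMN⟩
  · obtain ⟨c', h', v', hh', hb⟩ := readback_program hA hM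
    -- By determinism the run of the answer used for reading back ends where the given run does.
    obtain ⟨_, -, hj⟩ := hh.to_final hh' (final_halt _ _)
    obtain ⟨rfl, -, hvv⟩ := State.mk.inj (hj.of_final (final_halt _ _)).2
    obtain rfl := Code.val.inj hvv
    obtain ⟨Θ, h₁, h₂⟩ := hb Ψ β V hβ hv hV
    exact ⟨Θ, h₁, M, .refl, h₂.symm⟩
  · obtain ⟨hN, hs⟩ := hMN.sim hM
    obtain ⟨c', h', v', γ, hh', hc, hγ, hv'⟩ := hs.1 _ _ _ hh
    obtain ⟨Θ, h₁, P, h₂, h₃⟩ := ih c' (by omega) hN hh' (hβ.trans hγ)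
      (hv.trans (fun _ b _ k k' => ⟨b, k, k'⟩) hv')
    exact ⟨Θ, h₁, P, .head hMN h₂, h₃⟩

theorem reduces_of_eval {M V : Expr} {Ψ : Heap} (hM : M.IsProgram) (h : Eval Heap.empty M Ψ V) :
    ∃ Θ : Letrecs, Θ.HasHeap Ψ ∧ Reduces M (Θ.plug V) := by
  obtain ⟨c, H, v, β, hr, -, hβ, hv⟩ := h.run [] (e := fun _ => 0) hrel_empty hM.aeq_refl
  exact reduces_of_halts h.isValue c hM hr hβ hv

end NeedRec

open NeedRec in
/-- Equivalence of the reduction semantics and the natural semantics for the call-by-need letrec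
calculus with pairs. -/
theorem mainTheorem4 (M : Expr) (hM : M.IsProgram) :
    (∀ A : Expr, IsAnswer A → Reduces M A →
      ∃ (Θ : Letrecs) (V : Expr) (Ψ : Heap),
        IsValue V ∧ AlphaEq (Θ.plug V) A ∧ Θ.HasHeap Ψ ∧ Eval Heap.empty M Ψ V) ∧
    (∀ (Ψ : Heap) (V : Expr), Eval Heap.empty M Ψ V →
      ∃ Θ : Letrecs, Θ.HasHeap Ψ ∧ Reduces M (Θ.plug V)) :=
  ⟨fun _ hA h => eval_of_reduces hM hA h, fun _ _ h => reduces_of_eval hM h⟩
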